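/- **Setting.** Let $\sigma,S,\lambda,\tau>0$ and $\rho=e^{-\tau/\lambda}\in(0,1)$. The observed log-price is $p_t=p^\star_t+\eta_t$, $t\ge 0$, where $p^\star$ is a Brownian motion with volatility $\sigma$ (with arbitrary starting value), $\eta_t=S(X_t-\tfrac12)$ with $X_t$ Bernoulli$(1/2)$, the processes $p^\star$ and $\eta$ are independent, and $\mathrm{corr}(\eta_s,\eta_t)=e^{-|t-s|/\lambda}$ for all $s,t\ge0$. Moreover, with $Y_t=2X_t-1\in\{-1,1\}$, for all times $t_0\le t_1\le t_2\le\dots$ the variables $Y_{t_0},\,Y_{t_0}Y_{t_1},\,Y_{t_1}Y_{t_2},\dots$ are mutually independent. For $n$ observations $p_0,p_\tau,\dots,p_{(n-1)\tau}$, an integer $L\ge1$ and $v\in\{1,2,3\}$ let $$\widehat V_v(n,L)=\frac1{k_v(n,L)}\sum_{i=0}^{k_v(n,L)-1}\bigl(p_{(a_v(i)+L)\tau}-p_{a_v(i)\tau}\bigr)^2,$$ with $a_1(i)=i$, $a_2(i)=iL$, $a_3(i)=i+iL$ and $k_1=n-L$, $k_2=\lfloor (n-1)/L\rfloor$, $k_3=\lfloor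 n/(L+1)\rfloor$. Put $$\widehat{S^2_{3,v}}(n,L,L',\rho)=\frac{2(L'\widehat V_v(n,L)-L\widehat V_v(n,L'))}{L'(1-\rho^L)-L(1-\rho^{L'})},\qquad \widehat{\rho^{L}}=\sqrt{\left|\frac{2\widehat V_v(n,2L)-\widehat V_v(n,4L)}{2\widehat V_v(n,L)-\widehat V_v(n,2L)}\right|}-1 .$$ Let $V(L\tau)=L\tau\sigma^2+\frac{S^2}2(1-e^{-L\tau/\lambda})$, $(\zeta_1(L),\zeta_2(L),\zeta_3(L))=(1,L,L+1)$, and for $v\in\{2,3\}$ $$\sigma_{3,v}^2(L)=2L^2\tau^2\sigma^4+\tfrac{S^4}4(1-e^{-2L\tau/\lambda})+2L\tau\sigma^2S^2(1-e^{-L\tau/\lambda}),$$ while $$\sigma_{3,1}^2(L)=\sigma_{3,2}^2(L)+\tfrac23\tau^2\sigma^4(L-1)L(2L-1)+\tfrac{S^4}2e^{-2L\tau/\lambda}\bigl(f_L(\tfrac{2\tau}\lambda)-L+1\bigr)+2\tau\sigma^2S^2\bigl(2e^{-L\tau/\lambda}f_L'(\tfrac\tau\lambda)-f_L'(-\tfrac\tau\lambda)-e^{-2L\tau/\lambda}f_L'(\tfrac\tau\lambda)\bigr),$$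 where $f_L(x)=\frac{e^x-e^{xL}}{1-e^x}$ and $f_L'(x)=\frac{e^x-Le^{xL}+(L-1)e^{x(L+1)}}{(1-e^x)^2}$ for $x\neq0$. **Theorem.** Let $v\in\{1,2,3\}$. (0) For all integers $L,L'\ge1$ the limit $r_{3,v}(L,L')=\lim_{n\to\infty}\mathrm{corr}(\widehat V_v(n,L),\widehat V_v(n,L'))$ exists. (1) For all integers $L,L'\ge1$ with $L\ne L'$: $\widehat{S^2_{3,v}}(n,L,L',\rho)$ is integrable with mean $S^2$ for every $n>\max(L,L')$; it converges to $S^2$ in probability as $n\to\infty$; and $\sqrt n\,(\widehat{S^2_{3,v}}(n,L,L',\rho)-S^2)$ converges in distribution to $\mathcal N(0,\gamma_{3,v}(L,L',\rho))$, where $$\gamma_{3,v}(L,L',\rho)=\frac{4\bigl[L'^2\zeta_v(L)\sigma_{3,v}^2(L)+L^2\zeta_v(L')\sigma_{3,v}^2(L')-2LL'\sqrt{\zeta_v(L)\zeta_v(L')}\,\sigma_{3,v}(L)\sigma_{3,v}(L')r_{3,v}(L,L')\bigr]}{(L'(1-\rho^L)-L(1-\rho^{L'}))^2}\ \ge 0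 .$$ (2) For all integers $L,L',L''\ge1$ with $L\neq L'$, the plug-in estimator $\widehat{S^2_{3,v}}(n,L,L',(\widehat{\rho^{L''}})^{1/L''})$ converges to $S^2$ in probability. (3) For every integer $L\ge1$, $\sqrt n\,\bigl(\widehat{S^2_{3,v}}(n,L,2L,(\widehat{\rho^{L}})^{1/L})-S^2\bigr)$ converges in distribution to $\mathcal N(0,W^T\Sigma W)$, where $\Sigma_{ij}=\sqrt{\zeta_v(2^{i-1}L)\zeta_v(2^{j-1}L)}\,\sigma_{3,v}(2^{i-1}L)\sigma_{3,v}(2^{j-1}L)\,r_{3,v}(2^{i-1}L,2^{j-1}L)$ for $i,j\in\{1,2,3\}$, $W=\nabla h(V(L\tau),V(2L\tau),V(4L\tau))$ (the function $h$ being differentiable at this point) and $$h(x,y,z)=\frac{2(2x-y)^2}{(2\sqrt{2x-y}-\sqrt{2y-z})^2}.$$ The same consistency and asymptotic normality hold for the closed form of this estimator, $$\frac{2(2\widehat V_v(n,L)-\widehat V_v(n,2L))^2}{\bigl(2\sqrt{|2\widehat V_v(n,L)-\widehat V_v(n,2L)|}-\sqrt{|2\widehat V_v(n,2L)-\widehat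 V_v(n,4L)|}\bigr)^2}.$$ (Where a denominator vanishes or a non-integer power of a negative number occurs, any fixed measurable convention may be used; this does not affect the limits.) -/

import Mathlib

open MeasureTheory ProbabilityTheory Filter Topology
open scoped NNReal Matrix

noncomputable section

namespace SpreadEstimation

variable {Ω : Type*} [MeasurableSpace Ω]

/-! ### The market model -/

/-- Correlation coefficient of two real random variables. -/
def corr (μ : Measure Ω) (X Y : Ω → ℝ) : ℝ :=
  cov[X, Y; μ] / (√(Var[X; μ]) * √(Var[Y; μ]))

/-- `P` is a Brownian motion with volatility `σ`, started at an arbitrary (possibly random)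
value `P 0`: the process `(P t - P 0) / σ` is a standard Brownian motion. -/
structure IsBrownianWithVolatility (P : ℝ≥0 → Ω → ℝ) (σ : ℝ) (μ : Measure Ω) : Prop where
  aemeasurable : ∀ t, AEMeasurable (P t) μ
  brownian : IsBrownianReal (fun t ω => (P t ω - P 0 ω) / σ) μ

/-- The microstructure noise `η_t = S (X_t - 1/2)` for the trade direction `X`. -/
def noise (S : ℝ) (X : ℝ≥0 → Ω → ℝ) (t : ℝ≥0) (ω : Ω) : ℝ := S * (X t ω - 1 / 2)

/-- The observed log-price `p_t = p*_t + η_t`. -/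
def logPrice (S : ℝ) (P X : ℝ≥0 → Ω → ℝ) (t : ℝ≥0) (ω : Ω) : ℝ := P t ω + noise S X t ω

/-- The trade sign `Y_t = 2 X_t - 1`, with values in `{-1, 1}`. -/
def tradeSign (X : ℝ≥0 → Ω → ℝ) (t : ℝ≥0) (ω : Ω) : ℝ := 2 * X t ω - 1

/-- Along the times `t 0 ≤ t 1 ≤ …`, the initial sign `Y_{t 0}` followed by the sign changes
`Y_{t k} Y_{t (k+1)}`; since signs are `±1`, `Y_{t k}` is the product of the first `k + 1` of
these variables. -/
def signRatio (X : ℝ≥0 → Ω → ℝ) (t : ℕ → ℝ≥0) : ℕ → Ω → ℝ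
  | 0 => fun ω => tradeSign X (t 0) ω
  | k + 1 => fun ω => tradeSign X (t k) ω * tradeSign X (t (k + 1)) ω

/-- Autocorrelated trades: `X_t` is a Bernoulli(1/2) variable, the noise `η = S (X - 1/2)` has the
autocorrelation `exp (-|t - s| / lam)`, and along any nondecreasing sequence of times the initial
sign and the successive sign changes are mutually independent. -/
structure IsTradeDirection (X : ℝ≥0 → Ω → ℝ) (S lam : ℝ) (μ : Measure Ω) : Prop where
  law : ∀ t, HasLaw (X t) (bernoulliMeasure (1 : ℝ) 0 ⟨1 / 2, by norm_num, by norm_num⟩) μ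
  corr_eq : ∀ s t : ℝ≥0,
    corr μ (noise S X s) (noise S X t) = Real.exp (-|(t : ℝ) - (s : ℝ)| / lam)
  indep : ∀ t : ℕ → ℝ≥0, Monotone t → iIndepFun (signRatio X t) μ

/-! ### Empirical variances and estimators -/

/-- The three ways of extracting increments of a given lag from the observed series. -/
inductive Scheme
  | overlapping
  | nonOverlapping
  | disjoint

/-- The number `k_v(n, L)` of increments of lag `L` among `n` observations. -/
def Scheme.count : Scheme → ℕ → ℕ → ℕ
  | .overlapping, n, L => n - L
  | .nonOverlapping, n, L => (n - 1) / L
  | .disjoint, n, L => n / (L + 1)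

/-- The index at which the `i`-th increment of lag `L` starts; it ends `L` steps later. -/
def Scheme.start : Scheme → ℕ → ℕ → ℕ
  | .overlapping, _, i => i
  | .nonOverlapping, L, i => i * L
  | .disjoint, L, i => i + i * L

/-- `ζ_v(L)`, the limit of `n / k_v(n, L)`. -/
def Scheme.zeta : Scheme → ℕ → ℝ
  | .overlapping, _ => 1
  | .nonOverlapping, L => L
  | .disjoint, L => L + 1

/-- The empirical variance `V̂_v(n, L)` of the process `p` observed at times `0, τ, 2τ, …`. -/
def empVar (v : Scheme) (p : ℝ≥0 → Ω → ℝ) (τ : ℝ≥0) (n L : ℕ) (ω : Ω) : ℝ :=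
  (1 / (v.count n L : ℝ)) * ∑ i ∈ Finset.range (v.count n L),
    (p (((v.start L i + L : ℕ) : ℝ≥0) * τ) ω - p ((v.start L i : ℝ≥0) * τ) ω) ^ 2

/-- `Ŝ²_{3,v}` as a function of `x = V̂_v(n, L)`, `y = V̂_v(n, L')` and `ρ`. -/
def spreadFormula (L L' : ℕ) (ρ x y : ℝ) : ℝ :=
  2 * (L' * x - L * y) / (L' * (1 - ρ ^ L) - L * (1 - ρ ^ L'))

/-- The estimator `Ŝ²_{3,v}(n, L, L', ρ)` with known dependence parameter. -/
def spreadEst (v : Scheme) (p : ℝ≥0 → Ω → ℝ) (τ : ℝ≥0) (n L L' : ℕ) (ρ : ℝ) (ω : Ω) : ℝ :=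
  spreadFormula L L' ρ (empVar v p τ n L ω) (empVar v p τ n L' ω)

/-- The estimator of `ρ ^ L`. -/
def rhoPowEst (v : Scheme) (p : ℝ≥0 → Ω → ℝ) (τ : ℝ≥0) (n L : ℕ) (ω : Ω) : ℝ :=
  √|(2 * empVar v p τ n (2 * L) ω - empVar v p τ n (4 * L) ω) /
      (2 * empVar v p τ n L ω - empVar v p τ n (2 * L) ω)| - 1

/-- The plug-in estimator, in which `ρ` is replaced by the `1 / L''`-th power of the estimator of
`ρ ^ L''`. -/
def spreadPlugIn (v : Scheme) (p : ℝ≥0 → Ω → ℝ) (τ : ℝ≥0) (n L L' L'' : ℕ) (ω : Ω) : ℝ :=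
  spreadEst v p τ n L L' ((rhoPowEst v p τ n L'' ω) ^ (1 / (L'' : ℝ))) ω

/-- The closed form of the plug-in estimator for `(L', L'') = (2L, L)`, with absolute values keeping
the square roots defined. -/
def spreadClosed (v : Scheme) (p : ℝ≥0 → Ω → ℝ) (τ : ℝ≥0) (n L : ℕ) (ω : Ω) : ℝ :=
  2 * (2 * empVar v p τ n L ω - empVar v p τ n (2 * L) ω) ^ 2 /
    (2 * √|2 * empVar v p τ n L ω - empVar v p τ n (2 * L) ω|
      - √|2 * empVar v p τ n (2 * L) ω - empVar v p τ n (4 * L) ω|) ^ 2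

/-! ### The asymptotic variances -/

/-- `V(Lτ)`, the variance of a log-price increment of duration `Lτ`. -/
def priceVar (σ S lam τ : ℝ) (L : ℕ) : ℝ :=
  L * τ * σ ^ 2 + S ^ 2 / 2 * (1 - Real.exp (-(L * τ) / lam))

/-- `f_L(x) = ∑_{m=1}^{L-1} e^{xm}` in closed form, for `x ≠ 0`. -/
def geomSum (L : ℕ) (x : ℝ) : ℝ :=
  (Real.exp x - Real.exp (x * L)) / (1 - Real.exp x)

/-- `f_L'(x) = ∑_{m=1}^{L-1} m e^{xm}` in closed form, for `x ≠ 0`. -/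
def geomSumDeriv (L : ℕ) (x : ℝ) : ℝ :=
  (Real.exp x - L * Real.exp (x * L) + (L - 1) * Real.exp (x * (L + 1))) / (1 - Real.exp x) ^ 2

/-- `σ²_{3,v}(L)` for `v = 2, 3`. -/
def baseVar (σ S lam τ : ℝ) (L : ℕ) : ℝ :=
  2 * L ^ 2 * τ ^ 2 * σ ^ 4 + S ^ 4 / 4 * (1 - Real.exp (-(2 * L * τ) / lam))
    + 2 * L * τ * σ ^ 2 * S ^ 2 * (1 - Real.exp (-(L * τ) / lam))

/-- `σ²_{3,v}(L)`. -/
def sigmaSq (σ S lam τ : ℝ) : Scheme → ℕ → ℝ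
  | .overlapping, L =>
      baseVar σ S lam τ L
        + 2 / 3 * τ ^ 2 * σ ^ 4 * ((L - 1) * L * (2 * L - 1))
        + S ^ 4 / 2 * Real.exp (-(2 * L * τ) / lam) * (geomSum L (2 * τ / lam) - L + 1)
        + 2 * τ * σ ^ 2 * S ^ 2 *
          (2 * Real.exp (-(L * τ) / lam) * geomSumDeriv L (τ / lam)
            - geomSumDeriv L (-τ / lam)
            - Real.exp (-(2 * L * τ) / lam) * geomSumDeriv L (τ / lam))
  | .nonOverlapping, L => baseVar σ S lam τ L
  | .disjoint, L => baseVar σ S lam τ L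

/-- `r_{3,v}(L, L')`, the limit of the correlation of the empirical variances of lags `L`, `L'`. -/
def limCorr (μ : Measure Ω) (v : Scheme) (p : ℝ≥0 → Ω → ℝ) (τ : ℝ≥0) (L L' : ℕ) : ℝ :=
  limUnder atTop (fun n : ℕ => corr μ (empVar v p τ n L) (empVar v p τ n L'))

/-- The asymptotic covariance
`√(ζ_v(L) ζ_v(L')) σ_{3,v}(L) σ_{3,v}(L') r`, for a limit correlation `r`. -/
def asympCov (σ S lam τ : ℝ) (v : Scheme) (L L' : ℕ) (r : ℝ) : ℝ :=
  √(v.zeta L * v.zeta L') * √(sigmaSq σ S lam τ v L) * √(sigmaSq σ S lam τ v L') * r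

/-- `γ_{3,v}(L, L', ρ)`, where `r` is the limit correlation `r_{3,v}(L, L')`. -/
def gammaVar (σ S lam τ : ℝ) (v : Scheme) (L L' : ℕ) (ρ r : ℝ) : ℝ :=
  4 / (L' * (1 - ρ ^ L) - L * (1 - ρ ^ L')) ^ 2 *
    (L' ^ 2 * v.zeta L * sigmaSq σ S lam τ v L
      + L ^ 2 * v.zeta L' * sigmaSq σ S lam τ v L'
      - 2 * L * L' * asympCov σ S lam τ v L L' r)

/-- `h(x, y, z) = 2 (2x - y)² / (2 √(2x - y) - √(2y - z))²`. -/
def hFun (u : EuclideanSpace ℝ (Fin 3)) : ℝ :=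
  2 * (2 * u 0 - u 1) ^ 2 / (2 * √(2 * u 0 - u 1) - √(2 * u 1 - u 2)) ^ 2

/-- The point `(V(Lτ), V(2Lτ), V(4Lτ))`. -/
def priceVarVec (σ S lam τ : ℝ) (L : ℕ) : EuclideanSpace ℝ (Fin 3) :=
  !₂[priceVar σ S lam τ L, priceVar σ S lam τ (2 * L), priceVar σ S lam τ (4 * L)]

/-- The matrix `Σ` of asymptotic covariances at the lags `L, 2L, 4L`. -/
def covMatrix (μ : Measure Ω) (σ S lam : ℝ) (τ : ℝ≥0) (v : Scheme) (p : ℝ≥0 → Ω → ℝ) (L : ℕ) :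
    Matrix (Fin 3) (Fin 3) ℝ :=
  Matrix.of fun i j =>
    asympCov σ S lam τ v (2 ^ (i : ℕ) * L) (2 ^ (j : ℕ) * L)
      (limCorr μ v p τ (2 ^ (i : ℕ) * L) (2 ^ (j : ℕ) * L))

/-- `Wᵀ Σ W` with `W = ∇h(V(Lτ), V(2Lτ), V(4Lτ))`. -/
def plugInVar (μ : Measure Ω) (σ S lam : ℝ) (τ : ℝ≥0) (v : Scheme) (p : ℝ≥0 → Ω → ℝ) (L : ℕ) : ℝ :=
  (gradient hFun (priceVarVec σ S lam τ L)).ofLp ⬝ᵥ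
    (covMatrix μ σ S lam τ v p L *ᵥ (gradient hFun (priceVarVec σ S lam τ L)).ofLp)

/-- The statistics `T n` are asymptotically normal at rate `√n`, with centre `a` and asymptotic
variance `w ≥ 0`: `√n (T n - a)` converges in distribution to `N(0, w)`. -/
def AsymptoticallyNormal (μ : Measure Ω) [IsProbabilityMeasure μ] (T : ℕ → Ω → ℝ) (a w : ℝ) :
    Prop :=
  0 ≤ w ∧ TendstoInDistribution (fun (n : ℕ) ω => √(n : ℝ) * (T n ω - a)) atTop
    (id : ℝ → ℝ) (fun _ => μ) (gaussianReal 0 w.toNNReal)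

end SpreadEstimation

end

/-!
Write `Y` for the trade sign. The sign changes `Y_{iτ} Y_{(i+1)τ}` and the price increments twisted
by the current sign, `Y_{iτ} (P_{(i+1)τ} - P_{iτ})`, together form an i.i.d. sequence: Gaussian
increments are symmetric and independent of the signs, so the twist does not change their joint law.
A squared increment of the log-price over `L` steps is a function of `L` consecutive terms of this
sequence, because the sign common to all of its summands is removed by the square. For each of the
three schemes `√n (V̂(n, L) - V(Lτ))` is thus asymptotically a normalized sum of a finite range
moving average of an i.i.d. sequence. Cutting such a sum into long blocks separated by short gaps
(Bernstein's method) reduces it to the classical central limit theorem, and the Cramér–Wold device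
gives joint normality for several `L`. The asymptotic covariances are the limits of the covariances,
and the asymptotic variances are computed from the autocovariances of the squared increments, which
are explicit by Isserlis-type formulas for the Gaussian part and by the exponential decay of the
correlation for the sign part.

The estimators of `S²` are functions of finitely many `V̂(n, L)`. The one with known `ρ` is linear
in them; the plug-in estimator and its closed form agree near the limit point with the smooth
function `h`, because `2 V(Lτ) - V(2Lτ) = S² (1 - ρ^L)² / 2` is positive and its values at `L` and
`2L` have the ratio `(1 + ρ^L)²`. The delta method concludes.
-/

namespace SpreadEstimation

lemma injective_mul_add_fin (K : ℕ) :
    Function.Injective fun p : ℕ × Fin K => p.1 * K + (p.2 : ℕ) := by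
  rintro ⟨j, i⟩ ⟨j', i'⟩ h
  have hK : 0 < K := i.pos
  obtain rfl : j = j' := by
    simpa [Nat.add_div_of_dvd_right, hK, Nat.div_eq_of_lt] using congrArg (· / K) h
  simpa [Fin.ext_iff] using h

section Shift

variable {E : Type*}

/-- The sequence `x` read from the index `a` on. -/
def shift (a : ℕ) (x : ℕ → E) : ℕ → E := fun i => x (a + i)

@[simp] lemma shift_apply (a : ℕ) (x : ℕ → E) (i : ℕ) : shift a x i = x (a + i) := rfl

@[simp] lemma shift_shift (a b : ℕ) (x : ℕ → E) : shift a (shift b x) = shift (b + a) x := by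
  ext i
  simp [add_assoc]

@[simp] lemma shift_zero (x : ℕ → E) : shift 0 x = x := by
  ext i
  simp

lemma dependsOn_comp_shift {β : Type*} {X : (ℕ → E) → β} {m a M : ℕ}
    (hX : DependsOn X (Set.Iio m)) (hM : a + m ≤ M) :
    DependsOn (fun x => X (shift a x)) (Set.Iio M) := by
  intro x y hxy
  refine hX fun i hi => hxy _ ?_
  simp only [Set.mem_Iio] at hi ⊢
  lia

variable [MeasurableSpace E]

@[fun_prop] lemma measurable_shift (a : ℕ) : Measurable (shift a : (ℕ → E) → ℕ → E) :=
  measurable_pi_lambda _ fun i => measurable_pi_apply (a + i)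

variable (ν : Measure E) [IsProbabilityMeasure ν]

lemma measurePreserving_shift (a : ℕ) :
    MeasurePreserving (shift a) (Measure.infinitePi fun _ : ℕ => ν)
      (Measure.infinitePi fun _ : ℕ => ν) where
  measurable := measurable_shift a
  map_eq := Measure.map_infinitePi_infinitePi_of_inj (P := fun _ : ℕ => ν)
    (f := fun i => a + i) (add_right_injective a)

lemma hasLaw_blocks (K : ℕ) :
    HasLaw (fun (x : ℕ → E) (j : ℕ) (i : Fin K) => x (j * K + i))
      (Measure.infinitePi fun _ : ℕ => Measure.infinitePi fun _ : Fin K => ν)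
      (Measure.infinitePi fun _ : ℕ => ν) where
  aemeasurable := (measurable_pi_lambda _ fun _ => measurable_pi_lambda _ fun _ =>
    measurable_pi_apply _).aemeasurable
  map_eq := by
    rw [← Measure.infinitePi_map_curry (X := E) fun (_ : ℕ) (_ : Fin K) => ν,
      ← Measure.map_infinitePi_infinitePi_of_inj (P := fun _ : ℕ => ν) (injective_mul_add_fin K),
      Measure.map_map (by fun_prop) (by fun_prop)]
    rfl

lemma iIndepFun_blocks (K : ℕ) :
    iIndepFun (fun (j : ℕ) (x : ℕ → E) (i : Fin K) => x (j * K + i))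
      (Measure.infinitePi fun _ : ℕ => ν) :=
  (iIndepFun_iff_hasLaw_Pi_infinitePi
    (fun j => (measurePreserving_eval_infinitePi
      (fun _ : ℕ => Measure.infinitePi fun _ : Fin K => ν) j).hasLaw.comp (hasLaw_blocks ν K))
    (hasLaw_blocks ν K).aemeasurable).2 (hasLaw_blocks ν K)

lemma iIndepFun_comp_shift {β : ℕ → Type*} [∀ j, MeasurableSpace (β j)]
    {X : ∀ j, (ℕ → E) → β j} (hX : ∀ j, Measurable (X j)) {K : ℕ}
    (hK : ∀ j, DependsOn (X j) (Set.Iio K)) :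
    iIndepFun (fun (j : ℕ) x => X j (shift (j * K) x)) (Measure.infinitePi fun _ : ℕ => ν) := by
  obtain ⟨e⟩ := nonempty_of_isProbabilityMeasure ν
  let extend : (Fin K → E) → ℕ → E := fun y i => if h : i < K then y ⟨i, h⟩ else e
  have h_extend : Measurable extend := by
    refine measurable_pi_lambda _ fun i => ?_
    by_cases h : i < K
    · simpa [extend, h] using measurable_pi_apply _
    · simp [extend, h]
  convert (iIndepFun_blocks ν K).comp (fun j => X j ∘ extend)
    (fun j => (hX j).comp h_extend) using 2 with j
  ext x
  refine hK j fun i hi => ?_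
  simp [extend, Set.mem_Iio.1 hi]

lemma indepFun_comp_shift {β : Type*} [MeasurableSpace β] {X Z : (ℕ → E) → β}
    (hX : Measurable X) (hZ : Measurable Z) {K : ℕ} (hXK : DependsOn X (Set.Iio K))
    (hZK : DependsOn Z (Set.Iio K)) :
    IndepFun X (fun x => Z (shift K x)) (Measure.infinitePi fun _ : ℕ => ν) := by
  have h := iIndepFun_comp_shift ν (X := fun j => if j = 0 then X else Z) (K := K)
    (fun j => by split_ifs <;> assumption) (fun j => by split_ifs <;> assumption)
  simpa using h.indepFun (zero_ne_one' ℕ)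

variable {F G : (ℕ → E) → ℝ}

lemma integral_comp_shift (hF : Measurable F) (a : ℕ) :
    ∫ x, F (shift a x) ∂(Measure.infinitePi fun _ : ℕ => ν) =
      ∫ x, F x ∂(Measure.infinitePi fun _ : ℕ => ν) := by
  rw [← integral_map (measurable_shift a).aemeasurable hF.aestronglyMeasurable,
    (measurePreserving_shift ν a).map_eq]

lemma integral_mul_comp_shift_eq_zero (hF : Measurable F) (hG : Measurable G) {K : ℕ}
    (hFK : DependsOn F (Set.Iio K)) (hGK : DependsOn G (Set.Iio K))
    (h0 : ∫ x, F x ∂(Measure.infinitePi fun _ : ℕ => ν) = 0) :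
    ∫ x, F x * G (shift K x) ∂(Measure.infinitePi fun _ : ℕ => ν) = 0 := by
  rw [(indepFun_comp_shift ν hF hG hFK hGK).integral_fun_mul_eq_mul_integral
    hF.aestronglyMeasurable (hG.comp (measurable_shift K)).aestronglyMeasurable, h0, zero_mul]

lemma integral_comp_shift_mul_comp_shift (hF : Measurable F) (s i k : ℕ) :
    ∫ x, F (shift (i * s) x) * F (shift ((i + k) * s) x) ∂(Measure.infinitePi fun _ : ℕ => ν) =
      ∫ x, F x * F (shift (k * s) x) ∂(Measure.infinitePi fun _ : ℕ => ν) := by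
  rw [← integral_comp_shift ν (F := fun x => F x * F (shift (k * s) x)) (by fun_prop) (i * s)]
  simp [add_mul]

end Shift

section SecondMoment

variable {Ω : Type*} [MeasurableSpace Ω] {μ : Measure Ω}

lemma integral_sq_sum_range_succ {X : ℕ → Ω → ℝ} (hX : ∀ i, MemLp (X i) 2 μ) {r : ℕ → ℝ}
    (hr : ∀ i k, ∫ ω, X i ω * X (i + k) ω ∂μ = r k) (N : ℕ) :
    ∫ ω, (∑ i ∈ Finset.range (N + 1), X i ω) ^ 2 ∂μ =
      ∫ ω, (∑ i ∈ Finset.range N, X i ω) ^ 2 ∂μ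
        + (r 0 + 2 * ∑ k ∈ Finset.range N, r (k + 1)) := by
  have hint : ∀ i j, Integrable (fun ω => X i ω * X j ω) μ := fun i j =>
    (hX i).integrable_mul (hX j)
  have hcross : Integrable (fun ω => ∑ i ∈ Finset.range N, X i ω * X N ω) μ :=
    integrable_finsetSum _ fun i _ => hint i N
  have hsq : ∀ ω, (∑ i ∈ Finset.range (N + 1), X i ω) ^ 2 =
      (∑ i ∈ Finset.range N, X i ω) ^ 2
        + (X N ω * X N ω + 2 * ∑ i ∈ Finset.range N, X i ω * X N ω) := by
    intro ω
    rw [Finset.sum_range_succ, ← Finset.sum_mul]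
    ring
  have hdiag : Integrable
      (fun ω => X N ω * X N ω + 2 * ∑ i ∈ Finset.range N, X i ω * X N ω) μ :=
    (hint N N).add (hcross.const_mul 2)
  have hcov : ∑ i ∈ Finset.range N, ∫ ω, X i ω * X N ω ∂μ =
      ∑ k ∈ Finset.range N, r (k + 1) := by
    rw [← Finset.sum_range_reflect]
    refine Finset.sum_congr rfl fun j hj => ?_
    have hjN := Finset.mem_range.1 hj
    rw [← hr (N - 1 - j) (j + 1), show N - 1 - j + (j + 1) = N by lia]
  simp_rw [hsq]
  rw [integral_add (memLp_finsetSum _ fun i _ => hX i).integrable_sq hdiag,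
    integral_add (hint N N) (hcross.const_mul 2), integral_const_mul,
    integral_finsetSum _ fun i _ => hint i N, hcov, ← hr N 0, add_zero]

lemma integral_sq_sum_range {X : ℕ → Ω → ℝ} (hX : ∀ i, MemLp (X i) 2 μ) {r : ℕ → ℝ}
    (hr : ∀ i k, ∫ ω, X i ω * X (i + k) ω ∂μ = r k) (N : ℕ) :
    ∫ ω, (∑ i ∈ Finset.range N, X i ω) ^ 2 ∂μ =
      ∑ M ∈ Finset.range N, (r 0 + 2 * ∑ k ∈ Finset.range M, r (k + 1)) := by
  induction N with
  | zero => simp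
  | succ N ih => rw [integral_sq_sum_range_succ hX hr, ih, Finset.sum_range_succ]

lemma tendsto_integral_sq_sum_range_div {X : ℕ → Ω → ℝ} (hX : ∀ i, MemLp (X i) 2 μ) {r : ℕ → ℝ}
    (hr : ∀ i k, ∫ ω, X i ω * X (i + k) ω ∂μ = r k) {m : ℕ} (hm : ∀ k, m ≤ k → r (k + 1) = 0) :
    Tendsto (fun N : ℕ => (N : ℝ)⁻¹ * ∫ ω, (∑ i ∈ Finset.range N, X i ω) ^ 2 ∂μ) atTop
      (𝓝 (r 0 + 2 * ∑ k ∈ Finset.range m, r (k + 1))) := by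
  simp_rw [integral_sq_sum_range hX hr]
  refine Tendsto.cesaro (tendsto_const_nhds.congr' ?_)
  filter_upwards [eventually_ge_atTop m] with M hM
  rw [← Finset.sum_range_add_sum_Ico _ hM,
    Finset.sum_eq_zero fun k hk => hm k (Finset.mem_Ico.1 hk).1, add_zero]

lemma lpNorm_two_sq {X : Ω → ℝ} (hX : AEStronglyMeasurable X μ) :
    lpNorm X 2 μ ^ 2 = ∫ ω, X ω ^ 2 ∂μ := by
  have : 0 ≤ ∫ ω, X ω ^ 2 ∂μ := integral_nonneg fun ω => sq_nonneg _
  rw [lpNorm_eq_integral_norm_rpow_toReal (by simp) (by simp) hX, ← Real.rpow_natCast,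
    ← Real.rpow_mul (by positivity)]
  simp

lemma lpNorm_two_eq_sqrt {X : Ω → ℝ} (hX : AEStronglyMeasurable X μ) :
    lpNorm X 2 μ = √(∫ ω, X ω ^ 2 ∂μ) := by
  rw [← lpNorm_two_sq hX, Real.sqrt_sq lpNorm_nonneg]

lemma lpNorm_sum_range_of_orthogonal {X : ℕ → Ω → ℝ} (hX : ∀ i, MemLp (X i) 2 μ) {v : ℝ}
    (hv : ∀ i, ∫ ω, X i ω * X i ω ∂μ = v) (h0 : ∀ i k, ∫ ω, X i ω * X (i + (k + 1)) ω ∂μ = 0)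
    (N : ℕ) : lpNorm (fun ω => ∑ i ∈ Finset.range N, X i ω) 2 μ = √N * √v := by
  have hr : ∀ i k, ∫ ω, X i ω * X (i + k) ω ∂μ = if k = 0 then v else 0 := by
    rintro i (_ | k)
    · simpa using hv i
    · simpa using h0 i k
  rw [lpNorm_two_eq_sqrt (memLp_finsetSum _ fun i _ => hX i).aestronglyMeasurable,
    integral_sq_sum_range hX hr, ← Real.sqrt_mul N.cast_nonneg]
  simp

lemma lpNorm_const_mul (c : ℝ) (X : Ω → ℝ) (p : ENNReal) :
    lpNorm (fun ω => c * X ω) p μ = |c| * lpNorm X p μ :=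
  lpNorm_const_smul c X μ

lemma lpNorm_fun_sum_le_card_mul {ι : Type*} {X : ι → Ω → ℝ} {s : Finset ι} {p : ENNReal}
    (hp : 1 ≤ p) (hX : ∀ i ∈ s, MemLp (X i) p μ) {C : ℝ} (hC : ∀ i ∈ s, lpNorm (X i) p μ ≤ C) :
    lpNorm (fun ω => ∑ i ∈ s, X i ω) p μ ≤ s.card * C := by
  have hsum : (fun ω => ∑ i ∈ s, X i ω) = ∑ i ∈ s, X i := by
    ext
    simp
  rw [hsum, ← nsmul_eq_mul]
  exact (lpNorm_sum_le hX hp).trans (Finset.sum_le_card_nsmul s _ C hC)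

lemma tendsto_lpNorm_of_tendsto_lpNorm_sub {ι : Type*} {l : Filter ι} {p : ENNReal} (hp : 1 ≤ p)
    {X Y : ι → Ω → ℝ} {c : ℝ} (hX : ∀ n, MemLp (X n) p μ) (hY : ∀ n, MemLp (Y n) p μ)
    (hc : Tendsto (fun n => lpNorm (X n) p μ) l (𝓝 c))
    (h : Tendsto (fun n => lpNorm (Y n - X n) p μ) l (𝓝 0)) :
    Tendsto (fun n => lpNorm (Y n) p μ) l (𝓝 c) := by
  refine tendsto_of_tendsto_of_tendsto_of_le_of_le
    (g := fun n => lpNorm (X n) p μ - lpNorm (Y n - X n) p μ)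
    (h := fun n => lpNorm (X n) p μ + lpNorm (Y n - X n) p μ)
    (by simpa using hc.sub h) (by simpa using hc.add h) (fun n => ?_) (fun n => ?_)
  · exact sub_le_iff_le_add.2 (lpNorm_le_lpNorm_add_lpNorm_sub (hY n) hp)
  · exact lpNorm_le_lpNorm_add_lpNorm_sub' (hX n) hp

lemma tendsto_integral_sq_of_tendsto_lpNorm_sub {ι : Type*} {l : Filter ι} [l.NeBot]
    {X Y : ι → Ω → ℝ} {w : ℝ} (hX : ∀ n, MemLp (X n) 2 μ) (hY : ∀ n, MemLp (Y n) 2 μ)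
    (hw : Tendsto (fun n => ∫ ω, X n ω ^ 2 ∂μ) l (𝓝 w))
    (h : Tendsto (fun n => lpNorm (Y n - X n) 2 μ) l (𝓝 0)) :
    Tendsto (fun n => ∫ ω, Y n ω ^ 2 ∂μ) l (𝓝 w) := by
  have hw0 : 0 ≤ w := ge_of_tendsto' hw fun n => integral_nonneg fun ω => sq_nonneg _
  have hXw : Tendsto (fun n => lpNorm (X n) 2 μ) l (𝓝 √w) := by
    simpa only [lpNorm_two_eq_sqrt (hX _).aestronglyMeasurable] using hw.sqrt
  have hYw := (tendsto_lpNorm_of_tendsto_lpNorm_sub one_le_two hX hY hXw h).pow 2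
  rw [Real.sq_sqrt hw0] at hYw
  exact hYw.congr fun n => lpNorm_two_sq (hY n).aestronglyMeasurable

end SecondMoment

lemma tendsto_of_dist_le_add {α ι κ : Type*} [PseudoMetricSpace α] {L : Filter κ} [L.NeBot]
    {l : Filter ι} {y : ι → α} {f : κ → ι → α} {g : κ → α} {z : α} {a : κ → ℝ} {b : κ → ι → ℝ}
    (hf : ∀ q, Tendsto (f q) l (𝓝 (g q))) (hg : Tendsto g L (𝓝 z)) (ha : Tendsto a L (𝓝 0))
    (hb : ∀ q, Tendsto (b q) l (𝓝 0)) (hab : ∀ q n, dist (y n) (f q n) ≤ a q + b q n) :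
    Tendsto y l (𝓝 z) := by
  rw [Metric.tendsto_nhds]
  intro ε hε
  have hq : Tendsto (fun q => a q + dist (g q) z) L (𝓝 0) := by
    simpa using ha.add (tendsto_iff_dist_tendsto_zero.1 hg)
  obtain ⟨q, hqε⟩ := (hq.eventually_lt_const (half_pos hε)).exists
  have hn : Tendsto (fun n => b q n + dist (f q n) (g q)) l (𝓝 0) := by
    simpa using (hb q).add (tendsto_iff_dist_tendsto_zero.1 (hf q))
  filter_upwards [hn.eventually_lt_const (half_pos hε)] with n hnε
  linarith [hab q n, dist_triangle4 (y n) (f q n) (g q) z]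

section Distribution

variable {Ω : Type*} [MeasurableSpace Ω] {μ : Measure Ω}

lemma tendstoInMeasure_zero_of_tendsto_lpNorm {ι : Type*} {l : Filter ι} {X : ι → Ω → ℝ}
    (hX : ∀ n, MemLp (X n) 2 μ) (h : Tendsto (fun n => lpNorm (X n) 2 μ) l (𝓝 0)) :
    TendstoInMeasure μ X l 0 := by
  refine tendstoInMeasure_of_tendsto_eLpNorm (p := 2) (by simp)
    (fun n => (hX n).aestronglyMeasurable) aestronglyMeasurable_zero ?_
  simpa [ofReal_lpNorm (hX _)] using ENNReal.tendsto_ofReal h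

variable [IsProbabilityMeasure μ] {Ω' : Type*} [MeasurableSpace Ω'] {μ' : Measure Ω'}
  [IsProbabilityMeasure μ'] {Z : Ω' → ℝ}

lemma tendstoInDistribution_comp_index {ι κ : Type*} {l : Filter ι} {l' : Filter κ}
    {X : ι → Ω → ℝ} (h : TendstoInDistribution X l Z (fun _ => μ) μ') {k : κ → ι}
    (hk : Tendsto k l' l) :
    TendstoInDistribution (fun n => X (k n)) l' Z (fun _ => μ) μ' where
  forall_aemeasurable n := h.forall_aemeasurable (k n)
  aemeasurable_limit := h.aemeasurable_limit
  tendsto := h.tendsto.comp hk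

lemma tendstoInDistribution_id_of_hasLaw {ι : Type*} {l : Filter ι} {X : ι → Ω → ℝ}
    (h : TendstoInDistribution X l Z (fun _ => μ) μ') {ρ : Measure ℝ} [IsProbabilityMeasure ρ]
    (hZ : HasLaw Z ρ μ') : TendstoInDistribution X l id (fun _ => μ) ρ where
  forall_aemeasurable := h.forall_aemeasurable
  tendsto := by
    have hlim := h.tendsto
    simp_rw [hZ.map_eq] at hlim
    simpa only [Measure.map_id] using hlim

lemma tendstoInDistribution_of_tendsto_lpNorm_sub {X Y : ℕ → Ω → ℝ}
    (hX : ∀ n, MemLp (X n) 2 μ) (hY : ∀ n, MemLp (Y n) 2 μ)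
    (hZ : TendstoInDistribution X atTop Z (fun _ => μ) μ')
    (h : Tendsto (fun n => lpNorm (Y n - X n) 2 μ) atTop (𝓝 0)) :
    TendstoInDistribution Y atTop Z (fun _ => μ) μ' :=
  tendstoInDistribution_of_tendstoInMeasure_sub Y Z hZ
    (tendstoInMeasure_zero_of_tendsto_lpNorm (fun n => (hY n).sub (hX n)) h)
    fun n => (hY n).aestronglyMeasurable.aemeasurable

lemma tendstoInDistribution_gaussian_const_mul {X : ℕ → Ω → ℝ} {c : ℕ → ℝ} {a v : ℝ}
    (hX : TendstoInDistribution X atTop (id : ℝ → ℝ) (fun _ => μ) (gaussianReal 0 v.toNNReal))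
    (hc : Tendsto c atTop (𝓝 a)) :
    TendstoInDistribution (fun n ω => c n * X n ω) atTop (id : ℝ → ℝ) (fun _ => μ)
      (gaussianReal 0 (a ^ 2 * v).toNNReal) := by
  have hcμ : TendstoInMeasure μ (fun n _ => c n) atTop fun _ => a :=
    tendstoInMeasure_of_tendsto_ae (fun n => aestronglyMeasurable_const) (ae_of_all _ fun _ => hc)
  have hmul := hX.continuous_comp_prodMk_of_tendstoInMeasure_const
    (g := fun x : ℝ × ℝ => x.2 * x.1) (by fun_prop) hcμ fun n => aemeasurable_const
  have hlaw : (gaussianReal 0 v.toNNReal).map (fun x => a * x) =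
      gaussianReal 0 (a ^ 2 * v).toNNReal := by
    rw [gaussianReal_map_const_mul, mul_zero, Real.toNNReal_mul (sq_nonneg a),
      Real.toNNReal_of_nonneg (sq_nonneg a)]
  exact tendstoInDistribution_id_of_hasLaw hmul ⟨by fun_prop, hlaw⟩

lemma norm_charFun_map_sub_le {X Y : Ω → ℝ} (hX : AEMeasurable X μ) (hY : AEMeasurable Y μ)
    (hXY : Integrable (X - Y) μ) (t : ℝ) :
    ‖charFun (μ.map X) t - charFun (μ.map Y) t‖ ≤ |t| * ∫ ω, ‖(X - Y) ω‖ ∂μ := by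
  have hint : ∀ {Z : Ω → ℝ}, AEMeasurable Z μ →
      Integrable (fun ω => Complex.exp (t * Z ω * Complex.I)) μ := by
    intro Z hZ
    refine Integrable.of_bound (C := 1) (by fun_prop) (ae_of_all _ fun ω => ?_)
    rw [← Complex.ofReal_mul, Complex.norm_exp_ofReal_mul_I]
  have hbound : ∀ ω, ‖Complex.exp (t * X ω * Complex.I) - Complex.exp (t * Y ω * Complex.I)‖ ≤
      |t| * ‖(X - Y) ω‖ := by
    intro ω
    have hfactor : Complex.exp (t * X ω * Complex.I) - Complex.exp (t * Y ω * Complex.I) =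
        Complex.exp (((t * Y ω : ℝ) : ℂ) * Complex.I) *
          (Complex.exp (Complex.I * ((t * (X ω - Y ω) : ℝ) : ℂ)) - 1) := by
      rw [mul_sub, ← Complex.exp_add]
      push_cast
      ring_nf
    rw [hfactor, norm_mul, Complex.norm_exp_ofReal_mul_I, one_mul]
    exact Real.norm_exp_I_mul_ofReal_sub_one_le.trans (by simp)
  rw [charFun_apply_real, charFun_apply_real, integral_map hX (by fun_prop),
    integral_map hY (by fun_prop), ← integral_sub (hint hX) (hint hY), ← integral_const_mul]
  exact norm_integral_le_of_norm_le (hXY.norm.const_mul _) (ae_of_all _ hbound)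

lemma integral_norm_le_lpNorm_two {X : Ω → ℝ} (hX : MemLp X 2 μ) :
    ∫ ω, ‖X ω‖ ∂μ ≤ lpNorm X 2 μ := by
  have hXm := hX.aestronglyMeasurable
  rw [← lpNorm_one_eq_integral_norm hXm, ← toReal_eLpNorm hXm, ← toReal_eLpNorm hXm]
  exact ENNReal.toReal_mono hX.eLpNorm_ne_top (eLpNorm_le_eLpNorm_of_exponent_le one_le_two hXm)

lemma tendsto_charFun_gaussianReal {ι : Type*} {l : Filter ι} {v : ι → ℝ≥0} {w : ℝ≥0}
    (hv : Tendsto v l (𝓝 w)) (m t : ℝ) :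
    Tendsto (fun n => charFun (gaussianReal m (v n)) t) l (𝓝 (charFun (gaussianReal m w) t)) := by
  simp_rw [charFun_gaussianReal]
  have hcont : Continuous fun u : ℝ≥0 =>
      Complex.exp (t * m * Complex.I - ((u : ℝ) : ℂ) * t ^ 2 / 2) := by fun_prop
  exact (hcont.tendsto w).comp hv

lemma tendstoInDistribution_gaussian_of_approx {Y : ℕ → Ω → ℝ} {X : ℕ → ℕ → Ω → ℝ}
    {w : ℝ} {v a : ℕ → ℝ} {b : ℕ → ℕ → ℝ}
    (hX : ∀ q n, MemLp (X q n) 2 μ) (hY : ∀ n, MemLp (Y n) 2 μ)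
    (hXv : ∀ q, TendstoInDistribution (X q) atTop (id : ℝ → ℝ) (fun _ => μ)
      (gaussianReal 0 (v q).toNNReal))
    (hv : Tendsto v atTop (𝓝 w)) (ha : Tendsto a atTop (𝓝 0))
    (hb : ∀ q, Tendsto (b q) atTop (𝓝 0))
    (hab : ∀ q n, lpNorm (Y n - X q n) 2 μ ≤ a q + b q n) :
    TendstoInDistribution Y atTop (id : ℝ → ℝ) (fun _ => μ) (gaussianReal 0 w.toNNReal) where
  forall_aemeasurable n := (hY n).aestronglyMeasurable.aemeasurable
  tendsto := by
    refine ProbabilityMeasure.tendsto_iff_tendsto_charFun.2 fun t => ?_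
    simp only [ProbabilityMeasure.coe_mk, Measure.map_id]
    have hXchar : ∀ q, Tendsto (fun n => charFun (μ.map (X q n)) t) atTop
        (𝓝 (charFun (gaussianReal 0 (v q).toNNReal) t)) := fun q => by
      simpa using ProbabilityMeasure.tendsto_iff_tendsto_charFun.1 (hXv q).tendsto t
    refine tendsto_of_dist_le_add (a := fun q => |t| * a q) (b := fun q n => |t| * b q n) hXchar
      (tendsto_charFun_gaussianReal ((continuous_real_toNNReal.tendsto w).comp hv) 0 t)
      (by simpa using ha.const_mul |t|) (fun q => by simpa using (hb q).const_mul |t|)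
      fun q n => ?_
    have hYX := (hY n).sub (hX q n)
    rw [dist_eq_norm, ← mul_add]
    refine (norm_charFun_map_sub_le (hY n).aestronglyMeasurable.aemeasurable
      (hX q n).aestronglyMeasurable.aemeasurable (hYX.integrable one_le_two) t).trans ?_
    gcongr
    exact (integral_norm_le_lpNorm_two hYX).trans (hab q n)

lemma tendstoInDistribution_inv_sqrt_mul_sum_of_integral_eq_zero {X : ℕ → Ω → ℝ}
    (hX2 : MemLp (X 0) 2 μ) (hindep : iIndepFun X μ)
    (hident : ∀ i, IdentDistrib (X i) (X 0) μ μ) (h0 : ∫ ω, X 0 ω ∂μ = 0) :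
    TendstoInDistribution (fun (n : ℕ) ω => (√(n : ℝ))⁻¹ * ∑ k ∈ Finset.range n, X k ω) atTop
      (id : ℝ → ℝ) (fun _ => μ) (gaussianReal 0 (∫ ω, X 0 ω ^ 2 ∂μ).toNNReal) := by
  have hvar := variance_of_integral_eq_zero hX2.aestronglyMeasurable.aemeasurable h0
  simpa only [hvar, h0, mul_zero, sub_zero] using
    tendstoInDistribution_inv_sqrt_mul_sum_sub HasLaw.id hX2 hindep hident

end Distribution

lemma sum_range_mul {M : Type*} [AddCommMonoid M] (f : ℕ → M) (n Q : ℕ) :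
    ∑ i ∈ Finset.range (n * Q), f i =
      ∑ j ∈ Finset.range n, ∑ i ∈ Finset.range Q, f (j * Q + i) := by
  induction n with
  | zero => simp
  | succ n ih => rw [Nat.succ_mul, Finset.sum_range_add, ih, Finset.sum_range_succ]

lemma abs_sub_mul_natDiv_le (n : ℕ) {B : ℕ} (hB : 0 < B) : |(n : ℝ) - B * (n / B : ℕ)| ≤ B := by
  have hdiv : (B : ℝ) * (n / B : ℕ) + (n % B : ℕ) = n := by exact_mod_cast Nat.div_add_mod n B
  have hmod : ((n % B : ℕ) : ℝ) ≤ B := by exact_mod_cast (Nat.mod_lt n hB).le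
  rw [← hdiv, add_sub_cancel_left, abs_of_nonneg (by positivity)]
  exact hmod

lemma tendsto_div_of_abs_sub_mul_le {k : ℕ → ℕ} {s C : ℝ} (hs : s ≠ 0)
    (hk : ∀ n : ℕ, |(n : ℝ) - s * k n| ≤ C) :
    Tendsto (fun n : ℕ => (k n : ℝ) / n) atTop (𝓝 s⁻¹) := by
  have hdiff : Tendsto (fun n : ℕ => ((n : ℝ) - s * k n) / n) atTop (𝓝 0) :=
    squeeze_zero_norm (fun n => by
      rw [Real.norm_eq_abs, abs_div, Nat.abs_cast]
      exact div_le_div_of_nonneg_right (hk n) n.cast_nonneg)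
      (tendsto_const_div_atTop_nhds_zero_nat C)
  have hlim := (hdiff.const_sub 1).const_mul s⁻¹
  rw [sub_zero, mul_one] at hlim
  refine hlim.congr' ?_
  filter_upwards [eventually_ne_atTop 0] with n hn
  have : (n : ℝ) ≠ 0 := by exact_mod_cast hn
  field_simp
  ring

lemma tendsto_atTop_of_abs_sub_mul_le {k : ℕ → ℕ} {s C : ℝ} (hs : 0 < s)
    (hk : ∀ n : ℕ, |(n : ℝ) - s * k n| ≤ C) : Tendsto k atTop atTop := by
  refine tendsto_natCast_atTop_iff.1 (tendsto_atTop_mono (f := fun n : ℕ => ((n : ℝ) - C) / s)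
    (fun n => ?_) ?_)
  · rw [div_le_iff₀ hs]
    linarith [(abs_le.1 (hk n)).2]
  · exact (tendsto_atTop_add_const_right _ _ tendsto_natCast_atTop_atTop).atTop_div_const hs

section ShiftSum

variable {E : Type*}

/-- The sum of `F` evaluated along the sequence read from the indices `0, s, …, (k - 1) * s` on. -/
noncomputable def shiftSum (F : (ℕ → E) → ℝ) (s k : ℕ) (x : ℕ → E) : ℝ :=
  ∑ j ∈ Finset.range k, F (shift (j * s) x)

@[simp] lemma shiftSum_zero (F : (ℕ → E) → ℝ) (s : ℕ) : shiftSum F s 0 = 0 := by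
  ext
  simp [shiftSum]

lemma shiftSum_add (F : (ℕ → E) → ℝ) (s k l : ℕ) (x : ℕ → E) :
    shiftSum F s (k + l) x = shiftSum F s k x + shiftSum F s l (shift (k * s) x) := by
  simp only [shiftSum, Finset.sum_range_add, shift_shift, add_mul]

lemma shiftSum_mul (F : (ℕ → E) → ℝ) (s N Q : ℕ) (x : ℕ → E) :
    shiftSum F s (N * Q) x = shiftSum (shiftSum F s Q) (Q * s) N x := by
  simp only [shiftSum, sum_range_mul, shift_shift, add_mul, mul_assoc]

lemma shiftSum_sum_mul {ι : Type*} [Fintype ι] (c : ι → ℝ) (F : ι → (ℕ → E) → ℝ) (s k : ℕ)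
    (x : ℕ → E) :
    shiftSum (fun y => ∑ i, c i * F i y) s k x = ∑ i, c i * shiftSum (F i) s k x := by
  simp only [shiftSum, Finset.mul_sum]
  exact Finset.sum_comm

lemma dependsOn_shiftSum {F : (ℕ → E) → ℝ} {m s k M : ℕ} (hF : DependsOn F (Set.Iio m))
    (hM : ∀ j < k, j * s + m ≤ M) : DependsOn (shiftSum F s k) (Set.Iio M) := fun _ _ hxy =>
  Finset.sum_congr rfl fun j hj => dependsOn_comp_shift hF (hM j (Finset.mem_range.1 hj)) hxy

variable [MeasurableSpace E] {F : (ℕ → E) → ℝ}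

@[fun_prop] lemma measurable_shiftSum (hF : Measurable F) (s k : ℕ) :
    Measurable (shiftSum F s k) := by
  unfold shiftSum
  fun_prop

variable (ν : Measure E) [IsProbabilityMeasure ν]

local notation "ν∞" => Measure.infinitePi (fun _ : ℕ => ν)

lemma memLp_comp_shift {p : ENNReal} (hF : MemLp F p ν∞) (a : ℕ) :
    MemLp (fun x => F (shift a x)) p ν∞ :=
  hF.comp_measurePreserving (measurePreserving_shift ν a)

lemma lpNorm_comp_shift {p : ENNReal} (hF : AEStronglyMeasurable F ν∞) (a : ℕ) :
    lpNorm (fun x => F (shift a x)) p ν∞ = lpNorm F p ν∞ := by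
  have hshift := measurePreserving_shift ν a
  change lpNorm (F ∘ shift a) p ν∞ = lpNorm F p ν∞
  rw [← toReal_eLpNorm hF, ← toReal_eLpNorm (hF.comp_measurePreserving hshift),
    eLpNorm_comp_measurePreserving hF hshift]

lemma memLp_shiftSum {p : ENNReal} (hF : MemLp F p ν∞) (s k : ℕ) :
    MemLp (shiftSum F s k) p ν∞ :=
  memLp_finsetSum _ fun _ _ => memLp_comp_shift ν hF _

lemma integral_shiftSum (hF : Measurable F) (hF1 : Integrable F ν∞) (s k : ℕ) :
    ∫ x, shiftSum F s k x ∂ν∞ = k * ∫ x, F x ∂ν∞ := by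
  have hint : ∀ j, Integrable (fun x => F (shift (j * s) x)) ν∞ := fun j =>
    (measurePreserving_shift ν (j * s)).integrable_comp_of_integrable hF1
  unfold shiftSum
  rw [integral_finsetSum _ fun j _ => hint j]
  simp [integral_comp_shift ν hF]

lemma lpNorm_shiftSum_le {p : ENNReal} (hp : 1 ≤ p) (hF : MemLp F p ν∞) (s k : ℕ) :
    lpNorm (shiftSum F s k) p ν∞ ≤ k * lpNorm F p ν∞ := by
  unfold shiftSum
  simpa using lpNorm_fun_sum_le_card_mul hp (s := Finset.range k)
    (fun j _ => memLp_comp_shift ν hF (j * s))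
    fun j _ => (lpNorm_comp_shift ν hF.aestronglyMeasurable (j * s)).le

lemma lpNorm_shiftSum_sub_le {p : ENNReal} (hp : 1 ≤ p) (hF : MemLp F p ν∞) (s k l : ℕ) :
    lpNorm (shiftSum F s k - shiftSum F s l) p ν∞ ≤ |(k : ℝ) - l| * lpNorm F p ν∞ := by
  wlog hkl : l ≤ k generalizing k l
  · rw [lpNorm_sub_comm, abs_sub_comm]
    exact this l k (le_of_not_ge hkl)
  obtain ⟨d, rfl⟩ := Nat.exists_eq_add_of_le hkl
  have hsub :
      shiftSum F s (l + d) - shiftSum F s l = fun x => shiftSum F s d (shift (l * s) x) := by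
    ext x
    simp only [Pi.sub_apply, shiftSum_add, add_sub_cancel_left]
  rw [hsub, lpNorm_comp_shift ν (memLp_shiftSum ν hF s d).aestronglyMeasurable]
  simpa using lpNorm_shiftSum_le ν hp hF s d

lemma lpNorm_shiftSum_of_orthogonal (hF : Measurable F) (hF2 : MemLp F 2 ν∞) {s : ℕ}
    (h0 : ∀ k, ∫ x, F x * F (shift ((k + 1) * s) x) ∂ν∞ = 0) (k : ℕ) :
    lpNorm (shiftSum F s k) 2 ν∞ = √k * lpNorm F 2 ν∞ := by
  rw [lpNorm_two_eq_sqrt hF2.aestronglyMeasurable]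
  refine lpNorm_sum_range_of_orthogonal (fun j => memLp_comp_shift ν hF2 (j * s)) (fun j => ?_)
    (fun j i => (integral_comp_shift_mul_comp_shift ν hF s j (i + 1)).trans (h0 i)) k
  simp_rw [← sq]
  exact integral_comp_shift ν (hF.pow_const 2) (j * s)

lemma tendsto_integral_sq_shiftSum_div (hF : Measurable F) (hF2 : MemLp F 2 ν∞) {s m : ℕ}
    (hm : ∀ j, m ≤ j → ∫ x, F x * F (shift ((j + 1) * s) x) ∂ν∞ = 0) :
    Tendsto (fun k : ℕ => (k : ℝ)⁻¹ * ∫ x, shiftSum F s k x ^ 2 ∂ν∞) atTop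
      (𝓝 (∫ x, F x ^ 2 ∂ν∞
        + 2 * ∑ j ∈ Finset.range m, ∫ x, F x * F (shift ((j + 1) * s) x) ∂ν∞)) := by
  have hlim := tendsto_integral_sq_sum_range_div (X := fun j x => F (shift (j * s) x))
    (r := fun j => ∫ x, F x * F (shift (j * s) x) ∂ν∞) (fun j => memLp_comp_shift ν hF2 _)
    (fun i j => integral_comp_shift_mul_comp_shift ν hF s i j) hm
  simpa [shiftSum, ← sq] using hlim

lemma integral_mul_comp_shift_eq_zero_of_le (hF : Measurable F) {m a : ℕ}
    (hm : DependsOn F (Set.Iio m)) (h0 : ∫ x, F x ∂ν∞ = 0) (hma : m ≤ a) :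
    ∫ x, F x * F (shift a x) ∂ν∞ = 0 :=
  have hdep := hm.mono (Set.Iio_subset_Iio hma)
  integral_mul_comp_shift_eq_zero ν hF hF hdep hdep h0

end ShiftSum

section OneDependent

variable {E : Type*}

lemma shiftSum_eq_blocks_add_gaps_add_rest (X : (ℕ → E) → ℝ) (B q N : ℕ) (x : ℕ → E) :
    shiftSum X B N x =
      shiftSum (shiftSum X B (q + 1)) ((q + 2) * B) (N / (q + 2)) x
      + shiftSum (fun y => X (shift ((q + 1) * B) y)) ((q + 2) * B) (N / (q + 2)) x
      + shiftSum X B (N % (q + 2)) (shift (N / (q + 2) * (q + 2) * B) x) := by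
  conv_lhs => rw [← Nat.div_add_mod' N (q + 2), shiftSum_add, shiftSum_mul]
  congr 1
  simp only [shiftSum, ← Finset.sum_add_distrib]
  exact Finset.sum_congr rfl fun j _ => Finset.sum_range_succ _ _

variable [MeasurableSpace E] (ν : Measure E) [IsProbabilityMeasure ν] {X : (ℕ → E) → ℝ} {B : ℕ}

local notation "ν∞" => Measure.infinitePi (fun _ : ℕ => ν)

lemma lpNorm_shiftSum_gaps (hX : Measurable X) (hX2 : MemLp X 2 ν∞)
    (hB : DependsOn X (Set.Iio (2 * B))) (h0 : ∫ x, X x ∂ν∞ = 0) (q M : ℕ) :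
    lpNorm (shiftSum (fun y => X (shift ((q + 1) * B) y)) ((q + 2) * B) M) 2 ν∞ =
      √M * lpNorm X 2 ν∞ := by
  rw [lpNorm_shiftSum_of_orthogonal ν (F := fun y => X (shift ((q + 1) * B) y)) (by fun_prop)
      (memLp_comp_shift ν hX2 _),
    lpNorm_comp_shift ν hX2.aestronglyMeasurable]
  intro k
  have hlag : 2 * B ≤ (k + 1) * ((q + 2) * B) := by
    rw [← mul_assoc]
    exact Nat.mul_le_mul_right B (by nlinarith)
  rw [← integral_mul_comp_shift_eq_zero_of_le ν hX hB h0 hlag,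
    ← integral_comp_shift ν (F := fun x => X x * X (shift ((k + 1) * ((q + 2) * B)) x))
      (by fun_prop) ((q + 1) * B)]
  simp only [shift_shift, add_comm]

lemma lpNorm_shiftSum_sub_blocks_le (hX : Measurable X) (hX2 : MemLp X 2 ν∞)
    (hB : DependsOn X (Set.Iio (2 * B))) (h0 : ∫ x, X x ∂ν∞ = 0) (q N : ℕ) :
    lpNorm (shiftSum X B N
        - shiftSum (shiftSum X B (q + 1)) ((q + 2) * B) (N / (q + 2))) 2 ν∞ ≤
      √(N / (q + 2) : ℕ) * lpNorm X 2 ν∞ + (q + 2) * lpNorm X 2 ν∞ := by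
  have hgaps := memLp_shiftSum ν (memLp_comp_shift ν hX2 ((q + 1) * B)) ((q + 2) * B) (N / (q + 2))
  have hsub : shiftSum X B N - shiftSum (shiftSum X B (q + 1)) ((q + 2) * B) (N / (q + 2)) =
      shiftSum (fun y => X (shift ((q + 1) * B) y)) ((q + 2) * B) (N / (q + 2))
        + fun x => shiftSum X B (N % (q + 2)) (shift (N / (q + 2) * (q + 2) * B) x) := by
    ext x
    simp only [Pi.sub_apply, Pi.add_apply, shiftSum_eq_blocks_add_gaps_add_rest X B q N x]
    ring
  rw [hsub, ← lpNorm_shiftSum_gaps ν hX hX2 hB h0 q]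
  refine (lpNorm_add_le hgaps one_le_two).trans (add_le_add_right ?_ _)
  rw [lpNorm_comp_shift ν (memLp_shiftSum ν hX2 B _).aestronglyMeasurable]
  refine (lpNorm_shiftSum_le ν one_le_two hX2 B _).trans ?_
  gcongr
  · exact lpNorm_nonneg
  · exact_mod_cast (Nat.mod_lt N (by lia : 0 < q + 2)).le

lemma lpNorm_inv_sqrt_mul_shiftSum_sub_blocks_le (hX : Measurable X) (hX2 : MemLp X 2 ν∞)
    (hB : DependsOn X (Set.Iio (2 * B))) (h0 : ∫ x, X x ∂ν∞ = 0) (q N : ℕ) :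
    lpNorm ((fun x => (√N)⁻¹ * shiftSum X B N x) - fun x => (√N)⁻¹ *
        shiftSum (shiftSum X B (q + 1)) ((q + 2) * B) (N / (q + 2)) x) 2 ν∞ ≤
      (√(q + 2 : ℝ))⁻¹ * lpNorm X 2 ν∞ + (√N)⁻¹ * ((q + 2) * lpNorm X 2 ν∞) := by
  have hdiv : (√N)⁻¹ * √(N / (q + 2) : ℕ) ≤ (√(q + 2 : ℝ))⁻¹ := by
    rcases N.eq_zero_or_pos with rfl | hN
    · simp
    rw [← div_eq_inv_mul, ← Real.sqrt_div (by positivity), ← Real.sqrt_inv]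
    refine Real.sqrt_le_sqrt ((div_le_iff₀ (by positivity)).2 ?_)
    simpa [div_eq_inv_mul] using Nat.cast_div_le (α := ℝ) (m := N) (n := q + 2)
  have hfactor : ((fun x => (√N)⁻¹ * shiftSum X B N x) - fun x => (√N)⁻¹ *
        shiftSum (shiftSum X B (q + 1)) ((q + 2) * B) (N / (q + 2)) x) =
      fun x => (√N)⁻¹ * (shiftSum X B N
        - shiftSum (shiftSum X B (q + 1)) ((q + 2) * B) (N / (q + 2))) x := by
    ext x
    simp only [Pi.sub_apply, mul_sub]
  rw [hfactor, lpNorm_const_mul, abs_of_nonneg (by positivity)]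
  calc _ ≤ (√N)⁻¹ * (√(N / (q + 2) : ℕ) * lpNorm X 2 ν∞ + (q + 2) * lpNorm X 2 ν∞) := by
        gcongr
        exact lpNorm_shiftSum_sub_blocks_le ν hX hX2 hB h0 q N
    _ ≤ _ := by
        rw [mul_add, ← mul_assoc]
        gcongr
        exact lpNorm_nonneg

lemma tendstoInDistribution_inv_sqrt_mul_shiftSum_of_dependsOn_step {A : (ℕ → E) → ℝ} {s : ℕ}
    (hA : Measurable A) (hA2 : MemLp A 2 ν∞) (hs : DependsOn A (Set.Iio s))
    (h0 : ∫ x, A x ∂ν∞ = 0) :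
    TendstoInDistribution (fun (N : ℕ) x => (√N)⁻¹ * shiftSum A s N x) atTop (id : ℝ → ℝ)
      (fun _ => ν∞) (gaussianReal 0 (∫ x, A x ^ 2 ∂ν∞).toNNReal) := by
  have hident : ∀ i : ℕ, IdentDistrib (fun x => A (shift (i * s) x)) A ν∞ ν∞ := fun i => by
    refine ⟨by fun_prop, by fun_prop, ?_⟩
    have hmap := Measure.map_map (μ := ν∞) hA (measurable_shift (i * s))
    rw [(measurePreserving_shift ν (i * s)).map_eq] at hmap
    exact hmap.symm
  have hclt := tendstoInDistribution_inv_sqrt_mul_sum_of_integral_eq_zero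
    (X := fun (j : ℕ) x => A (shift (j * s) x)) (memLp_comp_shift ν hA2 _)
    (iIndepFun_comp_shift ν (fun _ => hA) fun _ => hs)
    (fun i => (hident i).trans (hident 0).symm) (by simpa using h0)
  simpa [shiftSum] using hclt

end OneDependent

lemma tendstoInDistribution_inv_sqrt_mul_comp_natDiv {Ω : Type*} [MeasurableSpace Ω]
    {μ : Measure Ω} [IsProbabilityMeasure μ] {T : ℕ → Ω → ℝ} (hT0 : T 0 = 0) {v : ℝ}
    (hT : TendstoInDistribution (fun (N : ℕ) ω => (√N)⁻¹ * T N ω) atTop (id : ℝ → ℝ)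
      (fun _ => μ) (gaussianReal 0 v.toNNReal)) {p : ℕ} (hp : 0 < p) :
    TendstoInDistribution (fun (N : ℕ) ω => (√N)⁻¹ * T (N / p) ω) atTop (id : ℝ → ℝ)
      (fun _ => μ) (gaussianReal 0 ((p : ℝ)⁻¹ * v).toNNReal) := by
  have hp' : (p : ℝ) ≠ 0 := by exact_mod_cast hp.ne'
  have hlim := tendstoInDistribution_gaussian_const_mul
    (tendstoInDistribution_comp_index hT (Nat.tendsto_div_const_atTop hp.ne'))
    (tendsto_div_of_abs_sub_mul_le hp' (abs_sub_mul_natDiv_le · hp)).sqrt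
  rw [Real.sq_sqrt (by positivity)] at hlim
  convert hlim using 3 with N ω
  rcases (N / p).eq_zero_or_pos with hN | hN
  · simp [hN, hT0]
  have hN' : (0 : ℝ) < (N / p : ℕ) := by exact_mod_cast hN
  rw [Real.sqrt_div hN'.le, ← mul_assoc]
  field_simp

section OneDependentCLT

variable {E : Type*} [MeasurableSpace E] (ν : Measure E) [IsProbabilityMeasure ν]
  {X : (ℕ → E) → ℝ} {B : ℕ}

local notation "ν∞" => Measure.infinitePi (fun _ : ℕ => ν)

/-- Bernstein blocks: dropping every `(q + 2)`-nd term leaves independent blocks of `q + 1` terms,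
and the dropped terms are negligible in `L²` as `q → ∞`, uniformly in `N`. -/
theorem tendstoInDistribution_inv_sqrt_mul_shiftSum (hX : Measurable X) (hX2 : MemLp X 2 ν∞)
    (hB : DependsOn X (Set.Iio (2 * B))) (h0 : ∫ x, X x ∂ν∞ = 0) {w : ℝ}
    (hw : Tendsto (fun N : ℕ => (N : ℝ)⁻¹ * ∫ x, shiftSum X B N x ^ 2 ∂ν∞) atTop (𝓝 w)) :
    TendstoInDistribution (fun (N : ℕ) x => (√N)⁻¹ * shiftSum X B N x) atTop (id : ℝ → ℝ)
      (fun _ => ν∞) (gaussianReal 0 w.toNNReal) := by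
  have hblock : ∀ q, DependsOn (shiftSum X B (q + 1)) (Set.Iio ((q + 2) * B)) := fun q =>
    dependsOn_shiftSum hB fun j hj => by nlinarith
  have hblock0 : ∀ q, ∫ x, shiftSum X B (q + 1) x ∂ν∞ = 0 := fun q => by
    rw [integral_shiftSum ν hX (hX2.integrable one_le_two), h0, mul_zero]
  have hratio : Tendsto (fun q : ℕ => ((q + 1 : ℕ) : ℝ) / ((q + 2 : ℕ) : ℝ)) atTop (𝓝 1) := by
    simpa [Function.comp_def, add_assoc, one_add_one_eq_two] using
      (tendsto_natCast_div_add_atTop (1 : ℝ)).comp (tendsto_add_atTop_nat 1)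
  have hsqrt : Tendsto (fun n : ℕ => (√(n : ℝ))⁻¹) atTop (𝓝 0) :=
    (Real.tendsto_sqrt_atTop.comp tendsto_natCast_atTop_atTop).inv_tendsto_atTop
  refine tendstoInDistribution_gaussian_of_approx
    (X := fun q N x =>
      (√N)⁻¹ * shiftSum (shiftSum X B (q + 1)) ((q + 2) * B) (N / (q + 2)) x)
    (v := fun q => ((q + 2 : ℕ) : ℝ)⁻¹ * ∫ x, shiftSum X B (q + 1) x ^ 2 ∂ν∞)
    (a := fun q => (√(q + 2 : ℝ))⁻¹ * lpNorm X 2 ν∞)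
    (b := fun q N => (√N)⁻¹ * ((q + 2) * lpNorm X 2 ν∞))
    (fun q N => (memLp_shiftSum ν (memLp_shiftSum ν hX2 _ _) _ _).const_mul _)
    (fun N => (memLp_shiftSum ν hX2 _ _).const_mul _)
    (fun q => tendstoInDistribution_inv_sqrt_mul_comp_natDiv (shiftSum_zero _ _)
      (tendstoInDistribution_inv_sqrt_mul_shiftSum_of_dependsOn_step ν (by fun_prop)
        (memLp_shiftSum ν hX2 _ _) (hblock q) (hblock0 q)) (by lia))
    ?_ ?_ (fun q => ?_) (lpNorm_inv_sqrt_mul_shiftSum_sub_blocks_le ν hX hX2 hB h0)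
  · have hlim := hratio.mul (hw.comp (tendsto_add_atTop_nat 1))
    rw [one_mul] at hlim
    refine hlim.congr fun q => ?_
    simp only [Function.comp_apply]
    field_simp
  · simpa using (hsqrt.comp (tendsto_add_atTop_nat 2)).mul_const (lpNorm X 2 ν∞)
  · simpa using hsqrt.mul_const ((q + 2) * lpNorm X 2 ν∞)

lemma exists_limit_inv_sqrt_mul_shiftSum_div (hX : Measurable X) (hX2 : MemLp X 2 ν∞) (hB : 0 < B)
    (hXB : DependsOn X (Set.Iio (2 * B))) (h0 : ∫ x, X x ∂ν∞ = 0) :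
    ∃ w : ℝ,
      Tendsto (fun n : ℕ => ∫ x, ((√n)⁻¹ * shiftSum X B (n / B) x) ^ 2 ∂ν∞) atTop (𝓝 w) ∧
      TendstoInDistribution (fun (n : ℕ) x => (√n)⁻¹ * shiftSum X B (n / B) x) atTop
        (id : ℝ → ℝ) (fun _ => ν∞) (gaussianReal 0 w.toNNReal) := by
  have hw := tendsto_integral_sq_shiftSum_div ν hX hX2 (s := B) (m := 1) fun j hj =>
    integral_mul_comp_shift_eq_zero_of_le ν hX hXB h0 (Nat.mul_le_mul_right B (by lia))
  have hratio := tendsto_div_of_abs_sub_mul_le (by exact_mod_cast hB.ne')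
    (abs_sub_mul_natDiv_le · hB)
  refine ⟨(B : ℝ)⁻¹ * _,
    (hratio.mul (hw.comp (Nat.tendsto_div_const_atTop hB.ne'))).congr fun n => ?_,
    tendstoInDistribution_inv_sqrt_mul_comp_natDiv (shiftSum_zero X B)
      (tendstoInDistribution_inv_sqrt_mul_shiftSum ν hX hX2 hXB h0 hw) hB⟩
  simp only [mul_pow, inv_pow, Real.sq_sqrt n.cast_nonneg, integral_const_mul,
    Function.comp_apply]
  rcases (n / B).eq_zero_or_pos with hn | hn
  · simp [hn]
  field_simp

end OneDependentCLT

lemma exists_pos_forall_dvd_forall_le {ι : Type*} [Finite ι] {s : ι → ℕ} (hs : ∀ i, 0 < s i)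
    (m : ι → ℕ) : ∃ B, 0 < B ∧ (∀ i, s i ∣ B) ∧ ∀ i, m i ≤ B := by
  have := Fintype.ofFinite ι
  have hprod : 0 < ∏ i, s i := Finset.prod_pos fun i _ => hs i
  refine ⟨(∏ i, s i) * (1 + ∑ i, m i), by positivity,
    fun i => (Finset.dvd_prod_of_mem s (Finset.mem_univ i)).mul_right _, fun i => ?_⟩
  have hsum : m i ≤ ∑ j, m j := Finset.single_le_sum (fun _ _ => Nat.zero_le _) (Finset.mem_univ i)
  exact hsum.trans ((Nat.le_add_left _ 1).trans (Nat.le_mul_of_pos_left _ hprod))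

section MovingAverage

variable {E : Type*}

/-- The average of `F` over the `k` shifts by `0, s, …, (k - 1) * s`, which is `0` for `k = 0`. -/
noncomputable def movingAvg (F : (ℕ → E) → ℝ) (s k : ℕ) (x : ℕ → E) : ℝ :=
  (1 / (k : ℝ)) * shiftSum F s k x

lemma movingAvg_sub_const (F : (ℕ → E) → ℝ) (c : ℝ) (s : ℕ) {k : ℕ} (hk : 0 < k) (x : ℕ → E) :
    movingAvg F s k x - c = movingAvg (fun y => F y - c) s k x := by
  have hk' : (k : ℝ) ≠ 0 := by exact_mod_cast hk.ne'
  simp only [movingAvg, shiftSum, Finset.sum_sub_distrib, Finset.sum_const, Finset.card_range,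
    nsmul_eq_mul]
  field_simp

variable [MeasurableSpace E] (ν : Measure E) [IsProbabilityMeasure ν]

local notation "ν∞" => Measure.infinitePi (fun _ : ℕ => ν)

lemma memLp_movingAvg {F : (ℕ → E) → ℝ} {p : ENNReal} (hF : MemLp F p ν∞) (s k : ℕ) :
    MemLp (movingAvg F s k) p ν∞ :=
  (memLp_shiftSum ν hF s k).const_mul _

lemma integral_movingAvg {F : (ℕ → E) → ℝ} (hF : Measurable F) (hF1 : Integrable F ν∞) (s : ℕ)
    {k : ℕ} (hk : 0 < k) : ∫ x, movingAvg F s k x ∂ν∞ = ∫ x, F x ∂ν∞ := by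
  have hk' : (k : ℝ) ≠ 0 := by exact_mod_cast hk.ne'
  simp only [movingAvg]
  rw [integral_const_mul, integral_shiftSum ν hF hF1, ← mul_assoc, one_div_mul_cancel hk', one_mul]

lemma integral_sub_integral_eq_zero {Ω : Type*} [MeasurableSpace Ω] {μ : Measure Ω}
    [IsProbabilityMeasure μ] {F : Ω → ℝ} (hF : Integrable F μ) :
    ∫ x, (F x - ∫ y, F y ∂μ) ∂μ = 0 := by
  rw [integral_sub hF (integrable_const _)]
  simp

lemma lpNorm_sqrt_mul_movingAvg_sub_le {p : ENNReal} (hp : 1 ≤ p) {G : (ℕ → E) → ℝ}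
    (hG : MemLp G p ν∞) {s k l n : ℕ} {C D : ℝ} (hk : 0 < k) (hC : |(n : ℝ) - s * k| ≤ C)
    (hD : |(n : ℝ) - s * l| ≤ D) :
    lpNorm ((fun x => √n * movingAvg G s k x) - fun x => (√n)⁻¹ * (s * shiftSum G s l x)) p ν∞ ≤
      (√n)⁻¹ * ((2 * C + D) * lpNorm G p ν∞) := by
  have hk' : (0 : ℝ) < k := by exact_mod_cast hk
  have hsplit : ((fun x => √n * movingAvg G s k x) - fun x => (√n)⁻¹ * (s * shiftSum G s l x)) =
      fun x => (√n)⁻¹ * (((n - s * k) / k) * shiftSum G s k x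
        + s * (shiftSum G s k - shiftSum G s l) x) := by
    ext x
    rcases n.eq_zero_or_pos with rfl | hn
    · simp
    have hn' : √(n : ℝ) ≠ 0 := (Real.sqrt_pos.2 (by exact_mod_cast hn)).ne'
    simp only [movingAvg, Pi.sub_apply]
    field_simp
    rw [Real.sq_sqrt n.cast_nonneg]
    ring
  have hfirst : lpNorm (fun x => ((n - s * k) / k) * shiftSum G s k x) p ν∞ ≤
      C * lpNorm G p ν∞ := by
    rw [lpNorm_const_mul, abs_div, abs_of_pos hk', div_mul_eq_mul_div, div_le_iff₀ hk']
    calc |(n : ℝ) - s * k| * lpNorm (shiftSum G s k) p ν∞ ≤ C * (k * lpNorm G p ν∞) :=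
          mul_le_mul hC (lpNorm_shiftSum_le ν hp hG s k) lpNorm_nonneg ((abs_nonneg _).trans hC)
      _ = C * lpNorm G p ν∞ * k := by ring
  have hsecond : lpNorm (fun x => s * (shiftSum G s k - shiftSum G s l) x) p ν∞ ≤
      (C + D) * lpNorm G p ν∞ := by
    have hkl : (s : ℝ) * |(k : ℝ) - l| ≤ C + D := by
      rw [← Nat.abs_cast s, ← abs_mul]
      calc |(s : ℝ) * (k - l)| = |-((n : ℝ) - s * k) + (n - s * l)| := by ring_nf
        _ ≤ C + D := (abs_add_le _ _).trans (by rw [abs_neg]; exact add_le_add hC hD)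
    rw [lpNorm_const_mul, Nat.abs_cast]
    calc s * lpNorm (shiftSum G s k - shiftSum G s l) p ν∞
        ≤ s * (|(k : ℝ) - l| * lpNorm G p ν∞) := by
          gcongr
          exact lpNorm_shiftSum_sub_le ν hp hG s k l
      _ ≤ (C + D) * lpNorm G p ν∞ := by
          rw [← mul_assoc]
          exact mul_le_mul_of_nonneg_right hkl lpNorm_nonneg
  rw [hsplit, lpNorm_const_mul, abs_of_nonneg (by positivity)]
  gcongr
  calc _ ≤ C * lpNorm G p ν∞ + (C + D) * lpNorm G p ν∞ :=
        (lpNorm_add_le ((memLp_shiftSum ν hG s k).const_mul _) hp).trans (add_le_add hfirst hsecond)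
    _ = _ := by ring

variable {F : (ℕ → E) → ℝ} {C D : ℝ}

lemma tendsto_lpNorm_sqrt_mul_movingAvg_sub {p : ENNReal} (hp : 1 ≤ p) (hF : MemLp F p ν∞) (c : ℝ)
    {s : ℕ} (hs : 0 < s) {k l : ℕ → ℕ} (hk : ∀ n : ℕ, |(n : ℝ) - s * k n| ≤ C)
    (hl : ∀ n : ℕ, |(n : ℝ) - s * l n| ≤ D) :
    Tendsto (fun n : ℕ => lpNorm ((fun x => √n * (movingAvg F s (k n) x - c))
      - fun x => (√n)⁻¹ * (s * shiftSum (fun y => F y - c) s (l n) x)) p ν∞) atTop (𝓝 0) := by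
  have hsqrt : Tendsto (fun n : ℕ => (√(n : ℝ))⁻¹) atTop (𝓝 0) :=
    (Real.tendsto_sqrt_atTop.comp tendsto_natCast_atTop_atTop).inv_tendsto_atTop
  have hlim := hsqrt.mul_const ((2 * C + D) * lpNorm (fun x => F x - c) p ν∞)
  rw [zero_mul] at hlim
  refine squeeze_zero' (Eventually.of_forall fun n => lpNorm_nonneg) ?_ hlim
  filter_upwards [(tendsto_atTop_of_abs_sub_mul_le (by exact_mod_cast hs) hk).eventually_gt_atTop 0]
    with n hn
  simp only [movingAvg_sub_const F c s hn]
  exact lpNorm_sqrt_mul_movingAvg_sub_le ν hp (hF.sub (memLp_const c)) hn (hk n) (hl n)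

lemma tendsto_integral_sq_movingAvg (hF : Measurable F) (hF2 : MemLp F 2 ν∞) {m s : ℕ}
    (hs : 0 < s) (hm : DependsOn F (Set.Iio m)) {k : ℕ → ℕ}
    (hk : ∀ n : ℕ, |(n : ℝ) - s * k n| ≤ C) :
    Tendsto (fun n : ℕ => ∫ x, (√n * (movingAvg F s (k n) x - ∫ y, F y ∂ν∞)) ^ 2 ∂ν∞) atTop
      (𝓝 (s * (Var[F; ν∞]
        + 2 * ∑ j ∈ Finset.range m, cov[F, fun x => F (shift ((j + 1) * s) x); ν∞]))) := by
  have hs' : (s : ℝ) ≠ 0 := by exact_mod_cast hs.ne'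
  set G : (ℕ → E) → ℝ := fun x => F x - ∫ y, F y ∂ν∞ with hG
  have hGm : Measurable G := by fun_prop
  have hG2 : MemLp G 2 ν∞ := hF2.sub (memLp_const _)
  have hG0 : ∫ x, G x ∂ν∞ = 0 := integral_sub_integral_eq_zero (hF2.integrable one_le_two)
  have hcov : ∀ j, ∫ x, G x * G (shift j x) ∂ν∞ = cov[F, fun x => F (shift j x); ν∞] := fun j => by
    simp only [hG, covariance, integral_comp_shift ν hF]
  have hlim := tendsto_integral_sq_shiftSum_div ν hGm hG2 (s := s) (m := m) fun j hj =>
    integral_mul_comp_shift_eq_zero_of_le ν hGm (m := m) (fun x y h => by simp only [hG, hm h]) hG0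
      (le_trans (by lia) (Nat.le_mul_of_pos_right (j + 1) hs))
  simp only [hcov] at hlim
  rw [← variance_eq_integral hF.aemeasurable] at hlim
  refine tendsto_integral_sq_of_tendsto_lpNorm_sub
    (fun n => ((memLp_shiftSum ν hG2 s (k n)).const_mul _).const_mul _)
    (fun n => ((memLp_movingAvg ν hF2 s (k n)).sub (memLp_const _)).const_mul _) ?_
    (tendsto_lpNorm_sqrt_mul_movingAvg_sub ν one_le_two hF2 _ hs hk hk)
  have hk0 := tendsto_atTop_of_abs_sub_mul_le (by positivity) hk
  have hmul := ((tendsto_div_of_abs_sub_mul_le hs' hk).const_mul ((s : ℝ) ^ 2)).mul (hlim.comp hk0)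
  rw [sq, mul_assoc (s : ℝ), mul_inv_cancel₀ hs', mul_one] at hmul
  refine hmul.congr' ?_
  filter_upwards [hk0.eventually_ne_atTop 0] with n hn
  have hn' : (k n : ℝ) ≠ 0 := by exact_mod_cast hn
  simp only [mul_pow, inv_pow, Real.sq_sqrt n.cast_nonneg, integral_const_mul,
    Function.comp_apply]
  field_simp

lemma tendsto_lpNorm_sqrt_mul_sum_movingAvg_sub {ι : Type*} [Fintype ι] {p : ENNReal} (hp : 1 ≤ p)
    {F : ι → (ℕ → E) → ℝ} (hF : ∀ i, MemLp (F i) p ν∞) (a c : ι → ℝ) {s : ι → ℕ}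
    (hs : ∀ i, 0 < s i) {k l : ι → ℕ → ℕ} (hk : ∀ i (n : ℕ), |(n : ℝ) - s i * k i n| ≤ C)
    (hl : ∀ i (n : ℕ), |(n : ℝ) - s i * l i n| ≤ D) :
    Tendsto (fun n : ℕ => lpNorm
      ((fun x => √n * ∑ i, a i * (movingAvg (F i) (s i) (k i n) x - c i)) - fun x => (√n)⁻¹ *
        ∑ i, a i * s i * shiftSum (fun y => F i y - c i) (s i) (l i n) x) p ν∞) atTop (𝓝 0) := by
  set Δ : ℕ → ι → (ℕ → E) → ℝ := fun n i => (fun x => √n * (movingAvg (F i) (s i) (k i n) x - c i))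
    - fun x => (√n)⁻¹ * (s i * shiftSum (fun y => F i y - c i) (s i) (l i n) x) with hΔ
  have hΔp : ∀ n i, MemLp (Δ n i) p ν∞ := fun n i =>
    (((memLp_movingAvg ν (hF i) _ _).sub (memLp_const _)).const_mul _).sub
      (((memLp_shiftSum ν ((hF i).sub (memLp_const _)) _ _).const_mul _).const_mul _)
  have hlim : Tendsto (fun n => ∑ i, |a i| * lpNorm (Δ n i) p ν∞) atTop (𝓝 0) := by
    simpa using tendsto_finsetSum Finset.univ fun i _ => (tendsto_lpNorm_sqrt_mul_movingAvg_sub ν hp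
      (hF i) (c i) (hs i) (hk i) (hl i)).const_mul |a i|
  refine squeeze_zero (fun n => lpNorm_nonneg) (fun n => ?_) hlim
  have hsum : ((fun x => √n * ∑ i, a i * (movingAvg (F i) (s i) (k i n) x - c i)) - fun x =>
      (√n)⁻¹ * ∑ i, a i * s i * shiftSum (fun y => F i y - c i) (s i) (l i n) x) =
      ∑ i, fun x => a i * Δ n i x := by
    ext x
    simp only [Pi.sub_apply, Finset.sum_apply, hΔ, Finset.mul_sum, ← Finset.sum_sub_distrib]
    exact Finset.sum_congr rfl fun i _ => by ring
  rw [hsum]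
  refine (lpNorm_sum_le (fun i _ => (hΔp n i).const_mul (a i)) hp).trans_eq ?_
  simp only [lpNorm_const_mul]

/-- A common multiple `B` of the steps which dominates the ranges makes the sum over a block of
length `B` depend on two blocks only. -/
lemma exists_limit_sum_shiftSum {ι : Type*} [Fintype ι] (b : ι → ℝ) {G : ι → (ℕ → E) → ℝ}
    (hG : ∀ i, Measurable (G i)) (hG2 : ∀ i, MemLp (G i) 2 ν∞) {m s : ι → ℕ} (hs : ∀ i, 0 < s i)
    (hm : ∀ i, DependsOn (G i) (Set.Iio (m i))) (hG0 : ∀ i, ∫ x, G i x ∂ν∞ = 0) :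
    ∃ (l : ι → ℕ → ℕ) (D w : ℝ), (∀ i (n : ℕ), |(n : ℝ) - s i * l i n| ≤ D) ∧
      Tendsto (fun n : ℕ => ∫ x, ((√n)⁻¹ * ∑ i, b i * shiftSum (G i) (s i) (l i n) x) ^ 2 ∂ν∞)
        atTop (𝓝 w) ∧
      TendstoInDistribution (fun (n : ℕ) x => (√n)⁻¹ * ∑ i, b i * shiftSum (G i) (s i) (l i n) x)
        atTop (id : ℝ → ℝ) (fun _ => ν∞) (gaussianReal 0 w.toNNReal) := by
  obtain ⟨B, hB, hdvd, hmB⟩ := exists_pos_forall_dvd_forall_le hs m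
  choose d hd using hdvd
  set X : (ℕ → E) → ℝ := fun x => ∑ i, b i * shiftSum (G i) (s i) (d i) x with hX
  have hXsum : ∀ N x, shiftSum X B N x = ∑ i, b i * shiftSum (G i) (s i) (N * d i) x := by
    intro N x
    rw [hX, shiftSum_sum_mul]
    exact Finset.sum_congr rfl fun i _ => by rw [shiftSum_mul, hd i, mul_comm (d i)]
  have hX2 : MemLp X 2 ν∞ :=
    memLp_finsetSum _ fun i _ => (memLp_shiftSum ν (hG2 i) (s i) (d i)).const_mul _
  have hX0 : ∫ x, X x ∂ν∞ = 0 := by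
    rw [integral_finsetSum _ fun i _ =>
      ((memLp_shiftSum ν (hG2 i) (s i) (d i)).integrable one_le_two).const_mul _]
    simp only [integral_const_mul, integral_shiftSum ν (hG _) ((hG2 _).integrable one_le_two), hG0,
      mul_zero, Finset.sum_const_zero]
  have hdep : ∀ i, DependsOn (shiftSum (G i) (s i) (d i)) (Set.Iio (2 * B)) := fun i =>
    dependsOn_shiftSum (hm i) fun j hj => by
      have hblock : s i * j ≤ s i * d i := Nat.mul_le_mul_left _ hj.le
      rw [← hd i, mul_comm] at hblock
      linarith [hmB i]
  have hXB : DependsOn X (Set.Iio (2 * B)) := fun x y hxy =>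
    Finset.sum_congr rfl fun i _ => by rw [hdep i hxy]
  obtain ⟨w, hw, hclt⟩ :=
    exists_limit_inv_sqrt_mul_shiftSum_div ν (by fun_prop) hX2 hB hXB hX0
  simp only [hXsum] at hw hclt
  refine ⟨fun i n => n / B * d i, B, w, fun i n => le_of_eq_of_le ?_ (abs_sub_mul_natDiv_le n hB),
    hw, hclt⟩
  have hB' : (B : ℝ) = s i * d i := by exact_mod_cast hd i
  rw [hB', Nat.cast_mul]
  ring_nf

theorem exists_limit_movingAvg {ι : Type*} [Fintype ι] (a : ι → ℝ) {F : ι → (ℕ → E) → ℝ}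
    (hF : ∀ i, Measurable (F i)) (hF2 : ∀ i, MemLp (F i) 2 ν∞) {m s : ι → ℕ} (hs : ∀ i, 0 < s i)
    (hm : ∀ i, DependsOn (F i) (Set.Iio (m i))) {k : ι → ℕ → ℕ}
    (hk : ∀ i (n : ℕ), |(n : ℝ) - s i * k i n| ≤ C) :
    ∃ w : ℝ,
      Tendsto (fun n : ℕ => ∫ x, (√n * ∑ i, a i * (movingAvg (F i) (s i) (k i n) x
        - ∫ y, F i y ∂ν∞)) ^ 2 ∂ν∞) atTop (𝓝 w) ∧
      TendstoInDistribution (fun (n : ℕ) x => √n * ∑ i, a i *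
        (movingAvg (F i) (s i) (k i n) x - ∫ y, F i y ∂ν∞)) atTop (id : ℝ → ℝ)
        (fun _ => ν∞) (gaussianReal 0 w.toNNReal) := by
  have hG2 : ∀ i, MemLp (fun x => F i x - ∫ y, F i y ∂ν∞) 2 ν∞ := fun i =>
    (hF2 i).sub (memLp_const _)
  obtain ⟨l, D, w, hl, hw, hclt⟩ := exists_limit_sum_shiftSum ν (m := m) (fun i => a i * s i)
    (fun i => (hF i).sub_const (∫ y, F i y ∂ν∞)) hG2 hs
    (fun i x y h => by simp only [hm i h])
    fun i => integral_sub_integral_eq_zero ((hF2 i).integrable one_le_two)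
  have hsub := tendsto_lpNorm_sqrt_mul_sum_movingAvg_sub ν one_le_two hF2 a
    (fun i => ∫ y, F i y ∂ν∞) hs hk hl
  have hsums := fun n : ℕ => (memLp_finsetSum Finset.univ fun i _ =>
    (memLp_shiftSum ν (hG2 i) (s i) (l i n)).const_mul (a i * s i)).const_mul (√(n : ℝ))⁻¹
  have havgs := fun n : ℕ => (memLp_finsetSum Finset.univ fun i _ =>
    ((memLp_movingAvg ν (hF2 i) (s i) (k i n)).sub
      (memLp_const (∫ y, F i y ∂ν∞))).const_mul (a i)).const_mul √(n : ℝ)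
  exact ⟨w, tendsto_integral_sq_of_tendsto_lpNorm_sub hsums havgs hw hsub,
    tendstoInDistribution_of_tendsto_lpNorm_sub hsums havgs hclt hsub⟩

end MovingAverage

lemma exists_monotone_seq {α : Type*} [Preorder α] {a b c d : α} (hab : a ≤ b) (hbc : b ≤ c)
    (hcd : c ≤ d) : ∃ t : ℕ → α, Monotone t ∧ t 0 = a ∧ t 1 = b ∧ t 2 = c ∧ t 3 = d := by
  let t : ℕ → α
    | 0 => a
    | 1 => b
    | 2 => c
    | _ => d
  refine ⟨t, monotone_nat_of_le_succ fun n => ?_, rfl, rfl, rfl, rfl⟩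
  match n with
  | 0 => exact hab
  | 1 => exact hbc
  | 2 => exact hcd
  | n + 3 => exact le_rfl

section TradeSign

variable {Ω : Type*} [MeasurableSpace Ω] {μ : Measure Ω} {X : ℝ≥0 → Ω → ℝ} {S lam : ℝ}

omit [MeasurableSpace Ω] in
lemma noise_eq_mul_tradeSign (S : ℝ) (X : ℝ≥0 → Ω → ℝ) (t : ℝ≥0) :
    noise S X t = fun ω => S / 2 * tradeSign X t ω := by
  ext ω
  simp only [noise, tradeSign]
  ring

namespace IsTradeDirection

variable (hX : IsTradeDirection X S lam μ)
include hX

@[fun_prop] lemma aemeasurable_tradeSign (t : ℝ≥0) : AEMeasurable (tradeSign X t) μ := by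
  have := (hX.law t).aemeasurable
  unfold tradeSign
  fun_prop

lemma ae_tradeSign (t : ℝ≥0) : ∀ᵐ ω ∂μ, tradeSign X t ω = 1 ∨ tradeSign X t ω = -1 := by
  have h_bernoulli : ∀ᵐ x ∂(bernoulliMeasure (1 : ℝ) 0 ⟨1 / 2, by norm_num, by norm_num⟩),
      x = 1 ∨ x = 0 := by
    rw [bernoulliMeasure_def, ae_add_measure_iff]
    constructor <;> refine Measure.ae_smul_measure ?_ _ <;> simp [ae_dirac_eq]
  have h_meas : MeasurableSet {x : ℝ | x = 1 ∨ x = 0} :=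
    (measurableSet_singleton 1).union (measurableSet_singleton 0)
  filter_upwards [((hX.law t).ae_iff (measurableSet_setOfPred.1 h_meas)).2 h_bernoulli] with ω hω
  unfold tradeSign
  rcases hω with h | h <;> rw [h] <;> norm_num

lemma ae_tradeSign_sq (t : ℝ≥0) : ∀ᵐ ω ∂μ, tradeSign X t ω ^ 2 = 1 := by
  filter_upwards [hX.ae_tradeSign t] with ω h
  rcases h with h | h <;> rw [h] <;> norm_num

lemma integral_tradeSign (t : ℝ≥0) : ∫ ω, tradeSign X t ω ∂μ = 0 := by
  have h := (hX.law t).integral_comp (f := fun x : ℝ => 2 * x - 1) (by fun_prop)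
  simp only [integral_bernoulliMeasure, smul_eq_mul, Function.comp_def] at h
  unfold tradeSign
  rw [h]
  norm_num

variable [IsProbabilityMeasure μ]

lemma memLp_tradeSign (t : ℝ≥0) (q : ENNReal) : MemLp (tradeSign X t) q μ :=
  MemLp.of_bound (hX.aemeasurable_tradeSign t).aestronglyMeasurable 1 (by
    filter_upwards [hX.ae_tradeSign t] with ω h
    rcases h with h | h <;> rw [h] <;> norm_num)

lemma variance_noise (t : ℝ≥0) : Var[noise S X t; μ] = (S / 2) ^ 2 := by
  rw [noise_eq_mul_tradeSign, variance_const_mul,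
    variance_of_integral_eq_zero (hX.aemeasurable_tradeSign t) (hX.integral_tradeSign t),
    integral_congr_ae (hX.ae_tradeSign_sq t)]
  simp

lemma integral_tradeSign_mul (hS : S ≠ 0) (s t : ℝ≥0) :
    ∫ ω, tradeSign X s ω * tradeSign X t ω ∂μ = Real.exp (-|(t : ℝ) - (s : ℝ)| / lam) := by
  rw [← hX.corr_eq s t, corr, hX.variance_noise, hX.variance_noise,
    Real.mul_self_sqrt (sq_nonneg _), noise_eq_mul_tradeSign, noise_eq_mul_tradeSign,
    covariance_const_mul_left, covariance_const_mul_right,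
    covariance_eq_sub (hX.memLp_tradeSign s 2) (hX.memLp_tradeSign t 2),
    hX.integral_tradeSign, zero_mul, sub_zero]
  simp only [Pi.mul_apply]
  field_simp

lemma integral_tradeSign_mul_mul (hS : S ≠ 0) {a b c d : ℝ≥0}
    (hab : a ≤ b) (hbc : b ≤ c) (hcd : c ≤ d) :
    ∫ ω, (tradeSign X a ω * tradeSign X b ω) * (tradeSign X c ω * tradeSign X d ω) ∂μ =
      Real.exp (-((b : ℝ) - a) / lam) * Real.exp (-((d : ℝ) - c) / lam) := by
  obtain ⟨t, ht, rfl, rfl, rfl, rfl⟩ := exists_monotone_seq hab hbc hcd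
  have h_meas (k : ℕ) : AEStronglyMeasurable (signRatio X t (k + 1)) μ :=
    ((hX.aemeasurable_tradeSign _).mul (hX.aemeasurable_tradeSign _)).aestronglyMeasurable
  have h_indep : IndepFun (signRatio X t 1) (signRatio X t 3) μ :=
    (hX.indep t ht).indepFun (by norm_num)
  have h := h_indep.integral_fun_mul_eq_mul_integral (h_meas 0) (h_meas 2)
  simp only [signRatio] at h
  rw [h, hX.integral_tradeSign_mul hS, hX.integral_tradeSign_mul hS,
    abs_of_nonneg (sub_nonneg.2 (by exact_mod_cast hab)),
    abs_of_nonneg (sub_nonneg.2 (by exact_mod_cast hcd))]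

end IsTradeDirection

variable [IsProbabilityMeasure μ]

lemma charFun_map_of_ae_sign {U : Ω → ℝ} (hU : AEMeasurable U μ)
    (hU1 : ∀ᵐ ω ∂μ, U ω = 1 ∨ U ω = -1) (t : ℝ) :
    charFun (μ.map U) t = Complex.cos t + (∫ ω, U ω ∂μ : ℝ) * (Complex.sin t * Complex.I) := by
  have h_int : Integrable U μ := Integrable.of_bound hU.aestronglyMeasurable 1 (by
    filter_upwards [hU1] with ω h
    rcases h with h | h <;> rw [h] <;> norm_num)
  have h_exp : ∀ᵐ ω ∂μ, Complex.exp (t * U ω * Complex.I) =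
      Complex.cos t + (U ω : ℂ) * (Complex.sin t * Complex.I) := by
    filter_upwards [hU1] with ω h
    rw [Complex.exp_mul_I]
    rcases h with h | h <;> rw [h] <;> simp
  rw [charFun_apply_real, integral_map hU (by fun_prop), integral_congr_ae h_exp,
    integral_add (integrable_const _) (h_int.ofReal.mul_const _), integral_mul_const,
    integral_complex_ofReal]
  simp

lemma map_eq_map_of_ae_sign {U V : Ω → ℝ} (hU : AEMeasurable U μ) (hV : AEMeasurable V μ)
    (hU1 : ∀ᵐ ω ∂μ, U ω = 1 ∨ U ω = -1) (hV1 : ∀ᵐ ω ∂μ, V ω = 1 ∨ V ω = -1)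
    (h : ∫ ω, U ω ∂μ = ∫ ω, V ω ∂μ) : μ.map U = μ.map V := by
  have := Measure.isProbabilityMeasure_map hU
  have := Measure.isProbabilityMeasure_map hV
  refine Measure.ext_of_charFun (funext fun t => ?_)
  rw [charFun_map_of_ae_sign hU hU1, charFun_map_of_ae_sign hV hV1, h]

end TradeSign

section ProductLaws

lemma map_prodMk_infinitePi {α β : Type*} [MeasurableSpace α] [MeasurableSpace β]
    (υ : Measure α) (γ : Measure β) [IsProbabilityMeasure υ] [IsProbabilityMeasure γ] :
    ((Measure.infinitePi fun _ : ℕ => υ).prod (Measure.infinitePi fun _ : ℕ => γ)).map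
      (fun p j => (p.1 j, p.2 j)) = Measure.infinitePi fun _ : ℕ => υ.prod γ := by
  refine IsProjectiveLimit.unique (P := fun I : Finset ℕ => Measure.pi fun _ : I => υ.prod γ) ?_
    (Measure.isProjectiveLimit_infinitePi _)
  intro I
  have h_restrict : (Finset.restrict I ∘ fun (p : (ℕ → α) × (ℕ → β)) (j : ℕ) => (p.1 j, p.2 j)) =
      (MeasurableEquiv.arrowProdEquivProdArrow α β I).symm ∘
        Prod.map (Finset.restrict I) (Finset.restrict I) := by
    ext p j <;> rfl
  rw [Measure.map_map (Finset.measurable_restrict I) (by fun_prop), h_restrict,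
    ← Measure.map_map (by fun_prop) (by fun_prop),
    ← Measure.map_prod_map _ _ (Finset.measurable_restrict I) (Finset.measurable_restrict I),
    Measure.infinitePi_map_restrict, Measure.infinitePi_map_restrict]
  exact (measurePreserving_arrowProdEquivProdArrow α β I (fun _ => υ) (fun _ => γ)).symm.map_eq

lemma infinitePi_gaussianReal_map_sign_mul (v : ℝ≥0) {y : ℕ → ℝ} (hy : ∀ j, y j = 1 ∨ y j = -1) :
    (Measure.infinitePi fun _ : ℕ => gaussianReal 0 v).map (fun z j => y j * z j) =
      Measure.infinitePi fun _ : ℕ => gaussianReal 0 v := by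
  rw [Measure.infinitePi_map_pi (fun _ : ℕ => gaussianReal 0 v) (f := fun j z => y j * z)
    (fun j => by fun_prop)]
  congr 1
  ext1 j
  rw [gaussianReal_map_const_mul]
  congr 1
  · simp
  · ext
    rcases hy j with h | h <;> simp [h]

variable {Ω : Type*} [MeasurableSpace Ω] {μ : Measure Ω} [IsProbabilityMeasure μ]

lemma hasLaw_prodMk_of_indepFun {α α' β β' : Type*} [MeasurableSpace α] [MeasurableSpace α']
    [MeasurableSpace β] [MeasurableSpace β'] {Y : Ω → α} {Z : Ω → β} {u : α → α'}
    {g : α → β → β'} {υ : Measure α'} {κ : Measure β} {κ' : Measure β'} [SFinite κ]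
    (hYZ : IndepFun Y Z μ) (hY : AEMeasurable Y μ) (hu : Measurable u)
    (hg : Measurable (Function.uncurry g)) (huY : HasLaw (fun ω => u (Y ω)) υ μ)
    (hZ : HasLaw Z κ μ) (hκ : ∀ᵐ y ∂(μ.map Y), κ.map (g y) = κ') :
    HasLaw (fun ω => (u (Y ω), g (Y ω) (Z ω))) (υ.prod κ') μ := by
  have : IsProbabilityMeasure (μ.map Y) := Measure.isProbabilityMeasure_map hY
  have h_u : MeasurePreserving u (μ.map Y) υ :=
    ⟨hu, by rw [AEMeasurable.map_map_of_aemeasurable hu.aemeasurable hY, ← huY.map_eq]; rfl⟩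
  have h_pair : HasLaw (fun ω => (Y ω, Z ω)) ((μ.map Y).prod κ) μ :=
    ⟨hY.prodMk hZ.aemeasurable,
      by rw [hYZ.map_prod_eq_prod_map_map hY hZ.aemeasurable, hZ.map_eq]⟩
  exact (h_u.skew_product hg hκ).hasLaw.comp h_pair

end ProductLaws

section Driver

variable {Ω : Type*} [MeasurableSpace Ω] {μ : Measure Ω} {P X : ℝ≥0 → Ω → ℝ} {σ S lam : ℝ}
  {τ : ℝ≥0}

/-- The increment of the efficient price over the `j`-th sampling interval. -/
def priceIncr (P : ℝ≥0 → Ω → ℝ) (τ : ℝ≥0) (j : ℕ) (ω : Ω) : ℝ :=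
  P (((j + 1 : ℕ) : ℝ≥0) * τ) ω - P ((j : ℝ≥0) * τ) ω

/-- The trade sign at the `j`-th sampling time. -/
def gridSign (X : ℝ≥0 → Ω → ℝ) (τ : ℝ≥0) (j : ℕ) (ω : Ω) : ℝ := tradeSign X ((j : ℝ≥0) * τ) ω

/-- The sequence driving the sampled squared increments: sign changes together with efficient
increments multiplied by the current trade sign. -/
def driver (P X : ℝ≥0 → Ω → ℝ) (τ : ℝ≥0) (ω : Ω) (j : ℕ) : ℝ × ℝ :=
  (gridSign X τ j ω * gridSign X τ (j + 1) ω, gridSign X τ j ω * priceIncr P τ j ω)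

/-- The law of a single term of the driving sequence. -/
noncomputable def driverLaw (μ : Measure Ω) (X : ℝ≥0 → Ω → ℝ) (σ : ℝ) (τ : ℝ≥0) :
    Measure (ℝ × ℝ) :=
  (μ.map fun ω => gridSign X τ 0 ω * gridSign X τ 1 ω).prod
    (gaussianReal 0 (.mk (σ ^ 2) (sq_nonneg _) * τ))

lemma monotone_grid (τ : ℝ≥0) : Monotone fun j : ℕ => (j : ℝ≥0) * τ :=
  Nat.mono_cast.mul_const τ.2

namespace IsBrownianWithVolatility

omit [MeasurableSpace Ω] in
lemma sub_eq (hσ : σ ≠ 0) (s t : ℝ≥0) (ω : Ω) :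
    P t ω - P s ω = σ * ((P t ω - P 0 ω) / σ - (P s ω - P 0 ω) / σ) := by
  field_simp
  ring

variable (hP : IsBrownianWithVolatility P σ μ) (hσ : σ ≠ 0)
include hP hσ

lemma hasLaw_sub {s t : ℝ≥0} (hst : s ≤ t) :
    HasLaw (fun ω => P t ω - P s ω) (gaussianReal 0 (.mk (σ ^ 2) (sq_nonneg _) * (t - s))) μ := by
  have h := gaussianReal_const_mul (hP.brownian.toIsPreBrownianReal.hasLaw_sub t s) σ
  have h_dist : nndist t.1 s.1 = t - s := by
    ext
    rw [coe_nndist, NNReal.coe_sub hst, Real.dist_eq]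
    exact abs_of_nonneg (sub_nonneg.2 (by exact_mod_cast hst))
  rw [h_dist, mul_zero] at h
  exact h.congr (ae_of_all _ fun ω => by simpa using sub_eq hσ s t ω)

lemma iIndepFun_sub {t : ℕ → ℝ≥0} (ht : Monotone t) :
    iIndepFun (fun i ω => P (t (i + 1)) ω - P (t i) ω) μ := by
  convert (hP.brownian.toIsPreBrownianReal.hasIndepIncrements.nat ht).comp
    (fun _ x => σ * x) (fun _ => by fun_prop) using 2 with i
  ext ω
  exact sub_eq hσ _ _ ω

lemma hasLaw_priceIncr : HasLaw (fun ω j => priceIncr P τ j ω)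
    (Measure.infinitePi fun _ : ℕ => gaussianReal 0 (.mk (σ ^ 2) (sq_nonneg _) * τ)) μ := by
  have h_law (j : ℕ) :
      HasLaw (priceIncr P τ j) (gaussianReal 0 (.mk (σ ^ 2) (sq_nonneg _) * τ)) μ := by
    have h := hP.hasLaw_sub hσ (monotone_grid τ (Nat.le_succ j))
    have h_step : ((j + 1 : ℕ) : ℝ≥0) * τ - (j : ℝ≥0) * τ = τ := by
      rw [Nat.cast_succ, add_mul, one_mul, add_tsub_cancel_left]
    simp only [h_step] at h
    exact h
  exact (hP.iIndepFun_sub hσ (monotone_grid τ)).hasLaw_infinitePi h_law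
    (aemeasurable_pi_iff.2 fun j => (h_law j).aemeasurable)

end IsBrownianWithVolatility

namespace IsTradeDirection

variable (hX : IsTradeDirection X S lam μ)
include hX

lemma aemeasurable_gridSign (j : ℕ) : AEMeasurable (gridSign X τ j) μ := hX.aemeasurable_tradeSign _

lemma aemeasurable_signChange (j : ℕ) :
    AEMeasurable (fun ω => gridSign X τ j ω * gridSign X τ (j + 1) ω) μ :=
  (hX.aemeasurable_gridSign j).mul (hX.aemeasurable_gridSign (j + 1))

lemma ae_signChange (j : ℕ) : ∀ᵐ ω ∂μ, gridSign X τ j ω * gridSign X τ (j + 1) ω = 1 ∨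
    gridSign X τ j ω * gridSign X τ (j + 1) ω = -1 := by
  filter_upwards [hX.ae_tradeSign ((j : ℝ≥0) * τ),
    hX.ae_tradeSign (((j + 1 : ℕ) : ℝ≥0) * τ)] with ω h h'
  unfold gridSign
  rcases h with h | h <;> rcases h' with h' | h' <;> rw [h, h'] <;> norm_num

lemma ae_map_gridSign :
    ∀ᵐ y ∂(μ.map fun ω j => gridSign X τ j ω), ∀ j, y j = 1 ∨ y j = -1 := by
  refine ae_all_iff.2 fun j => ?_
  rw [ae_map_iff (aemeasurable_pi_iff.2 hX.aemeasurable_gridSign)]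
  · exact hX.ae_tradeSign _
  · exact ((measurableSet_singleton (1 : ℝ)).union (measurableSet_singleton (-1))).preimage
      (measurable_pi_apply j)

variable [IsProbabilityMeasure μ] (hS : S ≠ 0)
include hS

lemma integral_signChange (j : ℕ) :
    ∫ ω, gridSign X τ j ω * gridSign X τ (j + 1) ω ∂μ = Real.exp (-(τ : ℝ) / lam) := by
  unfold gridSign
  rw [hX.integral_tradeSign_mul hS]
  congr 2
  push_cast
  rw [show ((j : ℝ) + 1) * τ - j * τ = τ by ring, abs_of_nonneg (NNReal.coe_nonneg τ)]

lemma hasLaw_signChange : HasLaw (fun ω j => gridSign X τ j ω * gridSign X τ (j + 1) ω)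
    (Measure.infinitePi fun _ : ℕ => μ.map fun ω => gridSign X τ 0 ω * gridSign X τ 1 ω) μ := by
  have h_law (j : ℕ) : HasLaw (fun ω => gridSign X τ j ω * gridSign X τ (j + 1) ω)
      (μ.map fun ω => gridSign X τ 0 ω * gridSign X τ 1 ω) μ :=
    ⟨hX.aemeasurable_signChange j, map_eq_map_of_ae_sign (hX.aemeasurable_signChange j)
      (hX.aemeasurable_signChange 0) (hX.ae_signChange j) (hX.ae_signChange 0)
      (by rw [hX.integral_signChange hS j, ← hX.integral_signChange hS 0])⟩
  have h_indep : iIndepFun (fun j ω => gridSign X τ j ω * gridSign X τ (j + 1) ω) μ :=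
    iIndepFun.precomp (g := fun j : ℕ => j + 1) (add_left_injective 1)
      (hX.indep _ (monotone_grid τ))
  exact h_indep.hasLaw_infinitePi h_law (aemeasurable_pi_iff.2 hX.aemeasurable_signChange)

end IsTradeDirection

lemma indepFun_gridSign_priceIncr (hS : S ≠ 0)
    (hPX : IndepFun (fun ω t => P t ω) (fun ω t => noise S X t ω) μ) :
    IndepFun (fun ω j => gridSign X τ j ω) (fun ω j => priceIncr P τ j ω) μ := by
  have h := hPX.symm.comp (φ := fun (η : ℝ≥0 → ℝ) (j : ℕ) => 2 / S * η ((j : ℝ≥0) * τ))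
    (ψ := fun (p : ℝ≥0 → ℝ) (j : ℕ) => p (((j + 1 : ℕ) : ℝ≥0) * τ) - p ((j : ℝ≥0) * τ))
    (by fun_prop) (by fun_prop)
  convert h using 1
  · ext ω j
    simp only [gridSign, noise_eq_mul_tradeSign, Function.comp_apply]
    field_simp
  · rfl

-- Conditionally on the signs, multiplying the symmetric Gaussian increments by them preserves
-- their law: this makes the twisted increments independent of the sign changes.
theorem hasLaw_driver [IsProbabilityMeasure μ] (hσ : σ ≠ 0) (hS : S ≠ 0)
    (hP : IsBrownianWithVolatility P σ μ) (hX : IsTradeDirection X S lam μ)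
    (hPX : IndepFun (fun ω t => P t ω) (fun ω t => noise S X t ω) μ) :
    HasLaw (driver P X τ) (Measure.infinitePi fun _ : ℕ => driverLaw μ X σ τ) μ := by
  have : IsProbabilityMeasure (μ.map fun ω => gridSign X τ 0 ω * gridSign X τ 1 ω) :=
    Measure.isProbabilityMeasure_map (hX.aemeasurable_signChange 0)
  have h_pair := hasLaw_prodMk_of_indepFun (u := fun y j => y j * y (j + 1))
    (g := fun (y z : ℕ → ℝ) (j : ℕ) => y j * z j) (indepFun_gridSign_priceIncr (τ := τ) hS hPX)
    (aemeasurable_pi_iff.2 hX.aemeasurable_gridSign) (by fun_prop)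
    (by unfold Function.uncurry; fun_prop) (hX.hasLaw_signChange hS) (hP.hasLaw_priceIncr hσ)
    (hX.ae_map_gridSign.mono fun y hy => infinitePi_gaussianReal_map_sign_mul _ hy)
  have h_zip : HasLaw (fun (p : (ℕ → ℝ) × (ℕ → ℝ)) (j : ℕ) => (p.1 j, p.2 j))
      (Measure.infinitePi fun _ : ℕ => driverLaw μ X σ τ) _ :=
    ⟨by fun_prop, map_prodMk_infinitePi _ _⟩
  exact h_zip.comp h_pair

end Driver

section Moments

variable {Ω : Type*} [MeasurableSpace Ω] {μ : Measure Ω}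

/-- All moments of the random variable `X` are finite. -/
def HasAllMoments (X : Ω → ℝ) (μ : Measure Ω) : Prop :=
  ∀ q : ENNReal, q ≠ ⊤ → MemLp X q μ

namespace HasAllMoments

variable {X Z : Ω → ℝ}

lemma memLp_two (hX : HasAllMoments X μ) : MemLp X 2 μ := hX 2 (by simp)

lemma integrable (hX : HasAllMoments X μ) : Integrable X μ :=
  memLp_one_iff_integrable.1 (hX 1 (by simp))

lemma aestronglyMeasurable (hX : HasAllMoments X μ) : AEStronglyMeasurable X μ :=
  hX.integrable.aestronglyMeasurable

lemma add (hX : HasAllMoments X μ) (hZ : HasAllMoments Z μ) :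
    HasAllMoments (fun ω => X ω + Z ω) μ := fun q hq => (hX q hq).add (hZ q hq)

lemma sub (hX : HasAllMoments X μ) (hZ : HasAllMoments Z μ) :
    HasAllMoments (fun ω => X ω - Z ω) μ := fun q hq => (hX q hq).sub (hZ q hq)

lemma const_mul (hX : HasAllMoments X μ) (c : ℝ) : HasAllMoments (fun ω => c * X ω) μ :=
  fun q hq => (hX q hq).const_mul c

lemma mul (hX : HasAllMoments X μ) (hZ : HasAllMoments Z μ) :
    HasAllMoments (fun ω => X ω * Z ω) μ := fun q hq => by
  have : ENNReal.HolderTriple (2 * q) (2 * q) q := ⟨by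
    rw [ENNReal.mul_inv (by simp) (by simp), ← add_mul, ENNReal.inv_two_add_inv_two, one_mul]⟩
  exact (hZ (2 * q) (ENNReal.mul_ne_top (by simp) hq)).mul
    (hX (2 * q) (ENNReal.mul_ne_top (by simp) hq))

lemma pow [IsFiniteMeasure μ] (hX : HasAllMoments X μ) (n : ℕ) :
    HasAllMoments (fun ω => X ω ^ n) μ := by
  induction n with
  | zero => exact fun q _ => by simpa using memLp_const (1 : ℝ)
  | succ n ih => simpa only [pow_succ] using ih.mul hX

lemma of_hasLaw_gaussianReal {v : ℝ≥0} (h : HasLaw X (gaussianReal 0 v) μ) :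
    HasAllMoments X μ := fun q hq => by
  have h_id := memLp_id_gaussianReal' (μ := 0) (v := v) q hq
  rw [← h.map_eq, memLp_map_measure_iff (by fun_prop) h.aemeasurable] at h_id
  exact h_id

end HasAllMoments

section IndependentPairs

variable [IsProbabilityMeasure μ] {G G' H H' : Ω → ℝ} (hG : HasAllMoments G μ)
  (hG' : HasAllMoments G' μ) (hH : HasAllMoments H μ) (hH' : HasAllMoments H' μ)
  (hGH : IndepFun (fun ω => (G ω, G' ω)) (fun ω => (H ω, H' ω)) μ)
include hG hG' hH hH' hGH

lemma integral_add_pow_mul_add_pow (m n : ℕ) :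
    ∫ ω, (G ω + H ω) ^ m * (G' ω + H' ω) ^ n ∂μ =
      ∑ i ∈ Finset.range (m + 1), ∑ j ∈ Finset.range (n + 1), (m.choose i * n.choose j : ℝ) *
        ((∫ ω, G ω ^ i * G' ω ^ j ∂μ) * ∫ ω, H ω ^ (m - i) * H' ω ^ (n - j) ∂μ) := by
  have h_int (i j k l : ℕ) : Integrable (fun ω => (G ω ^ i * G' ω ^ j) * (H ω ^ k * H' ω ^ l)) μ :=
    (((hG.pow i).mul (hG'.pow j)).mul ((hH.pow k).mul (hH'.pow l))).integrable
  have h_mul (i j k l : ℕ) : ∫ ω, (G ω ^ i * G' ω ^ j) * (H ω ^ k * H' ω ^ l) ∂μ =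
      (∫ ω, G ω ^ i * G' ω ^ j ∂μ) * ∫ ω, H ω ^ k * H' ω ^ l ∂μ :=
    (hGH.comp (φ := fun p : ℝ × ℝ => p.1 ^ i * p.2 ^ j) (ψ := fun p : ℝ × ℝ => p.1 ^ k * p.2 ^ l)
      (by fun_prop) (by fun_prop)).integral_fun_mul_eq_mul_integral
      ((hG.pow i).mul (hG'.pow j)).aestronglyMeasurable
      ((hH.pow k).mul (hH'.pow l)).aestronglyMeasurable
  have h_expand (ω : Ω) : (G ω + H ω) ^ m * (G' ω + H' ω) ^ n =
      ∑ i ∈ Finset.range (m + 1), ∑ j ∈ Finset.range (n + 1), (m.choose i * n.choose j : ℝ) *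
        ((G ω ^ i * G' ω ^ j) * (H ω ^ (m - i) * H' ω ^ (n - j))) := by
    rw [add_pow, add_pow, Finset.sum_mul_sum]
    exact Finset.sum_congr rfl fun i _ => Finset.sum_congr rfl fun j _ => by ring
  simp_rw [h_expand]
  rw [integral_finsetSum _ fun i _ => integrable_finsetSum _ fun j _ => (h_int ..).const_mul _]
  refine Finset.sum_congr rfl fun i _ => ?_
  rw [integral_finsetSum _ fun j _ => (h_int ..).const_mul _]
  simp only [integral_const_mul, h_mul]

variable (hG0 : ∫ ω, G ω ∂μ = 0) (hH0 : ∫ ω, H ω ∂μ = 0)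
include hG0 hH0

omit [IsProbabilityMeasure μ] hG' hH' hGH in
lemma integral_add_sq_of_indepFun (hGH : IndepFun G H μ) :
    ∫ ω, (G ω + H ω) ^ 2 ∂μ = ∫ ω, G ω ^ 2 ∂μ + ∫ ω, H ω ^ 2 ∂μ := by
  have h_mean : ∫ ω, (G + H) ω ∂μ = 0 := by
    simp only [Pi.add_apply]
    rw [integral_add hG.integrable hH.integrable, hG0, hH0, add_zero]
  have h_var := hGH.variance_add hG.memLp_two hH.memLp_two
  rwa [variance_of_integral_eq_zero (X := G + H)
      (hG.add hH).aestronglyMeasurable.aemeasurable h_mean,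
    variance_of_integral_eq_zero hG.aestronglyMeasurable.aemeasurable hG0,
    variance_of_integral_eq_zero hH.aestronglyMeasurable.aemeasurable hH0] at h_var

lemma covariance_add_sq_add_sq (hG'0 : ∫ ω, G' ω ∂μ = 0) (hH'0 : ∫ ω, H' ω ∂μ = 0) :
    cov[fun ω => (G ω + H ω) ^ 2, fun ω => (G' ω + H' ω) ^ 2; μ] =
      cov[fun ω => G ω ^ 2, fun ω => G' ω ^ 2; μ] + 4 * (cov[G, G'; μ] * cov[H, H'; μ])
        + cov[fun ω => H ω ^ 2, fun ω => H' ω ^ 2; μ] := by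
  rw [covariance_eq_sub ((hG.add hH).pow 2).memLp_two ((hG'.add hH').pow 2).memLp_two,
    covariance_eq_sub (hG.pow 2).memLp_two (hG'.pow 2).memLp_two,
    covariance_eq_sub (hH.pow 2).memLp_two (hH'.pow 2).memLp_two,
    covariance_eq_sub hG.memLp_two hG'.memLp_two, covariance_eq_sub hH.memLp_two hH'.memLp_two,
    integral_add_sq_of_indepFun hG hH hG0 hH0 (hGH.comp measurable_fst measurable_fst),
    integral_add_sq_of_indepFun hG' hH' hG'0 hH'0 (hGH.comp measurable_snd measurable_snd)]
  simp only [Pi.mul_apply]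
  rw [integral_add_pow_mul_add_pow hG hG' hH hH' hGH]
  simp only [Nat.reduceAdd, Finset.sum_range_succ, Finset.range_one, Finset.sum_singleton,
    Nat.choose_zero_right, Nat.cast_one, mul_one, pow_zero, tsub_zero, Nat.choose_succ_self_right,
    Nat.cast_ofNat, pow_one, Nat.add_one_sub_one, Nat.choose_self, tsub_self, integral_const,
    probReal_univ, smul_eq_mul, one_mul, zero_mul, mul_zero, add_zero, zero_add,
    hG0, hH0, hG'0, hH'0]
  ring

omit hG' hH' hGH in
lemma variance_add_sq_of_indepFun (hGH : IndepFun G H μ) :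
    Var[fun ω => (G ω + H ω) ^ 2; μ] =
      Var[fun ω => G ω ^ 2; μ] + 4 * (Var[G; μ] * Var[H; μ]) + Var[fun ω => H ω ^ 2; μ] := by
  have h_cov := covariance_add_sq_add_sq hG hG hH hH (hGH.comp (φ := fun x => (x, x))
    (ψ := fun x => (x, x)) (by fun_prop) (by fun_prop)) hG0 hH0 hG0 hH0
  rwa [covariance_self ((hG.add hH).pow 2).aestronglyMeasurable.aemeasurable,
    covariance_self (hG.pow 2).aestronglyMeasurable.aemeasurable,
    covariance_self (hH.pow 2).aestronglyMeasurable.aemeasurable,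
    covariance_self hG.aestronglyMeasurable.aemeasurable,
    covariance_self hH.aestronglyMeasurable.aemeasurable] at h_cov

end IndependentPairs

section Gaussian

lemma integral_of_hasLaw_gaussianReal {X : Ω → ℝ} {v : ℝ≥0} (h : HasLaw X (gaussianReal 0 v) μ) :
    ∫ ω, X ω ∂μ = 0 := by
  rw [h.integral_eq, integral_id_gaussianReal]

lemma variance_of_hasLaw_gaussianReal {X : Ω → ℝ} {v : ℝ≥0} (h : HasLaw X (gaussianReal 0 v) μ) :
    Var[X; μ] = v := by
  rw [h.variance_eq, variance_id_gaussianReal]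

lemma variance_sq_of_hasLaw {X : Ω → ℝ} {κ : Measure ℝ} (h : HasLaw X κ μ) :
    Var[fun ω => X ω ^ 2; μ] = Var[fun x => x ^ 2; κ] := by
  rw [← h.map_eq, variance_map (by fun_prop) h.aemeasurable]
  rfl

-- For independent copies `X`, `Y`, the variance of `(X + Y) ^ 2` is computed in two ways: `X + Y`
-- has the law of `√2 X`, and it is also a sum of independent terms.
lemma variance_sq_gaussianReal (v : ℝ≥0) :
    Var[fun x => x ^ 2; gaussianReal 0 v] = 2 * (v : ℝ) ^ 2 := by
  set γ := gaussianReal 0 v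
  have h_fst : HasLaw (fun p : ℝ × ℝ => p.1) γ (γ.prod γ) := measurePreserving_fst.hasLaw
  have h_snd : HasLaw (fun p : ℝ × ℝ => p.2) γ (γ.prod γ) := measurePreserving_snd.hasLaw
  have h_indep : IndepFun (fun p : ℝ × ℝ => p.1) (fun p : ℝ × ℝ => p.2) (γ.prod γ) :=
    indepFun_prod (X := fun x : ℝ => x) (Y := fun x : ℝ => x) measurable_id measurable_id
  have h_add : HasLaw (fun p : ℝ × ℝ => p.1 + p.2) (gaussianReal 0 (v + v)) (γ.prod γ) := by
    have h := gaussianReal_add_gaussianReal_of_indepFun h_indep h_fst.map_eq h_snd.map_eq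
    rw [add_zero] at h
    exact ⟨by fun_prop, h⟩
  have h_scale : HasLaw (fun x : ℝ => √2 * x) (gaussianReal 0 (v + v)) γ := by
    have h := gaussianReal_const_mul (HasLaw.id (μ := γ)) (√2)
    rwa [mul_zero, show NNReal.mk (√2 ^ 2) (sq_nonneg _) * v = v + v by ext; simp [two_mul]] at h
  have h_four_mul : Var[fun p : ℝ × ℝ => (p.1 + p.2) ^ 2; γ.prod γ] =
      4 * Var[fun x => x ^ 2; γ] := by
    rw [variance_sq_of_hasLaw h_add, ← variance_sq_of_hasLaw h_scale]
    simp only [mul_pow, Real.sq_sqrt zero_le_two]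
    rw [variance_const_mul]
    norm_num
  have h_sum := variance_add_sq_of_indepFun (.of_hasLaw_gaussianReal h_fst)
    (.of_hasLaw_gaussianReal h_snd) (integral_of_hasLaw_gaussianReal h_fst)
    (integral_of_hasLaw_gaussianReal h_snd) h_indep
  rw [h_four_mul, variance_sq_of_hasLaw h_fst, variance_sq_of_hasLaw h_snd,
    variance_of_hasLaw_gaussianReal h_fst, variance_of_hasLaw_gaussianReal h_snd] at h_sum
  linear_combination h_sum / 2

lemma variance_sq_of_hasLaw_gaussianReal {X : Ω → ℝ} {v : ℝ≥0} (h : HasLaw X (gaussianReal 0 v) μ) :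
    Var[fun ω => X ω ^ 2; μ] = 2 * (v : ℝ) ^ 2 := by
  rw [variance_sq_of_hasLaw h, variance_sq_gaussianReal]

end Gaussian

end Moments

section SquaredIncrement

/-- The squared log-price increment of lag `L` from time `0` as a function of the driving
sequence. -/
noncomputable def sqIncr (S : ℝ) (L : ℕ) (x : ℕ → ℝ × ℝ) : ℝ :=
  (∑ m ∈ Finset.range L, (∏ l ∈ Finset.range m, (x l).1) * (x m).2
    + S / 2 * (∏ l ∈ Finset.range L, (x l).1 - 1)) ^ 2

lemma measurable_sqIncr (S : ℝ) (L : ℕ) : Measurable (sqIncr S L) := by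
  unfold sqIncr
  fun_prop

lemma dependsOn_sqIncr (S : ℝ) (L : ℕ) : DependsOn (sqIncr S L) (Set.Iio L) := by
  intro x y h
  have h_prod {m : ℕ} (hm : m ≤ L) :
      ∏ l ∈ Finset.range m, (x l).1 = ∏ l ∈ Finset.range m, (y l).1 :=
    Finset.prod_congr rfl fun l hl => by rw [h l ((Finset.mem_range.1 hl).trans_le hm)]
  unfold sqIncr
  rw [h_prod le_rfl, Finset.sum_congr rfl fun m hm => by
    rw [h_prod (Finset.mem_range.1 hm).le, h m (Finset.mem_range.1 hm)]]

/-- The distance between the starting points of consecutive increments of lag `L`. -/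
def Scheme.step : Scheme → ℕ → ℕ
  | .overlapping, _ => 1
  | .nonOverlapping, L => L
  | .disjoint, L => L + 1

lemma Scheme.start_eq (v : Scheme) (L i : ℕ) : v.start L i = i * v.step L := by
  cases v <;> simp [Scheme.start, Scheme.step, mul_add, add_comm]

lemma Scheme.zeta_eq (v : Scheme) (L : ℕ) : v.zeta L = v.step L := by
  cases v <;> simp [Scheme.zeta, Scheme.step]

lemma Scheme.step_pos (v : Scheme) {L : ℕ} (hL : 1 ≤ L) : 0 < v.step L := by
  cases v
  exacts [Nat.one_pos, hL, L.succ_pos]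

lemma Scheme.zeta_pos (v : Scheme) {L : ℕ} (hL : 1 ≤ L) : 0 < v.zeta L := by
  rw [v.zeta_eq]
  exact_mod_cast v.step_pos hL

lemma Scheme.count_pos (v : Scheme) {n L : ℕ} (hL : 1 ≤ L) (hn : L < n) : 0 < v.count n L := by
  cases v <;> simp only [Scheme.count]
  · omega
  · exact Nat.div_pos (by omega) hL
  · exact Nat.div_pos hn (by omega)

lemma Scheme.abs_sub_step_mul_count_le (v : Scheme) {L : ℕ} (hL : 1 ≤ L) (n : ℕ) :
    |(n : ℝ) - v.step L * v.count n L| ≤ L + 1 := by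
  have h_bounds : v.step L * v.count n L ≤ n ∧ n ≤ v.step L * v.count n L + (L + 1) := by
    cases v <;> simp only [Scheme.step, Scheme.count]
    · omega
    · have h1 := Nat.div_add_mod (n - 1) L
      have h2 := Nat.mod_lt (n - 1) hL
      omega
    · have h1 := Nat.div_add_mod n (L + 1)
      have h2 := Nat.mod_lt n (show 0 < L + 1 by omega)
      omega
  obtain ⟨h_le, h_ge⟩ := h_bounds
  have h_le_real : (v.step L : ℝ) * v.count n L ≤ n := by exact_mod_cast h_le
  have h_ge_real : (n : ℝ) ≤ v.step L * v.count n L + (L + 1) := by exact_mod_cast h_ge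
  rw [abs_of_nonneg] <;> linarith

variable {Ω : Type*} {P X : ℝ≥0 → Ω → ℝ} {S : ℝ} {τ : ℝ≥0}

lemma logPrice_sub (s t : ℝ≥0) (ω : Ω) : logPrice S P X t ω - logPrice S P X s ω =
    (P t ω - P s ω) + S / 2 * (tradeSign X t ω - tradeSign X s ω) := by
  simp only [logPrice, noise_eq_mul_tradeSign]
  ring

section UnitSigns

variable {ω : Ω} (h : ∀ j, gridSign X τ j ω ^ 2 = 1)
include h

lemma prod_driver_fst (a m : ℕ) : ∏ l ∈ Finset.range m, (driver P X τ ω (a + l)).1 =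
    gridSign X τ a ω * gridSign X τ (a + m) ω := by
  induction m with
  | zero => simpa only [sq, Finset.range_zero, Finset.prod_empty, add_zero] using (h a).symm
  | succ m ih =>
    rw [Finset.prod_range_succ, ih]
    simp only [driver]
    linear_combination (gridSign X τ a ω * gridSign X τ (a + (m + 1)) ω) * h (a + m)

lemma sum_prod_driver_fst_mul_snd (a m : ℕ) :
    ∑ j ∈ Finset.range m,
      (∏ l ∈ Finset.range j, (driver P X τ ω (a + l)).1) * (driver P X τ ω (a + j)).2 =
        gridSign X τ a ω * (P (((a + m : ℕ) : ℝ≥0) * τ) ω - P ((a : ℝ≥0) * τ) ω) := by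
  induction m with
  | zero => simp
  | succ m ih =>
    rw [Finset.sum_range_succ, ih, prod_driver_fst h]
    simp only [driver, priceIncr, add_assoc]
    linear_combination (gridSign X τ a ω * (P (((a + (m + 1) : ℕ) : ℝ≥0) * τ) ω
      - P (((a + m : ℕ) : ℝ≥0) * τ) ω)) * h (a + m)

lemma sq_logPrice_sub_eq_sqIncr (a L : ℕ) :
    (logPrice S P X (((a + L : ℕ) : ℝ≥0) * τ) ω - logPrice S P X ((a : ℝ≥0) * τ) ω) ^ 2 =
      sqIncr S L (shift a (driver P X τ ω)) := by
  simp only [sqIncr, shift_apply]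
  rw [prod_driver_fst h, sum_prod_driver_fst_mul_snd h, logPrice_sub]
  have h_sq := h a
  simp only [gridSign] at h_sq ⊢
  set y := tradeSign X ((a : ℝ≥0) * τ) ω
  set u := tradeSign X (((a + L : ℕ) : ℝ≥0) * τ) ω
  set d := P (((a + L : ℕ) : ℝ≥0) * τ) ω - P ((a : ℝ≥0) * τ) ω
  have h_factor : y * d + S / 2 * (y * u - 1) = y * (d + S / 2 * (u - y)) := by
    linear_combination (S / 2) * h_sq
  rw [h_factor, mul_pow, h_sq, one_mul]

end UnitSigns

end SquaredIncrement

section BrownianIncrements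

variable {Ω : Type*} [MeasurableSpace Ω] {μ : Measure Ω} {P : ℝ≥0 → Ω → ℝ} {σ : ℝ}

namespace IsBrownianWithVolatility

variable (hP : IsBrownianWithVolatility P σ μ) (hσ : σ ≠ 0) {s t u w : ℝ≥0}
include hP hσ

lemma hasAllMoments_sub (hst : s ≤ t) : HasAllMoments (fun ω => P t ω - P s ω) μ :=
  .of_hasLaw_gaussianReal (hP.hasLaw_sub hσ hst)

lemma integral_sub_eq_zero (hst : s ≤ t) : ∫ ω, (P t ω - P s ω) ∂μ = 0 :=
  integral_of_hasLaw_gaussianReal (hP.hasLaw_sub hσ hst)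

lemma variance_sub (hst : s ≤ t) : Var[fun ω => P t ω - P s ω; μ] = σ ^ 2 * (t - s) := by
  rw [variance_of_hasLaw_gaussianReal (hP.hasLaw_sub hσ hst), NNReal.coe_mul, NNReal.coe_sub hst]
  rfl

lemma variance_sub_sq (hst : s ≤ t) :
    Var[fun ω => (P t ω - P s ω) ^ 2; μ] = 2 * (σ ^ 2 * (t - s)) ^ 2 := by
  rw [variance_sq_of_hasLaw_gaussianReal (hP.hasLaw_sub hσ hst),
    ← variance_of_hasLaw_gaussianReal (hP.hasLaw_sub hσ hst), hP.variance_sub hσ hst]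

lemma integral_sub_sq (hst : s ≤ t) : ∫ ω, (P t ω - P s ω) ^ 2 ∂μ = σ ^ 2 * (t - s) := by
  rw [← hP.variance_sub hσ hst, variance_of_integral_eq_zero
    (hP.hasAllMoments_sub hσ hst).aestronglyMeasurable.aemeasurable
    (hP.integral_sub_eq_zero hσ hst)]

lemma indepFun_sub_sub (hst : s ≤ t) (htu : t ≤ u) (huw : u ≤ w) :
    IndepFun (fun ω => P t ω - P s ω) (fun ω => P w ω - P u ω) μ := by
  obtain ⟨r, hr, rfl, rfl, rfl, rfl⟩ := exists_monotone_seq hst htu huw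
  exact (hP.iIndepFun_sub hσ hr).indepFun (show 0 ≠ 2 by norm_num)

lemma indepFun_sub_prodMk (hst : s ≤ t) (htu : t ≤ u) (huw : u ≤ w) :
    IndepFun (fun ω => P u ω - P t ω) (fun ω => (P t ω - P s ω, P w ω - P u ω)) μ := by
  obtain ⟨r, hr, rfl, rfl, rfl, rfl⟩ := exists_monotone_seq hst htu huw
  exact ((hP.iIndepFun_sub hσ hr).indepFun_prodMk₀
    (fun i => (hP.hasLaw_sub hσ (hr i.le_succ)).aemeasurable) 0 2 1 (by norm_num)
    (by norm_num)).symm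

variable [IsProbabilityMeasure μ]

lemma covariance_sub_sub (hst : s ≤ t) (htu : t ≤ u) (huw : u ≤ w) :
    cov[fun ω => P u ω - P s ω, fun ω => P w ω - P t ω; μ] = σ ^ 2 * (u - t) := by
  have h_left := (hP.hasAllMoments_sub hσ hst).memLp_two
  have h_mid := (hP.hasAllMoments_sub hσ htu).memLp_two
  have h_right := (hP.hasAllMoments_sub hσ huw).memLp_two
  have h_split (a b c : ℝ≥0) : (fun ω => P c ω - P a ω) =
      (fun ω => P c ω - P b ω) + fun ω => P b ω - P a ω := by
    ext ω
    simp only [Pi.add_apply]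
    ring
  rw [h_split s t u, h_split t u w, covariance_add_left h_mid h_left (h_right.add h_mid),
    covariance_add_right h_mid h_right h_mid, covariance_add_right h_left h_right h_mid,
    covariance_self h_mid.1.aemeasurable, hP.variance_sub hσ htu,
    (hP.indepFun_sub_sub hσ htu le_rfl huw).covariance_eq_zero h_mid h_right,
    (hP.indepFun_sub_sub hσ hst le_rfl htu).covariance_eq_zero h_left h_mid,
    (hP.indepFun_sub_sub hσ hst htu huw).covariance_eq_zero h_left h_right, zero_add, zero_add,
    add_zero]

lemma covariance_sub_sq_sub_sq (hst : s ≤ t) (htu : t ≤ u) (huw : u ≤ w) :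
    cov[fun ω => (P u ω - P s ω) ^ 2, fun ω => (P w ω - P t ω) ^ 2; μ] =
      2 * (σ ^ 2 * (u - t)) ^ 2 := by
  have h_left := hP.hasAllMoments_sub hσ hst
  have h_mid := hP.hasAllMoments_sub hσ htu
  have h_right := hP.hasAllMoments_sub hσ huw
  have h_indep := hP.indepFun_sub_sub hσ hst htu huw
  have h_indep_sq : IndepFun (fun ω => (P t ω - P s ω) ^ 2) (fun ω => (P w ω - P u ω) ^ 2) μ :=
    h_indep.comp (φ := fun x => x ^ 2) (ψ := fun x => x ^ 2) (by fun_prop) (by fun_prop)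
  have h := covariance_add_sq_add_sq h_mid h_mid h_left h_right
    ((hP.indepFun_sub_prodMk hσ hst htu huw).comp (φ := fun x => (x, x)) (by fun_prop)
      measurable_id)
    (hP.integral_sub_eq_zero hσ htu) (hP.integral_sub_eq_zero hσ hst)
    (hP.integral_sub_eq_zero hσ htu) (hP.integral_sub_eq_zero hσ huw)
  rw [h_indep.covariance_eq_zero h_left.memLp_two h_right.memLp_two,
    h_indep_sq.covariance_eq_zero (h_left.pow 2).memLp_two (h_right.pow 2).memLp_two,
    covariance_self (h_mid.pow 2).aestronglyMeasurable.aemeasurable, hP.variance_sub_sq hσ htu,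
    mul_zero, mul_zero, add_zero, add_zero] at h
  simpa only [sub_add_sub_cancel, sub_add_sub_cancel'] using h

end IsBrownianWithVolatility

end BrownianIncrements

section IncrementMoments

variable {Ω : Type*} [MeasurableSpace Ω] {μ : Measure Ω} {P X : ℝ≥0 → Ω → ℝ} {σ S lam : ℝ}
  {τ : ℝ≥0}

lemma covariance_congr_ae {U U' V V' : Ω → ℝ} (hU : U =ᵐ[μ] U') (hV : V =ᵐ[μ] V') :
    cov[U, V; μ] = cov[U', V'; μ] := by
  rw [covariance, covariance, integral_congr_ae hU, integral_congr_ae hV]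
  refine integral_congr_ae ?_
  filter_upwards [hU, hV] with ω hU hV
  rw [hU, hV]

namespace IsTradeDirection

variable (hX : IsTradeDirection X S lam μ)
include hX

lemma ae_gridSign_sq (j : ℕ) : ∀ᵐ ω ∂μ, gridSign X τ j ω ^ 2 = 1 := hX.ae_tradeSign_sq _

lemma gridSign_sub_sq_ae_eq (i j : ℕ) : (fun ω => (gridSign X τ j ω - gridSign X τ i ω) ^ 2) =ᵐ[μ]
    fun ω => 2 - 2 * (gridSign X τ i ω * gridSign X τ j ω) := by
  filter_upwards [hX.ae_gridSign_sq (τ := τ) i, hX.ae_gridSign_sq (τ := τ) j] with ω hi hj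
  linear_combination hi + hj

variable [IsProbabilityMeasure μ]

lemma hasAllMoments_gridSign (j : ℕ) : HasAllMoments (gridSign X τ j) μ :=
  fun q _ => hX.memLp_tradeSign _ q

lemma integral_gridSign_sub (i j : ℕ) : ∫ ω, (gridSign X τ j ω - gridSign X τ i ω) ∂μ = 0 := by
  rw [integral_sub (hX.hasAllMoments_gridSign j).integrable
    (hX.hasAllMoments_gridSign i).integrable]
  simp only [gridSign]
  rw [hX.integral_tradeSign, hX.integral_tradeSign, sub_zero]

variable (hS : S ≠ 0)
include hS

lemma integral_gridSign_mul {i j : ℕ} (hij : i ≤ j) :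
    ∫ ω, gridSign X τ i ω * gridSign X τ j ω ∂μ = Real.exp (-τ / lam) ^ (j - i) := by
  have hij_real : (i : ℝ) ≤ j := by exact_mod_cast hij
  simp only [gridSign]
  rw [hX.integral_tradeSign_mul hS, ← Real.exp_nat_mul]
  congr 1
  push_cast [Nat.cast_sub hij]
  rw [← sub_mul, abs_of_nonneg (mul_nonneg (sub_nonneg.2 hij_real) (NNReal.coe_nonneg τ))]
  ring

lemma integral_gridSign_mul_mul {a b c d : ℕ} (hab : a ≤ b) (hbc : b ≤ c) (hcd : c ≤ d) :
    ∫ ω, (gridSign X τ a ω * gridSign X τ b ω) * (gridSign X τ c ω * gridSign X τ d ω) ∂μ =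
      Real.exp (-τ / lam) ^ (b - a) * Real.exp (-τ / lam) ^ (d - c) := by
  simp only [gridSign]
  rw [hX.integral_tradeSign_mul_mul hS (monotone_grid τ hab) (monotone_grid τ hbc)
    (monotone_grid τ hcd), ← Real.exp_nat_mul, ← Real.exp_nat_mul]
  push_cast [Nat.cast_sub hab, Nat.cast_sub hcd]
  congr 2 <;> ring

lemma integral_gridSign_sub_sq {i j : ℕ} (hij : i ≤ j) :
    ∫ ω, (gridSign X τ j ω - gridSign X τ i ω) ^ 2 ∂μ =
      2 - 2 * Real.exp (-τ / lam) ^ (j - i) := by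
  have h_int : Integrable (fun ω => gridSign X τ i ω * gridSign X τ j ω) μ :=
    ((hX.hasAllMoments_gridSign i).mul (hX.hasAllMoments_gridSign j)).integrable
  rw [integral_congr_ae (hX.gridSign_sub_sq_ae_eq i j),
    integral_sub (integrable_const _) (h_int.const_mul 2), integral_const_mul,
    hX.integral_gridSign_mul hS hij, integral_const, probReal_univ, one_smul]

lemma covariance_gridSign {i j : ℕ} (hij : i ≤ j) :
    cov[gridSign X τ i, gridSign X τ j; μ] = Real.exp (-τ / lam) ^ (j - i) := by
  have h_mean : ∫ ω, gridSign X τ i ω ∂μ = 0 := hX.integral_tradeSign _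
  rw [covariance_eq_sub (hX.hasAllMoments_gridSign i).memLp_two
    (hX.hasAllMoments_gridSign j).memLp_two, h_mean, zero_mul, sub_zero]
  exact hX.integral_gridSign_mul hS hij

lemma covariance_gridSign_sub {k L : ℕ} (hkL : k ≤ L) :
    cov[fun ω => gridSign X τ L ω - gridSign X τ 0 ω,
      fun ω => gridSign X τ (k + L) ω - gridSign X τ k ω; μ] =
      2 * Real.exp (-τ / lam) ^ k - Real.exp (-τ / lam) ^ (L - k)
        - Real.exp (-τ / lam) ^ (L + k) := by
  have h_mem (j : ℕ) := (hX.hasAllMoments_gridSign (τ := τ) j).memLp_two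
  rw [covariance_fun_sub_fun_sub (h_mem L) (h_mem 0) (h_mem (k + L)) (h_mem k),
    hX.covariance_gridSign hS (by lia), covariance_comm (gridSign X τ L),
    hX.covariance_gridSign hS hkL, hX.covariance_gridSign hS (by lia),
    hX.covariance_gridSign hS (by lia), Nat.add_sub_cancel, Nat.sub_zero, Nat.sub_zero, add_comm k]
  ring

lemma covariance_gridSign_mul {k L : ℕ} (hkL : k ≤ L) :
    cov[fun ω => gridSign X τ 0 ω * gridSign X τ L ω,
      fun ω => gridSign X τ k ω * gridSign X τ (k + L) ω; μ] =
      Real.exp (-τ / lam) ^ (2 * k) - Real.exp (-τ / lam) ^ (2 * L) := by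
  have h_mem (i j : ℕ) := ((hX.hasAllMoments_gridSign (τ := τ) i).mul
    (hX.hasAllMoments_gridSign (τ := τ) j)).memLp_two
  have h_swap (ω : Ω) : gridSign X τ 0 ω * gridSign X τ L ω *
      (gridSign X τ k ω * gridSign X τ (k + L) ω) =
      gridSign X τ 0 ω * gridSign X τ k ω * (gridSign X τ L ω * gridSign X τ (k + L) ω) :=
    mul_mul_mul_comm ..
  rw [covariance_eq_sub (h_mem 0 L) (h_mem k (k + L))]
  simp only [Pi.mul_apply, h_swap]
  rw [hX.integral_gridSign_mul_mul hS (Nat.zero_le k) hkL (by lia),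
    hX.integral_gridSign_mul hS (Nat.zero_le L), hX.integral_gridSign_mul hS (by lia),
    Nat.add_sub_cancel, Nat.add_sub_cancel_left, Nat.sub_zero, Nat.sub_zero]
  ring

lemma covariance_gridSign_sub_sq {k L : ℕ} (hkL : k ≤ L) :
    cov[fun ω => (gridSign X τ L ω - gridSign X τ 0 ω) ^ 2,
      fun ω => (gridSign X τ (k + L) ω - gridSign X τ k ω) ^ 2; μ] =
      4 * (Real.exp (-τ / lam) ^ (2 * k) - Real.exp (-τ / lam) ^ (2 * L)) := by
  have h_int (i j : ℕ) : Integrable (fun ω => 2 * (gridSign X τ i ω * gridSign X τ j ω)) μ :=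
    (((hX.hasAllMoments_gridSign i).mul (hX.hasAllMoments_gridSign j)).const_mul 2).integrable
  rw [covariance_congr_ae (hX.gridSign_sub_sq_ae_eq 0 L) (hX.gridSign_sub_sq_ae_eq k (k + L)),
    covariance_const_sub_left (h_int 0 L), covariance_const_sub_right (h_int k (k + L)),
    covariance_const_mul_left, covariance_const_mul_right, hX.covariance_gridSign_mul hS hkL]
  ring

end IsTradeDirection

lemma indepFun_priceSub_gridSign
    (hPX : IndepFun (fun ω t => P t ω) (fun ω t => noise S X t ω) μ) (a b c d : ℕ) :
    IndepFun (fun ω => (P ((b : ℝ≥0) * τ) ω - P ((a : ℝ≥0) * τ) ω,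
        P ((d : ℝ≥0) * τ) ω - P ((c : ℝ≥0) * τ) ω))
      (fun ω => (S / 2 * (gridSign X τ b ω - gridSign X τ a ω),
        S / 2 * (gridSign X τ d ω - gridSign X τ c ω))) μ := by
  have h := hPX.comp
    (φ := fun f : ℝ≥0 → ℝ => (f (b * τ) - f (a * τ), f (d * τ) - f (c * τ)))
    (ψ := fun η : ℝ≥0 → ℝ => (η (b * τ) - η (a * τ), η (d * τ) - η (c * τ)))
    (by fun_prop) (by fun_prop)
  simp only [noise_eq_mul_tradeSign] at h
  simp only [gridSign, mul_sub]
  exact h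

/-- The autocovariance at distance `k` of the squared log-price increments of lag `L ≥ k`. -/
noncomputable def sqAutocov (σ S lam τ : ℝ) (L k : ℕ) : ℝ :=
  2 * (σ ^ 2 * τ * (L - k : ℕ)) ^ 2
    + S ^ 2 * (σ ^ 2 * τ * (L - k : ℕ)) * (2 * Real.exp (-τ / lam) ^ k
      - Real.exp (-τ / lam) ^ (L - k) - Real.exp (-τ / lam) ^ (L + k))
    + S ^ 4 / 4 * (Real.exp (-τ / lam) ^ (2 * k) - Real.exp (-τ / lam) ^ (2 * L))

lemma exp_neg_nat_mul_div (lam τ : ℝ) (L : ℕ) :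
    Real.exp (-(L * τ) / lam) = Real.exp (-τ / lam) ^ L := by
  rw [← Real.exp_nat_mul]
  ring_nf

lemma priceVar_eq (σ S lam τ : ℝ) (L : ℕ) : priceVar σ S lam τ L =
    L * τ * σ ^ 2 + S ^ 2 / 2 * (1 - Real.exp (-τ / lam) ^ L) := by
  rw [priceVar, exp_neg_nat_mul_div]

variable [IsProbabilityMeasure μ] (hσ : σ ≠ 0) (hS : S ≠ 0) (hP : IsBrownianWithVolatility P σ μ)
  (hX : IsTradeDirection X S lam μ)
  (hPX : IndepFun (fun ω t => P t ω) (fun ω t => noise S X t ω) μ)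
include hσ hS hP hX hPX

lemma integral_sq_logPrice_sub (L : ℕ) :
    ∫ ω, (logPrice S P X ((L : ℝ≥0) * τ) ω - logPrice S P X (((0 : ℕ) : ℝ≥0) * τ) ω) ^ 2 ∂μ =
      priceVar σ S lam τ L := by
  have h_le := monotone_grid τ (Nat.zero_le L)
  have h_sign := (hX.hasAllMoments_gridSign (τ := τ) L).sub
    (hX.hasAllMoments_gridSign (τ := τ) 0)
  have h_sign_mean : ∫ ω, S / 2 * (gridSign X τ L ω - gridSign X τ 0 ω) ∂μ = 0 := by
    rw [integral_const_mul, hX.integral_gridSign_sub, mul_zero]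
  have h_add := integral_add_sq_of_indepFun (hP.hasAllMoments_sub hσ h_le)
    (h_sign.const_mul (S / 2)) (hP.integral_sub_eq_zero hσ h_le) h_sign_mean
    ((indepFun_priceSub_gridSign hPX 0 L 0 L).comp measurable_fst measurable_fst)
  simp only [logPrice_sub]
  refine h_add.trans ?_
  simp only [mul_pow]
  rw [hP.integral_sub_sq hσ h_le, integral_const_mul, hX.integral_gridSign_sub_sq hS L.zero_le,
    priceVar_eq]
  push_cast
  rw [Nat.sub_zero]
  ring

lemma covariance_sq_logPrice_sub {k L : ℕ} (hkL : k ≤ L) :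
    cov[fun ω => (logPrice S P X ((L : ℝ≥0) * τ) ω - logPrice S P X (((0 : ℕ) : ℝ≥0) * τ) ω) ^ 2,
      fun ω => (logPrice S P X (((k + L : ℕ) : ℝ≥0) * τ) ω
        - logPrice S P X ((k : ℝ≥0) * τ) ω) ^ 2; μ] = sqAutocov σ S lam τ L k := by
  have h_zero_k := monotone_grid τ (Nat.zero_le k)
  have h_k_L := monotone_grid τ hkL
  have h_L_kL := monotone_grid τ (Nat.le_add_left L k)
  have h_sign (i j : ℕ) := ((hX.hasAllMoments_gridSign (τ := τ) j).sub
    (hX.hasAllMoments_gridSign (τ := τ) i)).const_mul (S / 2)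
  have h_sign_mean (i j : ℕ) : ∫ ω, S / 2 * (gridSign X τ j ω - gridSign X τ i ω) ∂μ = 0 := by
    rw [integral_const_mul, hX.integral_gridSign_sub, mul_zero]
  have h_add := covariance_add_sq_add_sq (hP.hasAllMoments_sub hσ (h_zero_k.trans h_k_L))
    (hP.hasAllMoments_sub hσ (h_k_L.trans h_L_kL)) (h_sign 0 L) (h_sign k (k + L))
    (indepFun_priceSub_gridSign hPX 0 L k (k + L))
    (hP.integral_sub_eq_zero hσ (h_zero_k.trans h_k_L)) (h_sign_mean 0 L)
    (hP.integral_sub_eq_zero hσ (h_k_L.trans h_L_kL)) (h_sign_mean k (k + L))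
  simp only [logPrice_sub]
  refine h_add.trans ?_
  simp only [mul_pow]
  rw [hP.covariance_sub_sq_sub_sq hσ h_zero_k h_k_L h_L_kL,
    hP.covariance_sub_sub hσ h_zero_k h_k_L h_L_kL, covariance_const_mul_left,
    covariance_const_mul_right, covariance_const_mul_left, covariance_const_mul_right,
    hX.covariance_gridSign_sub hS hkL, hX.covariance_gridSign_sub_sq hS hkL, sqAutocov,
    Nat.cast_sub hkL]
  push_cast
  ring

end IncrementMoments

section ClosedForms

lemma one_sub_exp_ne_zero {x : ℝ} (hx : x ≠ 0) : 1 - Real.exp x ≠ 0 :=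
  sub_ne_zero.2 (Ne.symm (mt (Real.exp_eq_one_iff x).1 hx))

lemma geomSum_eq_sum {x : ℝ} (hx : x ≠ 0) (L : ℕ) :
    geomSum L x = ∑ m ∈ Finset.range L, Real.exp x ^ m - 1 := by
  have h_ne := one_sub_exp_ne_zero hx
  rw [geomSum, mul_comm x, Real.exp_nat_mul, geom_sum_eq (mt (Real.exp_eq_one_iff x).1 hx),
    eq_sub_iff_add_eq, div_add_one h_ne, ← neg_div_neg_eq]
  congr 1 <;> ring

lemma sum_range_mul_pow_mul_one_sub_sq {R : Type*} [CommRing R] (q : R) (L : ℕ) :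
    (∑ m ∈ Finset.range L, m * q ^ m) * (1 - q) ^ 2 =
      q - L * q ^ L + (L - 1) * q ^ (L + 1) := by
  induction L with
  | zero => simp
  | succ L ih =>
    rw [Finset.sum_range_succ, add_mul, ih]
    push_cast
    ring

lemma geomSumDeriv_eq_sum {x : ℝ} (hx : x ≠ 0) (L : ℕ) :
    geomSumDeriv L x = ∑ m ∈ Finset.range L, m * Real.exp x ^ m := by
  have h_exp (m : ℕ) : Real.exp (x * m) = Real.exp x ^ m := by rw [mul_comm, Real.exp_nat_mul]
  rw [eq_comm, geomSumDeriv, eq_div_iff (pow_ne_zero 2 (one_sub_exp_ne_zero hx)), h_exp,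
    ← Nat.cast_succ, h_exp, sum_range_mul_pow_mul_one_sub_sq]

lemma sum_range_sq_eq (L : ℕ) :
    ∑ m ∈ Finset.range L, (m : ℝ) ^ 2 = (L - 1) * L * (2 * L - 1) / 6 := by
  induction L with
  | zero => simp
  | succ L ih =>
    rw [Finset.sum_range_succ, ih]
    push_cast
    ring

variable {σ S lam τ : ℝ}

lemma sqAutocov_self (L : ℕ) : sqAutocov σ S lam τ L L = 0 := by
  simp [sqAutocov]

lemma exp_neg_two_mul_nat_mul_div (lam τ : ℝ) (L : ℕ) :
    Real.exp (-(2 * L * τ) / lam) = Real.exp (-τ / lam) ^ (2 * L) := by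
  simpa only [Nat.cast_mul, Nat.cast_ofNat] using exp_neg_nat_mul_div lam τ (2 * L)

lemma sqAutocov_zero (L : ℕ) : sqAutocov σ S lam τ L 0 = baseVar σ S lam τ L := by
  rw [sqAutocov, baseVar, exp_neg_two_mul_nat_mul_div, exp_neg_nat_mul_div]
  simp only [Nat.sub_zero, Nat.add_zero, mul_zero, pow_zero]
  ring

lemma sum_sqAutocov_succ_eq_sum_sqAutocov_sub (L : ℕ) :
    ∑ j ∈ Finset.range L, sqAutocov σ S lam τ L (j + 1) =
      ∑ m ∈ Finset.range L, sqAutocov σ S lam τ L (L - m) := by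
  rw [← Finset.sum_range_reflect]
  refine Finset.sum_congr rfl fun j hj => ?_
  rw [Finset.mem_range] at hj
  congr 1
  lia

lemma sqAutocov_sub {L m : ℕ} (hm : m ≤ L) :
    sqAutocov σ S lam τ L (L - m) = 2 * (σ ^ 2 * τ) ^ 2 * (m : ℝ) ^ 2 +
      S ^ 2 * (σ ^ 2 * τ) * (m * (2 * Real.exp (-τ / lam) ^ (L - m) - Real.exp (-τ / lam) ^ m
        - Real.exp (-τ / lam) ^ (2 * L - m))) +
      S ^ 4 / 4 * (Real.exp (-τ / lam) ^ (2 * (L - m)) - Real.exp (-τ / lam) ^ (2 * L)) := by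
  rw [sqAutocov, Nat.sub_sub_self hm, show L + (L - m) = 2 * L - m by lia]
  ring

lemma exp_neg_div_pow_sub (lam τ : ℝ) {m a : ℕ} (hma : m ≤ a) :
    Real.exp (-τ / lam) ^ (a - m) = Real.exp (-τ / lam) ^ a * Real.exp (τ / lam) ^ m := by
  have h_inv : Real.exp (-τ / lam) = (Real.exp (τ / lam))⁻¹ := by rw [neg_div, Real.exp_neg]
  rw [pow_sub₀ _ (Real.exp_ne_zero _) hma, h_inv, inv_pow _ m, inv_inv]

lemma sqAutocov_sub_eq_geometric {L m : ℕ} (hm : m ≤ L) :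
    sqAutocov σ S lam τ L (L - m) = 2 * (σ ^ 2 * τ) ^ 2 * (m : ℝ) ^ 2 +
      S ^ 2 * (σ ^ 2 * τ) * (2 * Real.exp (-τ / lam) ^ L * (m * Real.exp (τ / lam) ^ m)
        - m * Real.exp (-τ / lam) ^ m
        - Real.exp (-τ / lam) ^ (2 * L) * (m * Real.exp (τ / lam) ^ m)) +
      S ^ 4 / 4 * (Real.exp (-τ / lam) ^ (2 * L) * Real.exp (2 * τ / lam) ^ m
        - Real.exp (-τ / lam) ^ (2 * L)) := by
  have h_exp : Real.exp (2 * τ / lam) = Real.exp (τ / lam) ^ 2 := by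
    rw [← Real.exp_nat_mul, Nat.cast_ofNat, mul_div_assoc]
  rw [sqAutocov_sub hm, Nat.mul_sub, exp_neg_div_pow_sub lam τ hm,
    exp_neg_div_pow_sub lam τ (show m ≤ 2 * L by lia),
    exp_neg_div_pow_sub lam τ (show 2 * m ≤ 2 * L by lia), h_exp]
  ring

lemma sqAutocov_zero_add_two_mul_sum (hlam : lam ≠ 0) (hτ : τ ≠ 0) (L : ℕ) :
    sqAutocov σ S lam τ L 0 + 2 * ∑ j ∈ Finset.range L, sqAutocov σ S lam τ L (j + 1) =
      sigmaSq σ S lam τ .overlapping L := by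
  have h_sum : ∑ m ∈ Finset.range L, sqAutocov σ S lam τ L (L - m) = _ :=
    Finset.sum_congr rfl fun m hm => sqAutocov_sub_eq_geometric (Finset.mem_range.1 hm).le
  rw [sqAutocov_zero, sum_sqAutocov_succ_eq_sum_sqAutocov_sub, h_sum, sigmaSq,
    geomSum_eq_sum (div_ne_zero (mul_ne_zero two_ne_zero hτ) hlam),
    geomSumDeriv_eq_sum (div_ne_zero hτ hlam),
    geomSumDeriv_eq_sum (div_ne_zero (neg_ne_zero.2 hτ) hlam),
    exp_neg_two_mul_nat_mul_div, exp_neg_nat_mul_div]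
  simp only [Finset.sum_add_distrib, Finset.sum_sub_distrib, ← Finset.mul_sum, sum_range_sq_eq,
    Finset.sum_const, Finset.card_range, nsmul_eq_mul]
  ring

lemma sqAutocov_zero_add_two_mul_sum_step (hlam : lam ≠ 0) (hτ : τ ≠ 0) (v : Scheme) (L : ℕ) :
    sqAutocov σ S lam τ L 0 + 2 * ∑ j ∈ Finset.range L,
      (if (j + 1) * v.step L ≤ L then sqAutocov σ S lam τ L ((j + 1) * v.step L) else 0) =
      sigmaSq σ S lam τ v L := by
  cases v with
  | overlapping =>
    rw [← sqAutocov_zero_add_two_mul_sum hlam hτ]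
    congr 2
    refine Finset.sum_congr rfl fun j hj => ?_
    simp only [Scheme.step, mul_one]
    exact if_pos (Finset.mem_range.1 hj)
  | nonOverlapping =>
    rw [Finset.sum_eq_zero, mul_zero, add_zero, sqAutocov_zero]
    · rfl
    · intro j _
      split_ifs with h_le
      · rw [h_le.antisymm (Nat.le_mul_of_pos_left L j.succ_pos), sqAutocov_self]
      · rfl
  | disjoint =>
    rw [Finset.sum_eq_zero, mul_zero, add_zero, sqAutocov_zero]
    · rfl
    · intro j _
      exact if_neg (not_le.2 (L.lt_succ_self.trans_le (Nat.le_mul_of_pos_left _ j.succ_pos)))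

-- The sum equals its own reflection, so it is half of a sum of products of two factors which
-- change sign together.
lemma sum_mul_sub_pow_nonneg {ρ : ℝ} (h0 : 0 ≤ ρ) (h1 : ρ ≤ 1) (L : ℕ) :
    0 ≤ ∑ m ∈ Finset.range (L + 1), (m : ℝ) * (ρ ^ (L - m) - ρ ^ m) := by
  have h_reflect : ∑ m ∈ Finset.range (L + 1), (m : ℝ) * (ρ ^ (L - m) - ρ ^ m) =
      ∑ m ∈ Finset.range (L + 1), ((L : ℝ) - m) * (ρ ^ m - ρ ^ (L - m)) := by
    rw [← Finset.sum_range_reflect]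
    refine Finset.sum_congr rfl fun m hm => ?_
    have hm' : m ≤ L := Nat.lt_succ_iff.1 (Finset.mem_range.1 hm)
    rw [show L + 1 - 1 - m = L - m by lia, Nat.sub_sub_self hm', Nat.cast_sub hm']
  have h_nonneg : 0 ≤ ∑ m ∈ Finset.range (L + 1), ((L : ℝ) - 2 * m) * (ρ ^ m - ρ ^ (L - m)) := by
    refine Finset.sum_nonneg fun m _ => ?_
    rcases le_total (2 * m) L with hmL | hLm
    · have h_factor : (2 * m : ℝ) ≤ L := by exact_mod_cast hmL
      exact mul_nonneg (by linarith) (sub_nonneg.2 (pow_le_pow_of_le_one h0 h1 (by lia)))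
    · have h_factor : (L : ℝ) ≤ 2 * m := by exact_mod_cast hLm
      exact mul_nonneg_of_nonpos_of_nonpos (by linarith)
        (sub_nonpos.2 (pow_le_pow_of_le_one h0 h1 (by lia)))
  have h_split : ∑ m ∈ Finset.range (L + 1), ((L : ℝ) - 2 * m) * (ρ ^ m - ρ ^ (L - m)) =
      ∑ m ∈ Finset.range (L + 1), ((L : ℝ) - m) * (ρ ^ m - ρ ^ (L - m)) +
      ∑ m ∈ Finset.range (L + 1), (m : ℝ) * (ρ ^ (L - m) - ρ ^ m) := by
    rw [← Finset.sum_add_distrib]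
    exact Finset.sum_congr rfl fun m _ => by ring
  linarith

section Positivity

variable (hlam : 0 < lam) (hτ : 0 < τ)
include hlam hτ

lemma exp_neg_div_le_one : Real.exp (-τ / lam) ≤ 1 :=
  Real.exp_le_one_iff.2 (div_nonpos_of_nonpos_of_nonneg (neg_nonpos.2 hτ.le) hlam.le)

lemma le_baseVar (L : ℕ) : 2 * (σ ^ 2 * τ * L) ^ 2 +
    2 * (S ^ 2 * (σ ^ 2 * τ)) * (L * (1 - Real.exp (-τ / lam) ^ L)) ≤ baseVar σ S lam τ L := by
  have h_nonneg : 0 ≤ S ^ 4 / 4 * (1 - Real.exp (-τ / lam) ^ (2 * L)) :=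
    mul_nonneg (by positivity)
      (sub_nonneg.2 (pow_le_one₀ (Real.exp_pos _).le (exp_neg_div_le_one hlam hτ)))
  rw [baseVar, exp_neg_two_mul_nat_mul_div, exp_neg_nat_mul_div]
  linarith

lemma baseVar_pos (hσ : σ ≠ 0) {L : ℕ} (hL : 1 ≤ L) : 0 < baseVar σ S lam τ L := by
  refine lt_of_lt_of_le ?_ (le_baseVar hlam hτ L)
  have : (0 : ℝ) < L := by exact_mod_cast hL
  have h_nonneg : 0 ≤ 1 - Real.exp (-τ / lam) ^ L :=
    sub_nonneg.2 (pow_le_one₀ (Real.exp_pos _).le (exp_neg_div_le_one hlam hτ))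
  positivity

lemma le_sqAutocov_sub {L m : ℕ} (hm : m ≤ L) :
    S ^ 2 * (σ ^ 2 * τ) * (m * (Real.exp (-τ / lam) ^ (L - m) - Real.exp (-τ / lam) ^ m)) ≤
      sqAutocov σ S lam τ L (L - m) := by
  rw [sqAutocov_sub hm]
  have h_pow {i j : ℕ} (hij : i ≤ j) : Real.exp (-τ / lam) ^ j ≤ Real.exp (-τ / lam) ^ i :=
    pow_le_pow_of_le_one (Real.exp_pos _).le (exp_neg_div_le_one hlam hτ) hij
  set ρ := Real.exp (-τ / lam)
  have h_quartic : 0 ≤ S ^ 4 / 4 * (ρ ^ (2 * (L - m)) - ρ ^ (2 * L)) :=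
    mul_nonneg (by positivity) (sub_nonneg.2 (h_pow (by lia)))
  have h_mixed : S ^ 2 * (σ ^ 2 * τ) * (m * (ρ ^ (L - m) - ρ ^ m)) ≤
      S ^ 2 * (σ ^ 2 * τ) * (m * (2 * ρ ^ (L - m) - ρ ^ m - ρ ^ (2 * L - m))) := by
    gcongr ?_ * (?_ * ?_)
    linarith [h_pow (show L - m ≤ 2 * L - m by lia)]
  have h_square : 0 ≤ 2 * (σ ^ 2 * τ) ^ 2 * (m : ℝ) ^ 2 := by positivity
  linarith

lemma sigmaSq_overlapping_pos (hσ : σ ≠ 0) {L : ℕ} (hL : 1 ≤ L) :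
    0 < sigmaSq σ S lam τ .overlapping L := by
  rw [← sqAutocov_zero_add_two_mul_sum hlam.ne' hτ.ne', sum_sqAutocov_succ_eq_sum_sqAutocov_sub,
    sqAutocov_zero]
  have h_sum := Finset.sum_le_sum fun m hm =>
    le_sqAutocov_sub (σ := σ) (S := S) hlam hτ (Finset.mem_range.1 hm).le (L := L)
  have h_nonneg :=
    sum_mul_sub_pow_nonneg (Real.exp_pos (-τ / lam)).le (exp_neg_div_le_one hlam hτ) L
  rw [Finset.sum_range_succ, Nat.sub_self, pow_zero] at h_nonneg
  have h_mixed := mul_nonneg (show 0 ≤ S ^ 2 * (σ ^ 2 * τ) by positivity) h_nonneg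
  rw [← Finset.mul_sum] at h_sum
  have : (0 : ℝ) < L := by exact_mod_cast hL
  have h_pos : 0 < 2 * (σ ^ 2 * τ * L) ^ 2 := by positivity
  linarith [le_baseVar (σ := σ) (S := S) hlam hτ L]

lemma sigmaSq_pos (hσ : σ ≠ 0) (v : Scheme) {L : ℕ} (hL : 1 ≤ L) :
    0 < sigmaSq σ S lam τ v L := by
  cases v
  exacts [sigmaSq_overlapping_pos hlam hτ hσ hL, baseVar_pos hlam hτ hσ hL,
    baseVar_pos hlam hτ hσ hL]

end Positivity

end ClosedForms

section Transfer

variable {Ω : Type*} [MeasurableSpace Ω] {μ : Measure Ω} {P X : ℝ≥0 → Ω → ℝ} {σ S lam : ℝ}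
  {τ : ℝ≥0}

namespace IsTradeDirection

variable (hX : IsTradeDirection X S lam μ)
include hX

lemma isProbabilityMeasure_driverLaw [IsProbabilityMeasure μ] :
    IsProbabilityMeasure (driverLaw μ X σ τ) := by
  have := Measure.isProbabilityMeasure_map (hX.aemeasurable_signChange (τ := τ) 0)
  exact Measure.prod.instIsProbabilityMeasure _ _

lemma ae_forall_gridSign_sq : ∀ᵐ ω ∂μ, ∀ j, gridSign X τ j ω ^ 2 = 1 :=
  ae_all_iff.2 hX.ae_gridSign_sq

lemma sqIncr_shift_driver_ae_eq (a L : ℕ) :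
    (fun ω => sqIncr S L (shift a (driver P X τ ω))) =ᵐ[μ] fun ω =>
      (logPrice S P X (((a + L : ℕ) : ℝ≥0) * τ) ω - logPrice S P X ((a : ℝ≥0) * τ) ω) ^ 2 := by
  filter_upwards [hX.ae_forall_gridSign_sq (τ := τ)] with ω hω
  exact (sq_logPrice_sub_eq_sqIncr hω a L).symm

lemma sqIncr_driver_ae_eq (L : ℕ) : (fun ω => sqIncr S L (driver P X τ ω)) =ᵐ[μ] fun ω =>
    (logPrice S P X ((L : ℝ≥0) * τ) ω - logPrice S P X (((0 : ℕ) : ℝ≥0) * τ) ω) ^ 2 := by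
  simpa only [shift_zero, zero_add] using hX.sqIncr_shift_driver_ae_eq (P := P) (τ := τ) 0 L

lemma empVar_ae_eq (v : Scheme) : ∀ᵐ ω ∂μ, ∀ n L : ℕ, empVar v (logPrice S P X) τ n L ω =
    movingAvg (sqIncr S L) (v.step L) (v.count n L) (driver P X τ ω) := by
  filter_upwards [hX.ae_forall_gridSign_sq (τ := τ)] with ω h n L
  simp only [empVar, movingAvg, shiftSum, sq_logPrice_sub_eq_sqIncr h, v.start_eq]

end IsTradeDirection

variable [IsProbabilityMeasure μ] (hσ : σ ≠ 0) (hS : S ≠ 0) (hP : IsBrownianWithVolatility P σ μ)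
  (hX : IsTradeDirection X S lam μ)
  (hPX : IndepFun (fun ω t => P t ω) (fun ω t => noise S X t ω) μ)

local notation "ν∞" => Measure.infinitePi (fun _ : ℕ => driverLaw μ X σ τ)

include hσ hS hP hX hPX

lemma memLp_sqIncr (L : ℕ) : MemLp (sqIncr S L) 2 ν∞ := by
  have h_driver := hasLaw_driver (τ := τ) hσ hS hP hX hPX
  have h_moments : HasAllMoments (fun ω => (logPrice S P X ((L : ℝ≥0) * τ) ω
      - logPrice S P X (((0 : ℕ) : ℝ≥0) * τ) ω) ^ 2) μ := by
    simp only [logPrice_sub]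
    exact ((hP.hasAllMoments_sub hσ (monotone_grid τ L.zero_le)).add
      (((hX.hasAllMoments_gridSign (τ := τ) L).sub
        (hX.hasAllMoments_gridSign (τ := τ) 0)).const_mul (S / 2))).pow 2
  rw [← h_driver.map_eq, memLp_map_measure_iff (measurable_sqIncr S L).aestronglyMeasurable
    h_driver.aemeasurable]
  exact h_moments.memLp_two.ae_eq (hX.sqIncr_driver_ae_eq L).symm

lemma integral_sqIncr (L : ℕ) : ∫ x, sqIncr S L x ∂ν∞ = priceVar σ S lam τ L := by
  rw [← integral_sq_logPrice_sub hσ hS hP hX hPX L,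
    ← (hasLaw_driver (τ := τ) hσ hS hP hX hPX).integral_comp
      (measurable_sqIncr S L).aestronglyMeasurable]
  exact integral_congr_ae (hX.sqIncr_driver_ae_eq L)

lemma covariance_sqIncr_comp_shift {k L : ℕ} (hkL : k ≤ L) :
    cov[sqIncr S L, fun x => sqIncr S L (shift k x); ν∞] = sqAutocov σ S lam τ L k := by
  have h_driver := hasLaw_driver (τ := τ) hσ hS hP hX hPX
  have h_meas := measurable_sqIncr S L
  have h_meas_shift : Measurable fun x => sqIncr S L (shift k x) := h_meas.comp (measurable_shift k)
  rw [← covariance_sq_logPrice_sub hσ hS hP hX hPX hkL, ← h_driver.map_eq,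
    covariance_map_fun h_meas.aestronglyMeasurable h_meas_shift.aestronglyMeasurable
      h_driver.aemeasurable]
  exact covariance_congr_ae (hX.sqIncr_driver_ae_eq L) (hX.sqIncr_shift_driver_ae_eq k L)

lemma covariance_sqIncr_comp_shift_of_le {k L : ℕ} (hLk : L ≤ k) :
    cov[sqIncr S L, fun x => sqIncr S L (shift k x); ν∞] = 0 := by
  have := hX.isProbabilityMeasure_driverLaw (σ := σ) (τ := τ)
  have h_meas := measurable_sqIncr S L
  have h_dep := (dependsOn_sqIncr S L).mono (Set.Iio_subset_Iio hLk)
  have h_mem := memLp_sqIncr (τ := τ) hσ hS hP hX hPX L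
  exact (indepFun_comp_shift _ h_meas h_meas h_dep h_dep).covariance_eq_zero h_mem
    (memLp_comp_shift _ h_mem k)

lemma variance_sqIncr (L : ℕ) : Var[sqIncr S L; ν∞] = sqAutocov σ S lam τ L 0 := by
  rw [← covariance_sqIncr_comp_shift hσ hS hP hX hPX L.zero_le,
    ← covariance_self (measurable_sqIncr S L).aemeasurable]
  simp only [shift_zero]

lemma tendsto_integral_sq_movingAvg_sqIncr (hlam : lam ≠ 0) (hτ : τ ≠ 0) (v : Scheme) {L : ℕ}
    (hL : 1 ≤ L) :
    Tendsto (fun n : ℕ => ∫ x, (√(n : ℝ) * (movingAvg (sqIncr S L) (v.step L) (v.count n L) x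
        - ∫ y, sqIncr S L y ∂ν∞)) ^ 2 ∂ν∞) atTop (𝓝 (v.zeta L * sigmaSq σ S lam τ v L)) := by
  have := hX.isProbabilityMeasure_driverLaw (σ := σ) (τ := τ)
  have h_cov (j : ℕ) : cov[sqIncr S L, fun x => sqIncr S L (shift j x); ν∞] =
      if j ≤ L then sqAutocov σ S lam τ L j else 0 := by
    split_ifs with hj
    · exact covariance_sqIncr_comp_shift hσ hS hP hX hPX hj
    · exact covariance_sqIncr_comp_shift_of_le hσ hS hP hX hPX (not_le.1 hj).le
  have h_lim := tendsto_integral_sq_movingAvg (driverLaw μ X σ τ) (measurable_sqIncr S L)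
    (memLp_sqIncr hσ hS hP hX hPX L) (v.step_pos hL) (dependsOn_sqIncr S L)
    (v.abs_sub_step_mul_count_le hL)
  simp only [h_cov, variance_sqIncr hσ hS hP hX hPX] at h_lim
  rwa [v.zeta_eq, ← sqAutocov_zero_add_two_mul_sum_step hlam (NNReal.coe_ne_zero.2 hτ)]

end Transfer

lemma tendstoInDistribution_comp_hasLaw {Ω Ω' E : Type*} [MeasurableSpace Ω]
    [MeasurableSpace Ω'] [MeasurableSpace E] {μ : Measure Ω} {μ' : Measure Ω'} {ν : Measure E}
    [IsProbabilityMeasure μ] [IsProbabilityMeasure μ'] [IsProbabilityMeasure ν] {Z : Ω' → ℝ}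
    {T : ℕ → E → ℝ} (h : TendstoInDistribution T atTop Z (fun _ => ν) μ') {d : Ω → E}
    (hd : HasLaw d ν μ) :
    TendstoInDistribution (fun n ω => T n (d ω)) atTop Z (fun _ => μ) μ' := by
  have hT (n : ℕ) : AEMeasurable (T n) (μ.map d) := hd.map_eq ▸ h.forall_aemeasurable n
  refine ⟨fun n => (hT n).comp_aemeasurable hd.aemeasurable, h.aemeasurable_limit,
    h.tendsto.congr fun n => Subtype.ext ?_⟩
  change ν.map (T n) = μ.map (T n ∘ d)
  rw [← AEMeasurable.map_map_of_aemeasurable (hT n) hd.aemeasurable, hd.map_eq]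

section Asymptotics

variable {Ω : Type*} [MeasurableSpace Ω] {μ : Measure Ω} [IsProbabilityMeasure μ]
  {P X : ℝ≥0 → Ω → ℝ} {σ S lam : ℝ} {τ : ℝ≥0}

/-- The deviation of the empirical variance `V̂_v(n, L)` from `V(Lτ)`, scaled by `√n`. -/
noncomputable def scaledDev (σ S lam : ℝ) (τ : ℝ≥0) (P X : ℝ≥0 → Ω → ℝ) (v : Scheme) (n L : ℕ)
    (ω : Ω) : ℝ :=
  √(n : ℝ) * (empVar v (logPrice S P X) τ n L ω - priceVar σ S lam τ L)

variable (hσ : σ ≠ 0) (hS : S ≠ 0) (hP : IsBrownianWithVolatility P σ μ)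
  (hX : IsTradeDirection X S lam μ)
  (hPX : IndepFun (fun ω t => P t ω) (fun ω t => noise S X t ω) μ) (v : Scheme)

local notation "ν∞" => Measure.infinitePi (fun _ : ℕ => driverLaw μ X σ τ)

include hσ hS hP hX hPX

lemma scaledDev_ae_eq : ∀ᵐ ω ∂μ, ∀ n L : ℕ, scaledDev σ S lam τ P X v n L ω =
    √(n : ℝ) * (movingAvg (sqIncr S L) (v.step L) (v.count n L) (driver P X τ ω)
      - ∫ x, sqIncr S L x ∂ν∞) := by
  filter_upwards [hX.empVar_ae_eq (P := P) (τ := τ) v] with ω hω n L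
  rw [scaledDev, hω, integral_sqIncr hσ hS hP hX hPX]

lemma memLp_empVar (n L : ℕ) : MemLp (empVar v (logPrice S P X) τ n L) 2 μ := by
  have := hX.isProbabilityMeasure_driverLaw (σ := σ) (τ := τ)
  have h_driver := hasLaw_driver (τ := τ) hσ hS hP hX hPX
  have h_avg := memLp_movingAvg (driverLaw μ X σ τ) (memLp_sqIncr hσ hS hP hX hPX L)
    (v.step L) (v.count n L)
  rw [← h_driver.map_eq] at h_avg
  refine (h_avg.comp_of_map h_driver.aemeasurable).ae_eq ?_
  filter_upwards [hX.empVar_ae_eq (P := P) (τ := τ) v] with ω hω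
  exact (hω n L).symm

lemma memLp_scaledDev (n L : ℕ) : MemLp (scaledDev σ S lam τ P X v n L) 2 μ :=
  ((memLp_empVar hσ hS hP hX hPX v n L).sub (memLp_const _)).const_mul _

lemma integral_empVar {n L : ℕ} (hL : 1 ≤ L) (hn : L < n) :
    ∫ ω, empVar v (logPrice S P X) τ n L ω ∂μ = priceVar σ S lam τ L := by
  have := hX.isProbabilityMeasure_driverLaw (σ := σ) (τ := τ)
  have h_driver := hasLaw_driver (τ := τ) hσ hS hP hX hPX
  have h_mem := memLp_sqIncr (τ := τ) hσ hS hP hX hPX L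
  rw [← integral_sqIncr (τ := τ) hσ hS hP hX hPX L,
    ← integral_movingAvg _ (measurable_sqIncr S L) (h_mem.integrable one_le_two) (v.step L)
      (v.count_pos hL hn),
    ← h_driver.integral_comp (memLp_movingAvg _ h_mem _ _).aestronglyMeasurable]
  refine integral_congr_ae ?_
  filter_upwards [hX.empVar_ae_eq (P := P) (τ := τ) v] with ω hω
  exact hω n L

lemma exists_limit_sum_scaledDev {ι : Type*} [Fintype ι] (c : ι → ℝ) {l : ι → ℕ}
    (hl : ∀ i, 1 ≤ l i) : ∃ w : ℝ,
      Tendsto (fun n : ℕ => ∫ ω, (∑ i, c i * scaledDev σ S lam τ P X v n (l i) ω) ^ 2 ∂μ) atTop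
        (𝓝 w) ∧
      TendstoInDistribution (fun (n : ℕ) ω => ∑ i, c i * scaledDev σ S lam τ P X v n (l i) ω) atTop
        (id : ℝ → ℝ) (fun _ => μ) (gaussianReal 0 w.toNNReal) := by
  have := hX.isProbabilityMeasure_driverLaw (σ := σ) (τ := τ)
  have h_driver := hasLaw_driver (τ := τ) hσ hS hP hX hPX
  obtain ⟨w, h_var, h_law⟩ := exists_limit_movingAvg (driverLaw μ X σ τ) c
    (s := fun i => v.step (l i)) (k := fun i n => v.count n (l i)) (C := ∑ i, ((l i : ℝ) + 1))
    (fun i => measurable_sqIncr S (l i)) (fun i => memLp_sqIncr hσ hS hP hX hPX (l i))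
    (fun i => v.step_pos (hl i)) (fun i => dependsOn_sqIncr S (l i))
    (fun i n => (v.abs_sub_step_mul_count_le (hl i) n).trans
      (Finset.single_le_sum (f := fun i => (l i : ℝ) + 1) (fun _ _ => by positivity)
        (Finset.mem_univ i)))
  have h_ae : ∀ᵐ ω ∂μ, ∀ n : ℕ, √(n : ℝ) * ∑ i, c i * (movingAvg (sqIncr S (l i)) (v.step (l i))
      (v.count n (l i)) (driver P X τ ω) - ∫ x, sqIncr S (l i) x ∂ν∞) =
      ∑ i, c i * scaledDev σ S lam τ P X v n (l i) ω := by
    filter_upwards [scaledDev_ae_eq (τ := τ) hσ hS hP hX hPX v] with ω hω n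
    simp only [hω, Finset.mul_sum, mul_left_comm]
  refine ⟨w, h_var.congr fun n => ?_,
    (tendstoInDistribution_comp_hasLaw h_law h_driver).congr (fun n => ?_) (by rfl)⟩
  · rw [← h_driver.integral_comp
      ((h_law.forall_aemeasurable n).pow_const 2).aestronglyMeasurable]
    refine integral_congr_ae ?_
    filter_upwards [h_ae] with ω hω
    simp only [Function.comp_apply, hω]
  · filter_upwards [h_ae] with ω hω
    exact hω n

lemma tendsto_integral_sq_scaledDev (hlam : lam ≠ 0) (hτ : τ ≠ 0) {L : ℕ} (hL : 1 ≤ L) :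
    Tendsto (fun n : ℕ => ∫ ω, scaledDev σ S lam τ P X v n L ω ^ 2 ∂μ) atTop
      (𝓝 (v.zeta L * sigmaSq σ S lam τ v L)) := by
  have := hX.isProbabilityMeasure_driverLaw (σ := σ) (τ := τ)
  refine (tendsto_integral_sq_movingAvg_sqIncr (τ := τ) hσ hS hP hX hPX hlam hτ v hL).congr
    fun n => ?_
  have h_meas := (memLp_movingAvg (driverLaw μ X σ τ) (memLp_sqIncr hσ hS hP hX hPX L)
    (v.step L) (v.count n L)).aestronglyMeasurable
  rw [← (hasLaw_driver (τ := τ) hσ hS hP hX hPX).integral_comp (by fun_prop)]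
  refine integral_congr_ae ?_
  filter_upwards [scaledDev_ae_eq (τ := τ) hσ hS hP hX hPX v] with ω hω
  simp only [Function.comp_apply, hω]

lemma exists_limit_integral_scaledDev_mul {L L' : ℕ} (hL : 1 ≤ L) (hL' : 1 ≤ L') :
    ∃ g : ℝ, Tendsto (fun n : ℕ => ∫ ω, scaledDev σ S lam τ P X v n L ω *
      scaledDev σ S lam τ P X v n L' ω ∂μ) atTop (𝓝 g) := by
  have hl : ∀ i, 1 ≤ ![L, L'] i := Fin.forall_fin_two.2 ⟨hL, hL'⟩
  obtain ⟨w, h_add, -⟩ := exists_limit_sum_scaledDev (τ := τ) hσ hS hP hX hPX v ![1, 1] hl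
  obtain ⟨w', h_sub, -⟩ := exists_limit_sum_scaledDev (τ := τ) hσ hS hP hX hPX v ![1, -1] hl
  refine ⟨4⁻¹ * (w - w'), ((h_add.sub h_sub).const_mul 4⁻¹).congr fun n => ?_⟩
  simp only [Fin.sum_univ_two, Matrix.cons_val_zero, Matrix.cons_val_one, one_mul, neg_one_mul]
  have h_mem := memLp_scaledDev (τ := τ) hσ hS hP hX hPX v n
  have h_int_add : Integrable (fun ω => (scaledDev σ S lam τ P X v n L ω +
      scaledDev σ S lam τ P X v n L' ω) ^ 2) μ := ((h_mem L).add (h_mem L')).integrable_sq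
  have h_int_sub : Integrable (fun ω => (scaledDev σ S lam τ P X v n L ω +
      -scaledDev σ S lam τ P X v n L' ω) ^ 2) μ := ((h_mem L).add (h_mem L').neg).integrable_sq
  rw [← integral_sub h_int_add h_int_sub, ← integral_const_mul]
  congr 1 with ω
  ring

end Asymptotics

section LimitCorrelation

variable {Ω : Type*} [MeasurableSpace Ω] {μ : Measure Ω} [IsProbabilityMeasure μ]
  {P X : ℝ≥0 → Ω → ℝ} {σ S lam : ℝ} {τ : ℝ≥0}

lemma sqrt_zeta_mul_sqrt_sigmaSq_pos (hσ : σ ≠ 0) (hlam : 0 < lam) (hτ : 0 < τ) (v : Scheme)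
    {L : ℕ} (hL : 1 ≤ L) : 0 < √(v.zeta L) * √(sigmaSq σ S lam τ v L) :=
  mul_pos (Real.sqrt_pos.2 (v.zeta_pos hL)) (Real.sqrt_pos.2 (sigmaSq_pos hlam hτ hσ v hL))

variable (hσ : σ ≠ 0) (hS : S ≠ 0) (hP : IsBrownianWithVolatility P σ μ)
  (hX : IsTradeDirection X S lam μ)
  (hPX : IndepFun (fun ω t => P t ω) (fun ω t => noise S X t ω) μ) (v : Scheme)

include hσ hS hP hX hPX

lemma integral_scaledDev_mul {n L L' : ℕ} (hL : 1 ≤ L) (hL' : 1 ≤ L') (hn : L < n)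
    (hn' : L' < n) :
    ∫ ω, scaledDev σ S lam τ P X v n L ω * scaledDev σ S lam τ P X v n L' ω ∂μ =
      n * cov[empVar v (logPrice S P X) τ n L, empVar v (logPrice S P X) τ n L'; μ] := by
  rw [covariance, integral_empVar hσ hS hP hX hPX v hL hn,
    integral_empVar hσ hS hP hX hPX v hL' hn', ← integral_const_mul]
  congr 1 with ω
  simp only [scaledDev]
  rw [mul_mul_mul_comm, Real.mul_self_sqrt n.cast_nonneg]

lemma integral_sq_scaledDev {n L : ℕ} (hL : 1 ≤ L) (hn : L < n) :
    ∫ ω, scaledDev σ S lam τ P X v n L ω ^ 2 ∂μ =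
      n * Var[empVar v (logPrice S P X) τ n L; μ] := by
  rw [← covariance_self (memLp_empVar (τ := τ) hσ hS hP hX hPX v n L).aemeasurable,
    ← integral_scaledDev_mul hσ hS hP hX hPX v hL hL hn hn]
  simp only [sq]

lemma corr_empVar_eq {n L L' : ℕ} (hL : 1 ≤ L) (hL' : 1 ≤ L') (hn : L < n) (hn' : L' < n) :
    corr μ (empVar v (logPrice S P X) τ n L) (empVar v (logPrice S P X) τ n L') =
      (∫ ω, scaledDev σ S lam τ P X v n L ω * scaledDev σ S lam τ P X v n L' ω ∂μ) /
        (√(∫ ω, scaledDev σ S lam τ P X v n L ω ^ 2 ∂μ) *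
          √(∫ ω, scaledDev σ S lam τ P X v n L' ω ^ 2 ∂μ)) := by
  have hn0 : (0 : ℝ) < n := by exact_mod_cast (Nat.zero_le L).trans_lt hn
  rw [integral_scaledDev_mul hσ hS hP hX hPX v hL hL' hn hn',
    integral_sq_scaledDev hσ hS hP hX hPX v hL hn, integral_sq_scaledDev hσ hS hP hX hPX v hL' hn',
    Real.sqrt_mul hn0.le, Real.sqrt_mul hn0.le, mul_mul_mul_comm, Real.mul_self_sqrt hn0.le,
    mul_div_mul_left _ _ hn0.ne', corr]

variable (hlam : 0 < lam) (hτ : 0 < τ)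

include hlam hτ

lemma tendsto_corr_empVar_of_tendsto_integral {L L' : ℕ} (hL : 1 ≤ L) (hL' : 1 ≤ L') {g : ℝ}
    (hg : Tendsto (fun n : ℕ => ∫ ω, scaledDev σ S lam τ P X v n L ω *
      scaledDev σ S lam τ P X v n L' ω ∂μ) atTop (𝓝 g)) :
    Tendsto (fun n : ℕ => corr μ (empVar v (logPrice S P X) τ n L)
      (empVar v (logPrice S P X) τ n L')) atTop
      (𝓝 (g / ((√(v.zeta L) * √(sigmaSq σ S lam τ v L)) *
        (√(v.zeta L') * √(sigmaSq σ S lam τ v L'))))) := by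
  have h_sqrt {M : ℕ} (hM : 1 ≤ M) :
      Tendsto (fun n : ℕ => √(∫ ω, scaledDev σ S lam τ P X v n M ω ^ 2 ∂μ)) atTop
        (𝓝 (√(v.zeta M) * √(sigmaSq σ S lam τ v M))) := by
    rw [← Real.sqrt_mul (v.zeta_pos hM).le]
    exact (tendsto_integral_sq_scaledDev hσ hS hP hX hPX v hlam.ne' hτ.ne' hM).sqrt
  have h_ne := mul_pos (sqrt_zeta_mul_sqrt_sigmaSq_pos (S := S) hσ hlam hτ v hL)
    (sqrt_zeta_mul_sqrt_sigmaSq_pos (S := S) hσ hlam hτ v hL')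
  refine (hg.div ((h_sqrt hL).mul (h_sqrt hL')) h_ne.ne').congr' ?_
  filter_upwards [eventually_gt_atTop L, eventually_gt_atTop L'] with n hn hn'
  exact (corr_empVar_eq hσ hS hP hX hPX v hL hL' hn hn').symm

theorem tendsto_corr_empVar {L L' : ℕ} (hL : 1 ≤ L) (hL' : 1 ≤ L') :
    Tendsto (fun n : ℕ => corr μ (empVar v (logPrice S P X) τ n L)
      (empVar v (logPrice S P X) τ n L')) atTop (𝓝 (limCorr μ v (logPrice S P X) τ L L')) := by
  obtain ⟨g, hg⟩ := exists_limit_integral_scaledDev_mul hσ hS hP hX hPX v hL hL'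
  exact tendsto_nhds_limUnder
    ⟨_, tendsto_corr_empVar_of_tendsto_integral hσ hS hP hX hPX v hlam hτ hL hL' hg⟩

theorem tendsto_integral_scaledDev_mul {L L' : ℕ} (hL : 1 ≤ L) (hL' : 1 ≤ L') :
    Tendsto (fun n : ℕ => ∫ ω, scaledDev σ S lam τ P X v n L ω *
      scaledDev σ S lam τ P X v n L' ω ∂μ) atTop
      (𝓝 (asympCov σ S lam τ v L L' (limCorr μ v (logPrice S P X) τ L L'))) := by
  obtain ⟨g, hg⟩ := exists_limit_integral_scaledDev_mul hσ hS hP hX hPX v hL hL'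
  have h_limCorr := tendsto_nhds_unique
    (tendsto_corr_empVar hσ hS hP hX hPX v hlam hτ hL hL')
    (tendsto_corr_empVar_of_tendsto_integral hσ hS hP hX hPX v hlam hτ hL hL' hg)
  have h_pos := sqrt_zeta_mul_sqrt_sigmaSq_pos (S := S) hσ hlam hτ v hL
  have h_pos' := sqrt_zeta_mul_sqrt_sigmaSq_pos (S := S) hσ hlam hτ v hL'
  convert hg using 2
  rw [asympCov, h_limCorr, Real.sqrt_mul (v.zeta_pos hL).le, mul_right_comm (√(v.zeta L)),
    mul_assoc _ (√(v.zeta L')), mul_div_cancel₀ _ (mul_pos h_pos h_pos').ne']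

lemma asympCov_self {L : ℕ} (hL : 1 ≤ L) :
    asympCov σ S lam τ v L L (limCorr μ v (logPrice S P X) τ L L) =
      v.zeta L * sigmaSq σ S lam τ v L := by
  have h_lim := tendsto_integral_scaledDev_mul hσ hS hP hX hPX v hlam hτ hL hL
  simp only [← sq] at h_lim
  exact tendsto_nhds_unique h_lim
    (tendsto_integral_sq_scaledDev hσ hS hP hX hPX v hlam.ne' hτ.ne' hL)

lemma asympCov_comm {L L' : ℕ} (hL : 1 ≤ L) (hL' : 1 ≤ L') :
    asympCov σ S lam τ v L L' (limCorr μ v (logPrice S P X) τ L L') =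
      asympCov σ S lam τ v L' L (limCorr μ v (logPrice S P X) τ L' L) := by
  have h_lim := tendsto_integral_scaledDev_mul hσ hS hP hX hPX v hlam hτ hL hL'
  simp only [mul_comm (scaledDev σ S lam τ P X v _ L _)] at h_lim
  exact tendsto_nhds_unique h_lim (tendsto_integral_scaledDev_mul hσ hS hP hX hPX v hlam hτ hL' hL)

lemma tendsto_integral_sq_sum_scaledDev {ι : Type*} [Fintype ι] (c : ι → ℝ) {l : ι → ℕ}
    (hl : ∀ i, 1 ≤ l i) :
    Tendsto (fun n : ℕ => ∫ ω, (∑ i, c i * scaledDev σ S lam τ P X v n (l i) ω) ^ 2 ∂μ) atTop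
      (𝓝 (∑ i, ∑ j, c i * c j *
        asympCov σ S lam τ v (l i) (l j) (limCorr μ v (logPrice S P X) τ (l i) (l j)))) := by
  refine (tendsto_finsetSum _ fun i _ => tendsto_finsetSum _ fun j _ =>
    (tendsto_integral_scaledDev_mul hσ hS hP hX hPX v hlam hτ (hl i) (hl j)).const_mul
      (c i * c j)).congr fun n => ?_
  have h_mem := memLp_scaledDev (τ := τ) hσ hS hP hX hPX v n
  have h_int (i j : ι) : Integrable (fun ω => c i * c j *
      (scaledDev σ S lam τ P X v n (l i) ω * scaledDev σ S lam τ P X v n (l j) ω)) μ :=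
    ((h_mem (l i)).integrable_mul (h_mem (l j))).const_mul _
  simp only [sq, Finset.sum_mul_sum, mul_mul_mul_comm (c _), ← integral_const_mul]
  rw [integral_finsetSum _ fun i _ => integrable_finsetSum _ fun j _ => h_int i j]
  exact Finset.sum_congr rfl fun i _ => (integral_finsetSum _ fun j _ => h_int i j).symm

theorem tendstoInDistribution_sum_scaledDev {ι : Type*} [Fintype ι] (c : ι → ℝ) {l : ι → ℕ}
    (hl : ∀ i, 1 ≤ l i) {w : ℝ}
    (hw : w = ∑ i, ∑ j, c i * c j *
      asympCov σ S lam τ v (l i) (l j) (limCorr μ v (logPrice S P X) τ (l i) (l j))) :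
    0 ≤ w ∧ TendstoInDistribution
      (fun (n : ℕ) ω => ∑ i, c i * scaledDev σ S lam τ P X v n (l i) ω) atTop (id : ℝ → ℝ)
      (fun _ => μ) (gaussianReal 0 w.toNNReal) := by
  obtain ⟨w', h_var, h_law⟩ := exists_limit_sum_scaledDev (τ := τ) hσ hS hP hX hPX v c hl
  rw [hw, tendsto_nhds_unique
    (tendsto_integral_sq_sum_scaledDev hσ hS hP hX hPX v hlam hτ c hl) h_var]
  exact ⟨ge_of_tendsto' h_var fun n => integral_nonneg fun ω => sq_nonneg _, h_law⟩

end LimitCorrelation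

section DeltaMethod

variable {Ω : Type*} [MeasurableSpace Ω] {μ : Measure Ω}

lemma tendstoInMeasure_comp_continuousAt {ι E F : Type*} [PseudoEMetricSpace E]
    [PseudoEMetricSpace F] {l : Filter ι} {U : ι → Ω → E} {a : E}
    (hU : TendstoInMeasure μ U l (fun _ => a)) {g : E → F} (hg : ContinuousAt g a) :
    TendstoInMeasure μ (fun n ω => g (U n ω)) l (fun _ => g a) := by
  intro ε hε
  obtain ⟨δ, hδ, h_ball⟩ := Metric.nhds_basis_eball.eventually_iff.1
    (hg.eventually (Metric.eball_mem_nhds (g a) hε))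
  refine tendsto_of_tendsto_of_tendsto_of_le_of_le tendsto_const_nhds (hU δ hδ)
    (fun _ => zero_le) fun n => measure_mono fun ω hω => ?_
  rw [Set.mem_ofPred_eq] at hω ⊢
  by_contra! h_lt
  exact absurd hω (not_le.2 (h_ball (Metric.mem_eball.2 h_lt)))

variable [IsFiniteMeasure μ]

lemma measureReal_le_abs_mul_le {f g : Ω → ℝ} (hg : Integrable (fun ω => g ω ^ 2) μ) {M : ℝ}
    (hM : 0 < M) (ε : ℝ) :
    μ.real {ω | ε ≤ |f ω * g ω|} ≤
      μ.real {ω | ε / M ≤ |f ω|} + (∫ ω, g ω ^ 2 ∂μ) / M ^ 2 := by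
  have h_markov : μ.real {ω | M ^ 2 ≤ g ω ^ 2} ≤ (∫ ω, g ω ^ 2 ∂μ) / M ^ 2 := by
    rw [le_div_iff₀' (by positivity)]
    exact mul_meas_ge_le_integral_of_nonneg (.of_forall fun ω => sq_nonneg (g ω)) hg _
  have h_subset : {ω | ε ≤ |f ω * g ω|} ⊆ {ω | ε / M ≤ |f ω|} ∪ {ω | M ^ 2 ≤ g ω ^ 2} := by
    intro ω hω
    rw [Set.mem_ofPred_eq, abs_mul] at hω
    by_contra h_not
    simp only [Set.mem_union, Set.mem_ofPred_eq, not_or, not_le] at h_not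
    have h_abs : |g ω| < M := abs_lt_of_sq_lt_sq h_not.2 hM.le
    have h_lt := (lt_div_iff₀ hM).1 h_not.1
    exact absurd hω (not_le.2 ((mul_le_mul_of_nonneg_left h_abs.le (abs_nonneg _)).trans_lt h_lt))
  calc μ.real {ω | ε ≤ |f ω * g ω|}
      ≤ μ.real {ω | ε / M ≤ |f ω|} + μ.real {ω | M ^ 2 ≤ g ω ^ 2} :=
        (measureReal_mono h_subset).trans (measureReal_union_le _ _)
    _ ≤ μ.real {ω | ε / M ≤ |f ω|} + (∫ ω, g ω ^ 2 ∂μ) / M ^ 2 := by gcongr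

lemma tendstoInMeasure_mul_of_integral_sq_le {ι : Type*} {l : Filter ι} {f g : ι → Ω → ℝ}
    (hf : TendstoInMeasure μ f l (fun _ => 0)) (hg : ∀ n, Integrable (fun ω => g n ω ^ 2) μ)
    {K : ℝ} (hK : ∀ n, ∫ ω, g n ω ^ 2 ∂μ ≤ K) :
    TendstoInMeasure μ (fun n ω => f n ω * g n ω) l (fun _ => 0) := by
  rw [tendstoInMeasure_iff_measureReal_norm] at hf ⊢
  simp only [sub_zero, Real.norm_eq_abs] at hf ⊢
  intro ε hε
  rw [Metric.tendsto_nhds]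
  intro η hη
  have h_inv_sq : Tendsto (fun M : ℝ => K / M ^ 2) atTop (𝓝 0) :=
    tendsto_const_nhds.div_atTop (tendsto_pow_atTop two_ne_zero)
  obtain ⟨M, hM, h_tail⟩ := ((eventually_gt_atTop 0).and
    (h_inv_sq.eventually_lt_const (half_pos hη))).exists
  filter_upwards [(hf (ε / M) (div_pos hε hM)).eventually_lt_const (half_pos hη)] with n hn
  rw [Real.dist_0_eq_abs, abs_of_nonneg measureReal_nonneg]
  calc μ.real {ω | ε ≤ |f n ω * g n ω|}
      ≤ μ.real {ω | ε / M ≤ |f n ω|} + (∫ ω, g n ω ^ 2 ∂μ) / M ^ 2 :=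
        measureReal_le_abs_mul_le (hg n) hM ε
    _ ≤ μ.real {ω | ε / M ≤ |f n ω|} + K / M ^ 2 := by gcongr; exact hK n
    _ < η := by linarith

variable {E : Type*} [NormedAddCommGroup E] {U : ℕ → Ω → E} {a : E} {K : ℝ}

lemma tendstoInMeasure_of_integral_norm_sq_le
    (hU : ∀ n : ℕ, Integrable (fun ω => (√(n : ℝ) * ‖U n ω - a‖) ^ 2) μ)
    (hK : ∀ n : ℕ, ∫ ω, (√(n : ℝ) * ‖U n ω - a‖) ^ 2 ∂μ ≤ K) :
    TendstoInMeasure μ U atTop (fun _ => a) := by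
  have h_inv_sqrt : TendstoInMeasure μ (fun (n : ℕ) (_ : Ω) => (√(n : ℝ))⁻¹) atTop (fun _ => 0) :=
    tendstoInMeasure_of_tendsto_ae (fun n => aestronglyMeasurable_const) (.of_forall fun _ =>
      (Real.tendsto_sqrt_atTop.comp tendsto_natCast_atTop_atTop).inv_tendsto_atTop)
  have h_mul := tendstoInMeasure_mul_of_integral_sq_le h_inv_sqrt hU hK
  rw [tendstoInMeasure_iff_norm] at h_mul ⊢
  intro ε hε
  refine (h_mul ε hε).congr' ?_
  filter_upwards [eventually_gt_atTop 0] with n hn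
  have h_ne : √(n : ℝ) ≠ 0 := (Real.sqrt_pos.2 (by exact_mod_cast hn)).ne'
  simp only [sub_zero, inv_mul_cancel_left₀ h_ne, norm_norm]

lemma tendstoInMeasure_delta_remainder [InnerProductSpace ℝ E] [CompleteSpace E]
    (hU : ∀ n : ℕ, Integrable (fun ω => (√(n : ℝ) * ‖U n ω - a‖) ^ 2) μ)
    (hK : ∀ n : ℕ, ∫ ω, (√(n : ℝ) * ‖U n ω - a‖) ^ 2 ∂μ ≤ K) {g : E → ℝ} {W : E}
    (hg : HasGradientAt g W a) :
    TendstoInMeasure μ (fun (n : ℕ) ω => √(n : ℝ) * (g (U n ω) - g a) -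
      √(n : ℝ) * inner ℝ W (U n ω - a)) atTop (fun _ => 0) := by
  let r : E → ℝ := fun u => ‖u - a‖⁻¹ * (g u - g a - inner ℝ W (u - a))
  have hr0 : r a = 0 := by simp only [r, sub_self, norm_zero, inv_zero, zero_mul]
  have hr : ContinuousAt r a := by
    rw [ContinuousAt, hr0, tendsto_zero_iff_norm_tendsto_zero]
    refine (hasFDerivAt_iff_tendsto.1 hg.hasFDerivAt).congr fun u => ?_
    rw [norm_mul, norm_inv, norm_norm, InnerProductSpace.toDual_apply_apply]
  have h_rem : TendstoInMeasure μ (fun n ω => r (U n ω)) atTop (fun _ => 0) := by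
    simpa only [hr0] using
      tendstoInMeasure_comp_continuousAt (tendstoInMeasure_of_integral_norm_sq_le hU hK) hr
  refine (tendstoInMeasure_mul_of_integral_sq_le h_rem hU hK).congr_left fun n =>
    .of_forall fun ω => ?_
  rcases eq_or_ne (U n ω) a with h_eq | h_ne
  · simp [h_eq]
  · have : ‖U n ω - a‖ ≠ 0 := norm_ne_zero_iff.2 (sub_ne_zero.2 h_ne)
    simp only [r]
    field_simp

end DeltaMethod

section SmoothFunctions

variable {Ω : Type*} {P X : ℝ≥0 → Ω → ℝ} {σ S lam : ℝ} {τ : ℝ≥0} {ι : Type*}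

/-- The vector of empirical variances at the lags `l`. -/
noncomputable def empVarVec (v : Scheme) (p : ℝ≥0 → Ω → ℝ) (τ : ℝ≥0) (l : ι → ℕ) (n : ℕ) (ω : Ω) :
    EuclideanSpace ℝ ι := WithLp.toLp 2 fun i => empVar v p τ n (l i) ω

/-- The vector of variances of the log-price increments at the lags `l`, the limit of
`empVarVec`. -/
noncomputable def varVec (σ S lam τ : ℝ) (l : ι → ℕ) : EuclideanSpace ℝ ι :=
  WithLp.toLp 2 fun i => priceVar σ S lam τ (l i)

lemma sqrt_mul_empVarVec_sub_apply (v : Scheme) (l : ι → ℕ) (n : ℕ) (ω : Ω) (i : ι) :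
    √(n : ℝ) * (empVarVec v (logPrice S P X) τ l n ω - varVec σ S lam τ l) i =
      scaledDev σ S lam τ P X v n (l i) ω := rfl

variable [Fintype ι]

lemma sq_sqrt_mul_norm_empVarVec_sub (v : Scheme) (l : ι → ℕ) (n : ℕ) (ω : Ω) :
    (√(n : ℝ) * ‖empVarVec v (logPrice S P X) τ l n ω - varVec σ S lam τ l‖) ^ 2 =
      ∑ i, scaledDev σ S lam τ P X v n (l i) ω ^ 2 := by
  simp only [mul_pow, EuclideanSpace.real_norm_sq_eq, Finset.mul_sum,
    ← sqrt_mul_empVarVec_sub_apply]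

lemma sqrt_mul_inner_empVarVec_sub (v : Scheme) (l : ι → ℕ) (n : ℕ) (ω : Ω)
    (W : EuclideanSpace ℝ ι) :
    √(n : ℝ) * inner ℝ W (empVarVec v (logPrice S P X) τ l n ω - varVec σ S lam τ l) =
      ∑ i, W i * scaledDev σ S lam τ P X v n (l i) ω := by
  simp only [PiLp.inner_apply, Real.inner_apply, Finset.mul_sum, mul_left_comm (√(n : ℝ)),
    sqrt_mul_empVarVec_sub_apply]

variable [MeasurableSpace Ω] {μ : Measure Ω} [IsProbabilityMeasure μ]
  (hσ : σ ≠ 0) (hS : S ≠ 0) (hP : IsBrownianWithVolatility P σ μ)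
  (hX : IsTradeDirection X S lam μ)
  (hPX : IndepFun (fun ω t => P t ω) (fun ω t => noise S X t ω) μ) (v : Scheme)

include hσ hS hP hX hPX

omit [Fintype ι] in
lemma aemeasurable_empVarVec (l : ι → ℕ) [Countable ι] (n : ℕ) :
    AEMeasurable (empVarVec v (logPrice S P X) τ l n) μ :=
  (WithLp.measurable_toLp 2 _).comp_aemeasurable (aemeasurable_pi_iff.2 fun i =>
    (memLp_empVar hσ hS hP hX hPX v n (l i)).aemeasurable)

lemma integrable_sq_sqrt_mul_norm_empVarVec_sub (l : ι → ℕ) (n : ℕ) :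
    Integrable (fun ω => (√(n : ℝ) *
      ‖empVarVec v (logPrice S P X) τ l n ω - varVec σ S lam τ l‖) ^ 2) μ := by
  simp only [sq_sqrt_mul_norm_empVarVec_sub]
  exact integrable_finsetSum _ fun i _ => (memLp_scaledDev hσ hS hP hX hPX v n (l i)).integrable_sq

lemma exists_integral_sq_sqrt_mul_norm_empVarVec_sub_le (hlam : lam ≠ 0) (hτ : τ ≠ 0) {l : ι → ℕ}
    (hl : ∀ i, 1 ≤ l i) :
    ∃ K, ∀ n : ℕ, ∫ ω, (√(n : ℝ) *
      ‖empVarVec v (logPrice S P X) τ l n ω - varVec σ S lam τ l‖) ^ 2 ∂μ ≤ K := by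
  obtain ⟨K, hK⟩ := (tendsto_finsetSum Finset.univ fun i _ =>
    tendsto_integral_sq_scaledDev (τ := τ) hσ hS hP hX hPX v hlam hτ (hl i)).bddAbove_range
  refine ⟨K, fun n => ?_⟩
  simp only [sq_sqrt_mul_norm_empVarVec_sub]
  rw [integral_finsetSum _ fun i _ => (memLp_scaledDev hσ hS hP hX hPX v n (l i)).integrable_sq]
  exact hK ⟨n, rfl⟩

omit [Fintype ι] in
theorem tendstoInMeasure_comp_empVarVec [Finite ι] (hlam : lam ≠ 0) (hτ : τ ≠ 0) {l : ι → ℕ}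
    (hl : ∀ i, 1 ≤ l i) {F : Type*} [PseudoEMetricSpace F] {g : EuclideanSpace ℝ ι → F}
    (hg : ContinuousAt g (varVec σ S lam τ l)) :
    TendstoInMeasure μ (fun n ω => g (empVarVec v (logPrice S P X) τ l n ω)) atTop
      (fun _ => g (varVec σ S lam τ l)) := by
  have := Fintype.ofFinite ι
  obtain ⟨K, hK⟩ :=
    exists_integral_sq_sqrt_mul_norm_empVarVec_sub_le hσ hS hP hX hPX v hlam hτ hl
  exact tendstoInMeasure_comp_continuousAt (tendstoInMeasure_of_integral_norm_sq_le
    (integrable_sq_sqrt_mul_norm_empVarVec_sub hσ hS hP hX hPX v l) hK) hg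

theorem asymptoticallyNormal_comp_empVarVec (hlam : 0 < lam) (hτ : 0 < τ) {l : ι → ℕ}
    (hl : ∀ i, 1 ≤ l i) {g : EuclideanSpace ℝ ι → ℝ} (hg_meas : Measurable g)
    {W : EuclideanSpace ℝ ι} (hg : HasGradientAt g W (varVec σ S lam τ l)) {w : ℝ}
    (hw : w = ∑ i, ∑ j, W i * W j *
      asympCov σ S lam τ v (l i) (l j) (limCorr μ v (logPrice S P X) τ (l i) (l j))) :
    AsymptoticallyNormal μ (fun n ω => g (empVarVec v (logPrice S P X) τ l n ω))
      (g (varVec σ S lam τ l)) w := by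
  obtain ⟨K, hK⟩ :=
    exists_integral_sq_sqrt_mul_norm_empVarVec_sub_le hσ hS hP hX hPX v hlam.ne' hτ.ne' hl
  obtain ⟨hw0, h_lim⟩ := tendstoInDistribution_sum_scaledDev hσ hS hP hX hPX v hlam hτ
    (fun i => W i) hl hw
  refine ⟨hw0, tendstoInDistribution_of_tendstoInMeasure_sub _ _ h_lim ?_ fun n => ?_⟩
  · have h_rem := tendstoInMeasure_delta_remainder
      (integrable_sq_sqrt_mul_norm_empVarVec_sub hσ hS hP hX hPX v l) hK hg
    simp only [sqrt_mul_inner_empVarVec_sub] at h_rem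
    exact h_rem
  · exact ((hg_meas.comp_aemeasurable
      (aemeasurable_empVarVec hσ hS hP hX hPX v l n)).sub_const _).const_mul _

end SmoothFunctions

section Denominators

variable {ρ : ℝ} (hρ0 : 0 < ρ) (hρ1 : ρ < 1)

include hρ0 hρ1

lemma nat_mul_pow_mul_one_sub_lt {L : ℕ} (hL : L ≠ 0) : L * ρ ^ L * (1 - ρ) < 1 - ρ ^ L := by
  rw [← geom_sum_mul_neg]
  refine mul_lt_mul_of_pos_right ?_ (sub_pos.2 hρ1)
  calc L * ρ ^ L = ∑ _i ∈ Finset.range L, ρ ^ L := by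
        rw [Finset.sum_const, Finset.card_range, nsmul_eq_mul]
    _ < ∑ i ∈ Finset.range L, ρ ^ i :=
        Finset.sum_lt_sum_of_nonempty (Finset.nonempty_range_iff.2 hL) fun i hi =>
          pow_lt_pow_right_of_lt_one₀ hρ0 hρ1 (Finset.mem_range.1 hi)

lemma strictAnti_one_sub_pow_div :
    StrictAnti fun L : ℕ => (1 - ρ ^ (L + 1)) / ((L + 1 : ℕ) : ℝ) := by
  refine strictAnti_nat_of_succ_lt fun L => ?_
  rw [div_lt_div_iff₀ (by positivity) (by positivity)]
  have h := nat_mul_pow_mul_one_sub_lt hρ0 hρ1 (Nat.add_one_ne_zero L)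
  push_cast at h ⊢
  linear_combination h

lemma mul_one_sub_pow_sub_ne_zero {L L' : ℕ} (hL : 1 ≤ L) (hL' : 1 ≤ L') (hne : L' ≠ L) :
    (L' : ℝ) * (1 - ρ ^ L) - L * (1 - ρ ^ L') ≠ 0 := by
  obtain ⟨a, rfl⟩ := Nat.exists_eq_add_of_le' hL
  obtain ⟨b, rfl⟩ := Nat.exists_eq_add_of_le' hL'
  intro h
  refine hne (congrArg (· + 1) ((strictAnti_one_sub_pow_div hρ0 hρ1).injective ?_))
  rw [div_eq_div_iff (by positivity) (by positivity)]
  linear_combination -h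

end Denominators

section DeterministicLimits

variable {σ S lam τ : ℝ}

lemma two_mul_priceVar_sub (L : ℕ) :
    2 * priceVar σ S lam τ L - priceVar σ S lam τ (2 * L) =
      S ^ 2 / 2 * (1 - Real.exp (-τ / lam) ^ L) ^ 2 := by
  rw [priceVar_eq, priceVar_eq, mul_comm 2 L, pow_mul]
  push_cast
  ring

lemma two_mul_priceVar_two_mul_sub (L : ℕ) :
    2 * priceVar σ S lam τ (2 * L) - priceVar σ S lam τ (4 * L) =
      S ^ 2 / 2 * (1 - (Real.exp (-τ / lam) ^ L) ^ 2) ^ 2 := by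
  rw [show 4 * L = 2 * (2 * L) by ring, two_mul_priceVar_sub, mul_comm 2 L, pow_mul]

variable (hlam : 0 < lam) (hτ : 0 < τ)

include hlam hτ

lemma exp_neg_div_lt_one : Real.exp (-τ / lam) < 1 :=
  Real.exp_lt_one_iff.2 (div_neg_of_neg_of_pos (neg_neg_of_pos hτ) hlam)

lemma exp_neg_div_pow_lt_one {L : ℕ} (hL : 1 ≤ L) : Real.exp (-τ / lam) ^ L < 1 :=
  pow_lt_one₀ (Real.exp_pos _).le (exp_neg_div_lt_one hlam hτ) (Nat.one_le_iff_ne_zero.1 hL)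

lemma spreadFormula_priceVar {L L' : ℕ} (hL : 1 ≤ L) (hL' : 1 ≤ L') (hne : L' ≠ L) :
    spreadFormula L L' (Real.exp (-τ / lam)) (priceVar σ S lam τ L) (priceVar σ S lam τ L') =
      S ^ 2 := by
  rw [spreadFormula, priceVar_eq, priceVar_eq, div_eq_iff
    (mul_one_sub_pow_sub_ne_zero (Real.exp_pos _) (exp_neg_div_lt_one hlam hτ) hL hL' hne)]
  ring

variable (hS : S ≠ 0) {L : ℕ} (hL : 1 ≤ L)

include hS hL

lemma two_mul_priceVar_sub_pos :
    0 < 2 * priceVar σ S lam τ L - priceVar σ S lam τ (2 * L) := by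
  rw [two_mul_priceVar_sub]
  have h_one_sub := sub_pos.2 (exp_neg_div_pow_lt_one hlam hτ hL)
  positivity

lemma two_mul_priceVar_two_mul_sub_pos :
    0 < 2 * priceVar σ S lam τ (2 * L) - priceVar σ S lam τ (4 * L) := by
  rw [show 4 * L = 2 * (2 * L) by ring]
  exact two_mul_priceVar_sub_pos hlam hτ hS (by lia)

end DeterministicLimits

section EstimatorFunctions

/-- The estimator of `ρ ^ L` as a function of the empirical variances `x`, `y`, `z` at the lags
`L`, `2 * L`, `4 * L`. -/
noncomputable def rhoPowFun (x y z : ℝ) : ℝ := √|(2 * y - z) / (2 * x - y)| - 1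

/-- The closed-form estimator as a function of the empirical variances at the lags
`L`, `2 * L`, `4 * L`. -/
noncomputable def closedFun (u : EuclideanSpace ℝ (Fin 3)) : ℝ :=
  2 * (2 * u 0 - u 1) ^ 2 / (2 * √|2 * u 0 - u 1| - √|2 * u 1 - u 2|) ^ 2

/-- The plug-in estimator for `(L', L'') = (2 * L, L)` as a function of the empirical variances
at the lags `L`, `2 * L`, `4 * L`. -/
noncomputable def plugInFun (L : ℕ) (u : EuclideanSpace ℝ (Fin 3)) : ℝ :=
  spreadFormula L (2 * L) (rhoPowFun (u 0) (u 1) (u 2) ^ (1 / (L : ℝ))) (u 0) (u 1)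

lemma measurable_closedFun : Measurable closedFun := by
  unfold closedFun
  fun_prop

lemma measurable_plugInFun (L : ℕ) : Measurable (plugInFun L) := by
  unfold plugInFun spreadFormula rhoPowFun
  fun_prop

section Continuity

variable {E : Type*} [TopologicalSpace E] {a : E} {x y z r : E → ℝ}

lemma continuousAt_rhoPowFun (hx : ContinuousAt x a) (hy : ContinuousAt y a)
    (hz : ContinuousAt z a) (h_ne : 2 * x a - y a ≠ 0) :
    ContinuousAt (fun u => rhoPowFun (x u) (y u) (z u)) a :=
  (((hy.const_mul 2).sub hz).div ((hx.const_mul 2).sub hy) h_ne).abs.sqrt.sub continuousAt_const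

lemma continuousAt_spreadFormula (L L' : ℕ) (hr : ContinuousAt r a) (hx : ContinuousAt x a)
    (hy : ContinuousAt y a) (h_ne : L' * (1 - r a ^ L) - L * (1 - r a ^ L') ≠ 0) :
    ContinuousAt (fun u => spreadFormula L L' (r u) (x u) (y u)) a :=
  (((hx.const_mul _).sub (hy.const_mul _)).const_mul 2).div
    (((continuousAt_const.sub (hr.pow L)).const_mul _).sub
      ((continuousAt_const.sub (hr.pow L')).const_mul _)) h_ne

end Continuity

lemma one_sub_rhoPowFun {x y z : ℝ} (hx : 0 < 2 * x - y) (hy : 0 ≤ 2 * y - z) :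
    1 - rhoPowFun x y z = (2 * √(2 * x - y) - √(2 * y - z)) / √(2 * x - y) := by
  have := Real.sqrt_pos.2 hx
  rw [rhoPowFun, abs_of_nonneg (div_nonneg hy hx.le), Real.sqrt_div hy]
  field_simp
  ring

lemma spreadFormula_two_mul {L : ℕ} (hL : L ≠ 0) (r x y : ℝ) :
    spreadFormula L (2 * L) r x y = 2 * (2 * x - y) / (1 - r ^ L) ^ 2 := by
  have hL' : (L : ℝ) ≠ 0 := Nat.cast_ne_zero.2 hL
  have h_num : 2 * (((2 * L : ℕ) : ℝ) * x - L * y) = L * (2 * (2 * x - y)) := by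
    push_cast
    ring
  have h_denom : ((2 * L : ℕ) : ℝ) * (1 - r ^ L) - L * (1 - r ^ (2 * L)) =
      L * (1 - r ^ L) ^ 2 := by
    rw [mul_comm 2 L, pow_mul]
    push_cast
    ring
  rw [spreadFormula, h_num, h_denom, mul_div_mul_left _ _ hL']

lemma closedFun_eq_hFun {u : EuclideanSpace ℝ (Fin 3)} (hx : 0 ≤ 2 * u 0 - u 1)
    (hy : 0 ≤ 2 * u 1 - u 2) : closedFun u = hFun u := by
  rw [closedFun, hFun, abs_of_nonneg hx, abs_of_nonneg hy]

lemma plugInFun_eq_hFun {L : ℕ} (hL : L ≠ 0) {u : EuclideanSpace ℝ (Fin 3)}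
    (hx : 0 < 2 * u 0 - u 1) (hy : 0 ≤ 2 * u 1 - u 2)
    (hr : 0 ≤ rhoPowFun (u 0) (u 1) (u 2)) : plugInFun L u = hFun u := by
  rw [plugInFun, spreadFormula_two_mul hL, one_div, Real.rpow_inv_natCast_pow hr hL,
    one_sub_rhoPowFun hx hy, div_pow, Real.sq_sqrt hx.le, div_div_eq_mul_div, hFun]
  ring

variable {σ S lam τ : ℝ} (hlam : 0 < lam) (hτ : 0 < τ) (hS : S ≠ 0) {L : ℕ} (hL : 1 ≤ L)

include hlam hτ hS hL

lemma rhoPowFun_priceVar :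
    rhoPowFun (priceVar σ S lam τ L) (priceVar σ S lam τ (2 * L)) (priceVar σ S lam τ (4 * L)) =
      Real.exp (-τ / lam) ^ L := by
  have h_one_sub := (sub_pos.2 (exp_neg_div_pow_lt_one hlam hτ hL)).ne'
  have h_pos : 0 < Real.exp (-τ / lam) ^ L := pow_pos (Real.exp_pos _) L
  rw [rhoPowFun, two_mul_priceVar_sub, two_mul_priceVar_two_mul_sub]
  generalize Real.exp (-τ / lam) ^ L = r at h_one_sub h_pos ⊢
  have h_ratio :
      S ^ 2 / 2 * (1 - r ^ 2) ^ 2 / (S ^ 2 / 2 * (1 - r) ^ 2) = (1 + r) ^ 2 := by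
    field_simp
    ring
  rw [h_ratio, abs_sq, Real.sqrt_sq (by positivity), add_sub_cancel_left]

lemma rhoPowFun_priceVar_rpow :
    rhoPowFun (priceVar σ S lam τ L) (priceVar σ S lam τ (2 * L)) (priceVar σ S lam τ (4 * L)) ^
      (1 / (L : ℝ)) = Real.exp (-τ / lam) := by
  rw [rhoPowFun_priceVar hlam hτ hS hL, one_div,
    Real.pow_rpow_inv_natCast (Real.exp_pos _).le (Nat.one_le_iff_ne_zero.1 hL)]

lemma plugInFun_priceVarVec : plugInFun L (priceVarVec σ S lam τ L) = S ^ 2 := by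
  change spreadFormula L (2 * L) (rhoPowFun (priceVar σ S lam τ L) (priceVar σ S lam τ (2 * L))
    (priceVar σ S lam τ (4 * L)) ^ (1 / (L : ℝ))) (priceVar σ S lam τ L)
    (priceVar σ S lam τ (2 * L)) = S ^ 2
  rw [rhoPowFun_priceVar_rpow hlam hτ hS hL,
    spreadFormula_priceVar hlam hτ hL (by lia) (by lia)]

lemma eventually_two_mul_sub_pos : ∀ᶠ u in 𝓝 (priceVarVec σ S lam τ L),
    0 < 2 * u 0 - u 1 ∧ 0 < 2 * u 1 - u 2 := by
  have hx : Continuous fun u : EuclideanSpace ℝ (Fin 3) => 2 * u 0 - u 1 := by fun_prop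
  have hy : Continuous fun u : EuclideanSpace ℝ (Fin 3) => 2 * u 1 - u 2 := by fun_prop
  exact ((isOpen_lt continuous_const hx).eventually_mem
    (two_mul_priceVar_sub_pos hlam hτ hS hL)).and ((isOpen_lt continuous_const hy).eventually_mem
      (two_mul_priceVar_two_mul_sub_pos hlam hτ hS hL))

lemma closedFun_eventuallyEq_hFun : closedFun =ᶠ[𝓝 (priceVarVec σ S lam τ L)] hFun := by
  filter_upwards [eventually_two_mul_sub_pos hlam hτ hS hL] with u hu
  exact closedFun_eq_hFun hu.1.le hu.2.le

lemma plugInFun_eventuallyEq_hFun : plugInFun L =ᶠ[𝓝 (priceVarVec σ S lam τ L)] hFun := by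
  have h_cont : ContinuousAt (fun u : EuclideanSpace ℝ (Fin 3) => rhoPowFun (u 0) (u 1) (u 2))
      (priceVarVec σ S lam τ L) :=
    continuousAt_rhoPowFun (by fun_prop) (by fun_prop) (by fun_prop)
      (two_mul_priceVar_sub_pos hlam hτ hS hL).ne'
  have h_pos : ∀ᶠ u in 𝓝 (priceVarVec σ S lam τ L), 0 < rhoPowFun (u 0) (u 1) (u 2) :=
    h_cont.eventually_const_lt ((pow_pos (Real.exp_pos _) L).trans_eq
      (rhoPowFun_priceVar hlam hτ hS hL).symm)
  filter_upwards [eventually_two_mul_sub_pos hlam hτ hS hL, h_pos] with u hu hr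
  exact plugInFun_eq_hFun (Nat.one_le_iff_ne_zero.1 hL) hu.1 hu.2.le hr.le

lemma hFun_priceVarVec : hFun (priceVarVec σ S lam τ L) = S ^ 2 := by
  rw [← (plugInFun_eventuallyEq_hFun hlam hτ hS hL).eq_of_nhds,
    plugInFun_priceVarVec hlam hτ hS hL]

lemma differentiableAt_hFun_priceVarVec :
    DifferentiableAt ℝ hFun (priceVarVec σ S lam τ L) := by
  have hx := two_mul_priceVar_sub_pos (σ := σ) hlam hτ hS hL
  have hy := two_mul_priceVar_two_mul_sub_pos (σ := σ) hlam hτ hS hL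
  have h_denom : 2 * √(2 * priceVar σ S lam τ L - priceVar σ S lam τ (2 * L)) -
      √(2 * priceVar σ S lam τ (2 * L) - priceVar σ S lam τ (4 * L)) ≠ 0 := by
    have h_one_sub := (sub_pos.2 (exp_neg_div_pow_lt_one hlam hτ hL)).ne'
    rw [← rhoPowFun_priceVar hlam hτ hS hL, one_sub_rhoPowFun hx hy.le] at h_one_sub
    exact (div_ne_zero_iff.1 h_one_sub).1
  have h_sqrt_x : DifferentiableAt ℝ (fun u : EuclideanSpace ℝ (Fin 3) => √(2 * u 0 - u 1))
      (priceVarVec σ S lam τ L) := DifferentiableAt.sqrt (by fun_prop) hx.ne'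
  have h_sqrt_y : DifferentiableAt ℝ (fun u : EuclideanSpace ℝ (Fin 3) => √(2 * u 1 - u 2))
      (priceVarVec σ S lam τ L) := DifferentiableAt.sqrt (by fun_prop) hy.ne'
  exact DifferentiableAt.fun_mul (by fun_prop)
    ((((h_sqrt_x.const_mul 2).fun_sub h_sqrt_y).fun_pow 2).fun_inv (pow_ne_zero 2 h_denom))

end EstimatorFunctions

section Estimators

/-- The gradient of `spreadFormula L L' ρ x y` in `(x, y)`, which is linear in these variables. -/
noncomputable def spreadGradient (L L' : ℕ) (ρ : ℝ) : EuclideanSpace ℝ (Fin 2) :=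
  (2 / (L' * (1 - ρ ^ L) - L * (1 - ρ ^ L')) : ℝ) • !₂[(L' : ℝ), -(L : ℝ)]

lemma hasGradientAt_spreadFormula (L L' : ℕ) (ρ : ℝ) (a : EuclideanSpace ℝ (Fin 2)) :
    HasGradientAt (fun u : EuclideanSpace ℝ (Fin 2) => spreadFormula L L' ρ (u 0) (u 1))
      (spreadGradient L L' ρ) a := by
  have h_inner : (fun u : EuclideanSpace ℝ (Fin 2) => spreadFormula L L' ρ (u 0) (u 1)) =
      InnerProductSpace.toDual ℝ _ (spreadGradient L L' ρ) := by
    ext u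
    simp only [InnerProductSpace.toDual_apply_apply, spreadGradient, PiLp.inner_apply,
      Fin.sum_univ_two, Real.inner_apply, PiLp.smul_apply, smul_eq_mul, Matrix.cons_val_zero,
      Matrix.cons_val_one, spreadFormula]
    ring
  rw [hasGradientAt_iff_hasFDerivAt, h_inner]
  exact (InnerProductSpace.toDual ℝ _ (spreadGradient L L' ρ)).hasFDerivAt

variable {Ω : Type*} [MeasurableSpace Ω] {μ : Measure Ω} [IsProbabilityMeasure μ]
  {P X : ℝ≥0 → Ω → ℝ} {σ S lam : ℝ} {τ : ℝ≥0}
  (hσ : σ ≠ 0) (hS : S ≠ 0) (hP : IsBrownianWithVolatility P σ μ)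
  (hX : IsTradeDirection X S lam μ)
  (hPX : IndepFun (fun ω t => P t ω) (fun ω t => noise S X t ω) μ) (v : Scheme)

include hσ hS hP hX hPX

lemma integrable_empVar (n L : ℕ) : Integrable (empVar v (logPrice S P X) τ n L) μ :=
  (memLp_empVar hσ hS hP hX hPX v n L).integrable one_le_two

lemma integrable_spreadEst (n L L' : ℕ) (ρ : ℝ) :
    Integrable (spreadEst v (logPrice S P X) τ n L L' ρ) μ :=
  ((((integrable_empVar hσ hS hP hX hPX v n L).const_mul _).sub
    ((integrable_empVar hσ hS hP hX hPX v n L').const_mul _)).const_mul 2).div_const _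

variable (hlam : 0 < lam) (hτ : 0 < τ) {L L' : ℕ} (hL : 1 ≤ L) (hL' : 1 ≤ L') (hne : L' ≠ L)

include hlam hτ hL hL' hne

theorem integral_spreadEst {n : ℕ} (hn : L < n) (hn' : L' < n) :
    ∫ ω, spreadEst v (logPrice S P X) τ n L L' (Real.exp (-τ / lam)) ω ∂μ = S ^ 2 := by
  simp only [spreadEst, spreadFormula]
  rw [integral_div, integral_const_mul, integral_sub
      ((integrable_empVar hσ hS hP hX hPX v n L).const_mul _)
      ((integrable_empVar hσ hS hP hX hPX v n L').const_mul _),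
    integral_const_mul, integral_const_mul, integral_empVar hσ hS hP hX hPX v hL hn,
    integral_empVar hσ hS hP hX hPX v hL' hn']
  exact spreadFormula_priceVar hlam (NNReal.coe_pos.2 hτ) hL hL' hne

theorem tendstoInMeasure_spreadEst :
    TendstoInMeasure μ
      (fun n : ℕ => spreadEst v (logPrice S P X) τ n L L' (Real.exp (-τ / lam))) atTop
      (fun _ => S ^ 2) := by
  have hl : ∀ i, 1 ≤ ![L, L'] i := Fin.forall_fin_two.2 ⟨hL, hL'⟩
  rw [← spreadFormula_priceVar (σ := σ) hlam (NNReal.coe_pos.2 hτ) hL hL' hne]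
  exact tendstoInMeasure_comp_empVarVec hσ hS hP hX hPX v hlam.ne' hτ.ne' hl
    (hasGradientAt_spreadFormula L L' _ _).continuousAt

theorem asymptoticallyNormal_spreadEst :
    AsymptoticallyNormal μ
      (fun n : ℕ => spreadEst v (logPrice S P X) τ n L L' (Real.exp (-τ / lam))) (S ^ 2)
      (gammaVar σ S lam τ v L L' (Real.exp (-τ / lam))
        (limCorr μ v (logPrice S P X) τ L L')) := by
  have hl : ∀ i, 1 ≤ ![L, L'] i := Fin.forall_fin_two.2 ⟨hL, hL'⟩
  have h_meas : Measurable fun u : EuclideanSpace ℝ (Fin 2) =>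
      spreadFormula L L' (Real.exp (-τ / lam)) (u 0) (u 1) := by
    unfold spreadFormula
    fun_prop
  rw [← spreadFormula_priceVar (σ := σ) hlam (NNReal.coe_pos.2 hτ) hL hL' hne]
  refine asymptoticallyNormal_comp_empVarVec hσ hS hP hX hPX v hlam hτ hl h_meas
    (hasGradientAt_spreadFormula L L' _ _) ?_
  simp only [Fin.sum_univ_two, spreadGradient, PiLp.smul_apply, smul_eq_mul,
    Matrix.cons_val_zero, Matrix.cons_val_one]
  rw [asympCov_self hσ hS hP hX hPX v hlam hτ hL, asympCov_self hσ hS hP hX hPX v hlam hτ hL',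
    asympCov_comm hσ hS hP hX hPX v hlam hτ hL' hL, gammaVar]
  generalize (L' : ℝ) * (1 - _) - L * (1 - _) = d
  ring

theorem tendstoInMeasure_spreadPlugIn {L'' : ℕ} (hL'' : 1 ≤ L'') :
    TendstoInMeasure μ (fun n : ℕ => spreadPlugIn v (logPrice S P X) τ n L L' L'') atTop
      (fun _ => S ^ 2) := by
  have hτ' : (0 : ℝ) < τ := NNReal.coe_pos.2 hτ
  let l : Fin 5 → ℕ := ![L, L', L'', 2 * L'', 4 * L'']
  have hl : ∀ i, 1 ≤ l i := by
    intro i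
    fin_cases i
    exacts [hL, hL', hL'', Nat.mul_pos two_pos hL'', Nat.mul_pos four_pos hL'']
  let r : EuclideanSpace ℝ (Fin 5) → ℝ := fun u => rhoPowFun (u 2) (u 3) (u 4) ^ (1 / (L'' : ℝ))
  have h_root : r (varVec σ S lam τ l) = Real.exp (-τ / lam) :=
    rhoPowFun_priceVar_rpow hlam hτ' hS hL''
  have hr : ContinuousAt r (varVec σ S lam τ l) :=
    (continuousAt_rhoPowFun (by fun_prop) (by fun_prop) (by fun_prop)
      (two_mul_priceVar_sub_pos hlam hτ' hS hL'').ne').rpow_const (Or.inr (by positivity))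
  have h_cont : ContinuousAt (fun u => spreadFormula L L' (r u) (u 0) (u 1))
      (varVec σ S lam τ l) := by
    refine continuousAt_spreadFormula L L' hr (by fun_prop) (by fun_prop) ?_
    rw [h_root]
    exact mul_one_sub_pow_sub_ne_zero (Real.exp_pos _) (exp_neg_div_lt_one hlam hτ') hL hL' hne
  rw [← spreadFormula_priceVar (σ := σ) hlam hτ' hL hL' hne, ← h_root]
  exact tendstoInMeasure_comp_empVarVec hσ hS hP hX hPX v hlam.ne' hτ.ne' hl h_cont

end Estimators

section PlugIn

variable {σ S lam : ℝ}

lemma empVarVec_two_pow_mul {Ω : Type*} (v : Scheme) (p : ℝ≥0 → Ω → ℝ) (τ : ℝ≥0) (L n : ℕ)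
    (ω : Ω) : empVarVec v p τ (fun i : Fin 3 => 2 ^ (i : ℕ) * L) n ω =
      !₂[empVar v p τ n L ω, empVar v p τ n (2 * L) ω, empVar v p τ n (4 * L) ω] := by
  ext i
  fin_cases i <;> simp [empVarVec]

lemma spreadPlugIn_eq_plugInFun {Ω : Type*} (v : Scheme) (p : ℝ≥0 → Ω → ℝ) (τ : ℝ≥0) (n L : ℕ) :
    spreadPlugIn v p τ n L (2 * L) L = fun ω => plugInFun L !₂[empVar v p τ n L ω,
      empVar v p τ n (2 * L) ω, empVar v p τ n (4 * L) ω] := rfl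

lemma spreadClosed_eq_closedFun {Ω : Type*} (v : Scheme) (p : ℝ≥0 → Ω → ℝ) (τ : ℝ≥0) (n L : ℕ) :
    spreadClosed v p τ n L = fun ω => closedFun !₂[empVar v p τ n L ω,
      empVar v p τ n (2 * L) ω, empVar v p τ n (4 * L) ω] := rfl

lemma varVec_two_pow_mul (σ S lam τ : ℝ) (L : ℕ) :
    varVec σ S lam τ (fun i : Fin 3 => 2 ^ (i : ℕ) * L) = priceVarVec σ S lam τ L := by
  ext i
  fin_cases i <;> simp [varVec, priceVarVec]

variable {Ω : Type*} [MeasurableSpace Ω] {μ : Measure Ω} [IsProbabilityMeasure μ]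
  {P X : ℝ≥0 → Ω → ℝ} {τ : ℝ≥0}

omit [IsProbabilityMeasure μ] in
lemma plugInVar_eq_sum (v : Scheme) (p : ℝ≥0 → Ω → ℝ) (L : ℕ) :
    plugInVar μ σ S lam τ v p L = ∑ i : Fin 3, ∑ j : Fin 3,
      gradient hFun (priceVarVec σ S lam τ L) i * gradient hFun (priceVarVec σ S lam τ L) j *
        asympCov σ S lam τ v (2 ^ (i : ℕ) * L) (2 ^ (j : ℕ) * L)
          (limCorr μ v p τ (2 ^ (i : ℕ) * L) (2 ^ (j : ℕ) * L)) := by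
  simp only [plugInVar, covMatrix, dotProduct, Matrix.mulVec, Matrix.of_apply, Finset.mul_sum]
  exact Finset.sum_congr rfl fun i _ => Finset.sum_congr rfl fun j _ => by ring

variable (hσ : σ ≠ 0) (hS : S ≠ 0) (hP : IsBrownianWithVolatility P σ μ)
  (hX : IsTradeDirection X S lam μ)
  (hPX : IndepFun (fun ω t => P t ω) (fun ω t => noise S X t ω) μ) (v : Scheme)
  (hlam : 0 < lam) (hτ : 0 < τ) {L : ℕ} (hL : 1 ≤ L)

include hσ hS hP hX hPX hlam hτ hL

theorem tendstoInMeasure_of_eventuallyEq_hFun {g : EuclideanSpace ℝ (Fin 3) → ℝ}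
    (hg : g =ᶠ[𝓝 (priceVarVec σ S lam τ L)] hFun) :
    TendstoInMeasure μ (fun n ω => g !₂[empVar v (logPrice S P X) τ n L ω,
      empVar v (logPrice S P X) τ n (2 * L) ω, empVar v (logPrice S P X) τ n (4 * L) ω]) atTop
      (fun _ => S ^ 2) := by
  have hτ' : (0 : ℝ) < τ := NNReal.coe_pos.2 hτ
  have h_cont : ContinuousAt g (priceVarVec σ S lam τ L) :=
    (differentiableAt_hFun_priceVarVec hlam hτ' hS hL).continuousAt.congr hg.symm
  rw [← varVec_two_pow_mul] at h_cont
  rw [← hFun_priceVarVec (σ := σ) hlam hτ' hS hL, ← hg.eq_of_nhds]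
  simp only [← empVarVec_two_pow_mul, ← varVec_two_pow_mul]
  exact tendstoInMeasure_comp_empVarVec hσ hS hP hX hPX v hlam.ne' hτ.ne'
    (fun i => Nat.mul_pos (by positivity) hL) h_cont

theorem asymptoticallyNormal_of_eventuallyEq_hFun {g : EuclideanSpace ℝ (Fin 3) → ℝ}
    (hg_meas : Measurable g) (hg : g =ᶠ[𝓝 (priceVarVec σ S lam τ L)] hFun) :
    AsymptoticallyNormal μ (fun n ω => g !₂[empVar v (logPrice S P X) τ n L ω,
      empVar v (logPrice S P X) τ n (2 * L) ω, empVar v (logPrice S P X) τ n (4 * L) ω])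
      (S ^ 2) (plugInVar μ σ S lam τ v (logPrice S P X) L) := by
  have hτ' : (0 : ℝ) < τ := NNReal.coe_pos.2 hτ
  have h_grad : HasGradientAt g (gradient hFun (priceVarVec σ S lam τ L))
      (priceVarVec σ S lam τ L) :=
    (differentiableAt_hFun_priceVarVec hlam hτ' hS hL).hasGradientAt.congr_of_eventuallyEq hg
  rw [← hFun_priceVarVec (σ := σ) hlam hτ' hS hL, ← hg.eq_of_nhds]
  simp only [← empVarVec_two_pow_mul]
  rw [← varVec_two_pow_mul] at h_grad ⊢
  refine asymptoticallyNormal_comp_empVarVec hσ hS hP hX hPX v hlam hτ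
    (fun i => Nat.mul_pos (by positivity) hL) hg_meas h_grad ?_
  rw [plugInVar_eq_sum, varVec_two_pow_mul]

theorem asymptoticallyNormal_spreadPlugIn :
    AsymptoticallyNormal μ (fun n : ℕ => spreadPlugIn v (logPrice S P X) τ n L (2 * L) L) (S ^ 2)
      (plugInVar μ σ S lam τ v (logPrice S P X) L) := by
  simp only [spreadPlugIn_eq_plugInFun]
  exact asymptoticallyNormal_of_eventuallyEq_hFun hσ hS hP hX hPX v hlam hτ hL
    (measurable_plugInFun L) (plugInFun_eventuallyEq_hFun hlam (NNReal.coe_pos.2 hτ) hS hL)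

theorem tendstoInMeasure_spreadClosed :
    TendstoInMeasure μ (fun n : ℕ => spreadClosed v (logPrice S P X) τ n L) atTop
      (fun _ => S ^ 2) := by
  simp only [spreadClosed_eq_closedFun]
  exact tendstoInMeasure_of_eventuallyEq_hFun hσ hS hP hX hPX v hlam hτ hL
    (closedFun_eventuallyEq_hFun hlam (NNReal.coe_pos.2 hτ) hS hL)

theorem asymptoticallyNormal_spreadClosed :
    AsymptoticallyNormal μ (fun n : ℕ => spreadClosed v (logPrice S P X) τ n L) (S ^ 2)
      (plugInVar μ σ S lam τ v (logPrice S P X) L) := by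
  simp only [spreadClosed_eq_closedFun]
  exact asymptoticallyNormal_of_eventuallyEq_hFun hσ hS hP hX hPX v hlam hτ hL measurable_closedFun
    (closedFun_eventuallyEq_hFun hlam (NNReal.coe_pos.2 hτ) hS hL)

end PlugIn

end SpreadEstimation

open SpreadEstimation in
theorem mainTheorem3 {Ω : Type*} [MeasurableSpace Ω] (μ : Measure Ω) [IsProbabilityMeasure μ]
    (σ S lam : ℝ) (τ : ℝ≥0) (hσ : 0 < σ) (hS : 0 < S) (hlam : 0 < lam) (hτ : 0 < τ)
    (P X : ℝ≥0 → Ω → ℝ)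
    (hP : IsBrownianWithVolatility P σ μ)
    (hX : IsTradeDirection X S lam μ)
    (hPX : IndepFun (fun ω t => P t ω) (fun ω t => noise S X t ω) μ)
    (v : Scheme) (p : ℝ≥0 → Ω → ℝ) (hp : p = logPrice S P X)
    (ρ : ℝ) (hρ : ρ = Real.exp (-(τ : ℝ) / lam)) :
    -- the limit correlations exist
    (∀ L L' : ℕ, 1 ≤ L → 1 ≤ L' →
      Tendsto (fun n : ℕ => corr μ (empVar v p τ n L) (empVar v p τ n L')) atTop
        (𝓝 (limCorr μ v p τ L L'))) ∧
    -- known dependence parameter: unbiased, consistent, asymptotically normal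
    (∀ L L' : ℕ, 1 ≤ L → 1 ≤ L' → L' ≠ L →
      (∀ n : ℕ, L < n → L' < n →
        Integrable (spreadEst v p τ n L L' ρ) μ ∧ ∫ ω, spreadEst v p τ n L L' ρ ω ∂μ = S ^ 2) ∧
      TendstoInMeasure μ (fun n : ℕ => spreadEst v p τ n L L' ρ) atTop (fun _ => S ^ 2) ∧
      AsymptoticallyNormal μ (fun n : ℕ => spreadEst v p τ n L L' ρ) (S ^ 2)
        (gammaVar σ S lam τ v L L' ρ (limCorr μ v p τ L L'))) ∧
    -- estimated dependence parameter: consistent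
    (∀ L L' L'' : ℕ, 1 ≤ L → 1 ≤ L' → 1 ≤ L'' → L' ≠ L →
      TendstoInMeasure μ (fun n : ℕ => spreadPlugIn v p τ n L L' L'') atTop (fun _ => S ^ 2)) ∧
    -- estimated dependence parameter: asymptotically normal for `(L', L'') = (2L, L)`,
    -- and likewise for the closed form of this estimator
    (∀ L : ℕ, 1 ≤ L →
      DifferentiableAt ℝ hFun (priceVarVec σ S lam τ L) ∧
      AsymptoticallyNormal μ (fun n : ℕ => spreadPlugIn v p τ n L (2 * L) L) (S ^ 2)
        (plugInVar μ σ S lam τ v p L) ∧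
      TendstoInMeasure μ (fun n : ℕ => spreadClosed v p τ n L) atTop (fun _ => S ^ 2) ∧
      AsymptoticallyNormal μ (fun n : ℕ => spreadClosed v p τ n L) (S ^ 2)
        (plugInVar μ σ S lam τ v p L)) := by
  subst hp hρ
  refine ⟨fun L L' hL hL' => tendsto_corr_empVar hσ.ne' hS.ne' hP hX hPX v hlam hτ hL hL',
    fun L L' hL hL' hne =>
      ⟨fun n hn hn' => ⟨integrable_spreadEst hσ.ne' hS.ne' hP hX hPX v n L L' _,
        integral_spreadEst hσ.ne' hS.ne' hP hX hPX v hlam hτ hL hL' hne hn hn'⟩,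
      tendstoInMeasure_spreadEst hσ.ne' hS.ne' hP hX hPX v hlam hτ hL hL' hne,
      asymptoticallyNormal_spreadEst hσ.ne' hS.ne' hP hX hPX v hlam hτ hL hL' hne⟩,
    fun L L' L'' hL hL' hL'' hne =>
      tendstoInMeasure_spreadPlugIn hσ.ne' hS.ne' hP hX hPX v hlam hτ hL hL' hne hL'',
    fun L hL => ⟨differentiableAt_hFun_priceVarVec hlam (NNReal.coe_pos.2 hτ) hS.ne' hL,
      asymptoticallyNormal_spreadPlugIn hσ.ne' hS.ne' hP hX hPX v hlam hτ hL,
      tendstoInMeasure_spreadClosed hσ.ne' hS.ne' hP hX hPX v hlam hτ hL,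
      asymptoticallyNormal_spreadClosed hσ.ne' hS.ne' hP hX hPX v hlam hτ hL⟩⟩
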